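/- \textbf{Lemma (fair near neighbor, approximate neighborhood).} Let $(M,d)$ be a metric space, $r\ge 0$, $c>1$, and suppose $M$ admits a locality sensitive hash family with parameters $(r,cr,p_1,p_2)$, $0<p_2<p_1\le 1$, $p_2<1$: a random function $h:M\to\mathbb N$ with $\Pr[h(x)=h(y)]\ge p_1$ if $d(x,y)\le r$ and $\Pr[h(x)=h(y)]\le p_2$ if $d(x,y)>cr$. For $n\ge 1$ put $$k=\Big\lceil \tfrac{\ln n}{\ln(1/p_2)}\Big\rceil,\qquad L=\lceil p_1^{-k}\rceil,\qquad Q(n,c)=L\,(k+1),\qquad S(n,c)=L\,(n+k),$$ the query time and the space of the standard LSH data structure, which has $L$ bucket functions, each a concatenation of $k$ functions of the family (for fixed $p_1,p_2$ these are $\tilde O(L)$ and $\tilde O(nL)$). For $q\in M$ and a set $P\subseteq M$ of $n$ points let $N(q,\rho)=\{x\in P: d(q,x)\le\rho\}$. The machine model is a randomized random access machine: its unit-cost instructions are assignment, addition and truncated subtraction of natural numbers, comparison, indirect memory access, drawing a uniform element of $\{0,\dots,m-1\}$, evaluating one of the drawn hash functions at the query or at a data point, and testing whether a data point is at distance $\le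 cr$ from the query. There are a preprocessing program and a query program such that for every $b\in\mathbb N$ there are constants $C,a$ and numbers $t(n)\le C(1+\ln n)$, depending only on $b$, with the following properties for all $M,r,c$, hash families, and sets $P$ of $n\ge1$ points. Draw $N=t(n)\,L\,k$ independent functions of the family. 1. (Space.) For every outcome of the draw, the preprocessing program halts and leaves a data structure $D$. The number $N$ of hash functions and every number stored in $D$ are at most $C\,S(n,c)\,(1+\ln(nL))^a$, and neither preprocessing nor any query (which does not modify $D$) ever uses a working memory cell with an address $\ge C\,S(n,c)\,(1+\ln(nL))^a$; so the space is $\tilde O(S(n,c))$. 2. (Output.) For every $q\in M$ there is a set $S\subseteq P$, determined by $q$ and the drawn hash functions, such that always $S\subseteq N(q,cr)$, and $N(q,r)\subseteq S\subseteq N(q,cr)$ with probability at least $1-n^{-b}$ over the draw. For every outcome of the draw and every $\varepsilon\in(0,1)$, the query program, given $q$ and $\lceil 1/\varepsilon\rceil$, reports each $p\in S$ with a probability $\mu_p$ (over the random choices of the query) satisfying $$\frac{1}{(1+\varepsilon)\,|S|}\ \le\ \mu_p\ \le\ \frac{1+\varepsilon}{|S|},$$ where $\sum_{p\in S}\mu_p=1$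 if $S\ne\emptyset$, and no point outside $S$ is ever reported; if $S=\emptyset$, it reports with probability $1$ that there is no point. 3. (Query time.) For every $q\in M$ and $\varepsilon\in(0,1)$, the expected number of steps of the query, over the draw of the hash functions and the random choices of the query, is at most $$C\; Q(n,c)\;\ln(2/\varepsilon)\;(1+\ln(nL))^a ,$$ that is, $\tilde O(Q(n,c)\log(1/\varepsilon))$. -/

import Mathlib

open MeasureTheory
open scoped ENNReal

universe u v

noncomputable section

namespace FairNN

/-! ### A randomized random access machine with unit-cost instructions -/

/-- Programs of the machine.  Arguments of instructions are numbers of registers; registers and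
memory cells hold natural numbers, and the data array can only be read. -/
inductive Prog : Type
  /-- do nothing -/
  | skip : Prog
  /-- `R[d] := v` -/
  | const (d v : ℕ) : Prog
  /-- `R[d] := R[a] + R[b]` -/
  | add (d a b : ℕ) : Prog
  /-- `R[d] := R[a] - R[b]`, truncated at zero -/
  | sub (d a b : ℕ) : Prog
  /-- `R[d] := data[R[a]]` -/
  | read (d a : ℕ) : Prog
  /-- `R[d] := mem[R[a]]` -/
  | load (d a : ℕ) : Prog
  /-- `mem[R[a]] := R[b]` -/
  | store (a b : ℕ) : Prog
  /-- `R[d] :=` a fresh uniform element of `{0, …, R[a] - 1}` (`0` if `R[a] = 0`) -/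
  | rand (d a : ℕ) : Prog
  /-- `R[d] :=` the value of hash function number `R[l]` at point number `R[x]` -/
  | hash (d l x : ℕ) : Prog
  /-- `R[d] := 1` if point number `R[x]` is not an outlier for the query, and `0` otherwise -/
  | near (d x : ℕ) : Prog
  /-- sequential composition -/
  | seq (p p' : Prog) : Prog
  /-- `if R[a] < R[b] then p else p'` -/
  | ite (a b : ℕ) (p p' : Prog) : Prog
  /-- `while R[a] < R[b] do p` -/
  | loop (a b : ℕ) (p : Prog) : Prog

/-- The access of a program to the hash functions, the points and the metric. -/
structure Oracle where
  hash : ℕ → ℕ → ℕ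
  near : ℕ → Prop

/-- Contents of the registers and of the working memory. -/
structure State where
  reg : ℕ → ℕ
  mem : ℕ → ℕ

/-- Assignment to a register. -/
def State.set (s : State) (d v : ℕ) : State := ⟨Function.update s.reg d v, s.mem⟩

/-- Assignment to a memory cell. -/
def State.put (s : State) (a v : ℕ) : State := ⟨s.reg, Function.update s.mem a v⟩

/-- A configuration: the stack of programs still to be executed, and the state.  The machine has
halted when the stack is empty. -/
abbrev Conf : Type := List Prog × State

/-- The uniform distribution on `{0, …, m - 1}`, and the point mass at `0` if `m = 0`. -/
def uniformBelow : ℕ → PMF ℕ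
  | 0 => PMF.pure 0
  | m + 1 => (PMF.uniformOfFintype (Fin (m + 1))).map (fun i : Fin (m + 1) => (i : ℕ))

open Classical in
/-- One step of the machine with oracle `O` and data array `data`. -/
def step (O : Oracle) (data : ℕ → ℕ) : Conf → PMF Conf
  | ([], s) => PMF.pure ([], s)
  | (.skip :: K, s) => PMF.pure (K, s)
  | (.const d v :: K, s) => PMF.pure (K, s.set d v)
  | (.add d a b :: K, s) => PMF.pure (K, s.set d (s.reg a + s.reg b))
  | (.sub d a b :: K, s) => PMF.pure (K, s.set d (s.reg a - s.reg b))
  | (.read d a :: K, s) => PMF.pure (K, s.set d (data (s.reg a)))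
  | (.load d a :: K, s) => PMF.pure (K, s.set d (s.mem (s.reg a)))
  | (.store a b :: K, s) => PMF.pure (K, s.put (s.reg a) (s.reg b))
  | (.rand d a :: K, s) => (uniformBelow (s.reg a)).map (fun v => (K, s.set d v))
  | (.hash d l x :: K, s) => PMF.pure (K, s.set d (O.hash (s.reg l) (s.reg x)))
  | (.near d x :: K, s) => PMF.pure (K, s.set d (if O.near (s.reg x) then 1 else 0))
  | (.seq p p' :: K, s) => PMF.pure (p :: p' :: K, s)
  | (.ite a b p p' :: K, s) => PMF.pure (if s.reg a < s.reg b then p :: K else p' :: K, s)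
  | (.loop a b p :: K, s) =>
      PMF.pure (if s.reg a < s.reg b then p :: .loop a b p :: K else K, s)

/-- The distribution of the configuration after a number of steps, from the configuration `c`. -/
def run (O : Oracle) (data : ℕ → ℕ) (c : Conf) : ℕ → PMF Conf
  | 0 => PMF.pure c
  | T + 1 => (run O data c T).bind (step O data)

/-- The start of program `p` on the given inputs, which are placed in registers `0, 1, …`; all
other registers and the working memory are zero. -/
def start (p : Prog) (inputs : List ℕ) : Conf :=
  ([p], ⟨fun i => inputs.getD i 0, fun _ => 0⟩)

/-- The probability that the machine halts with the number `v` in register `0`. -/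
def outputProb (O : Oracle) (data : ℕ → ℕ) (c : Conf) (v : ℕ) : ℝ≥0∞ :=
  ⨆ T : ℕ, (run O data c T).toOuterMeasure {c' | c'.1 = [] ∧ c'.2.reg 0 = v}

/-- The expected number of steps until the machine halts, `E[τ] = ∑_T P(τ > T)`. -/
def expectedTime (O : Oracle) (data : ℕ → ℕ) (c : Conf) : ℝ≥0∞ :=
  ∑' T : ℕ, (run O data c T).toOuterMeasure {c' | c'.1 ≠ []}

/-- At no time, whatever the random choices, is there a nonzero cell of the working memory at an
address `≥ B`. -/
def UsesSpace (O : Oracle) (data : ℕ → ℕ) (c : Conf) (B : ℝ) : Prop :=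
  ∀ T : ℕ, ∀ c' ∈ (run O data c T).support, ∀ a : ℕ, c'.2.mem a ≠ 0 → (a : ℝ) < B

/-- The machine halts after boundedly many steps, in a state that does not depend on random choices,
with memory contents `m`. -/
def HaltsWithMemory (O : Oracle) (data : ℕ → ℕ) (c : Conf) (m : ℕ → ℕ) : Prop :=
  ∃ (T : ℕ) (s : State), run O data c T = PMF.pure ([], s) ∧ s.mem = m

/-! ### Neighborhoods and locality sensitive hashing -/

variable {X : Type*} [MetricSpace X] {H : Type*}

/-- The `r`-neighborhood of `q` in the point set `P`. -/
def nbr {n : ℕ} (P : Fin n ↪ X) (q : X) (r : ℝ) : Set X :=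
  {x | x ∈ Set.range P ∧ dist q x ≤ r}

/-- A locality sensitive hash family with parameters `(r, c r, p₁, p₂)`: random functions
`h ω : X → ℕ` under which near points collide with probability at least `p₁` and far points with
probability at most `p₂ < p₁`. -/
structure IsLSHFamily [MeasurableSpace H] (ν : Measure H) (h : H → X → ℕ)
    (r c p₁ p₂ : ℝ) : Prop where
  measurable : ∀ x, Measurable (fun ω => h ω x)
  p₂_pos : 0 < p₂
  p₂_lt_p₁ : p₂ < p₁
  p₂_lt_one : p₂ < 1
  near : ∀ x y, dist x y ≤ r → p₁ ≤ ν.real {ω | h ω x = h ω y}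
  far : ∀ x y, c * r < dist x y → ν.real {ω | h ω x = h ω y} ≤ p₂

/-- The number of functions of the family that are concatenated to one bucket function `g`. -/
def lshK (n : ℕ) (p₂ : ℝ) : ℕ := ⌈Real.log n / Real.log (1 / p₂)⌉₊

/-- The number of bucket functions `g₁, …, g_L` in one LSH data structure for `n` points. -/
def lshL (n : ℕ) (p₁ p₂ : ℝ) : ℕ := ⌈(1 / p₁) ^ lshK n p₂⌉₊

/-- Query time of one LSH data structure: for each of the `L` bucket functions, evaluate `k` hash
functions and look at a constant number of points. -/
def lshQuery (n : ℕ) (p₁ p₂ : ℝ) : ℝ := lshL n p₁ p₂ * (lshK n p₂ + 1)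

/-- Space of one LSH data structure: for each of the `L` bucket functions, its `k` hash functions
and the `n` hashed points. -/
def lshSpace (n : ℕ) (p₁ p₂ : ℝ) : ℝ := lshL n p₁ p₂ * (n + lshK n p₂)

/-- The polylogarithmic factor hidden in the tilde notation, `(1 + log (n L)) ^ a`.  For a fixed
family, `log (n L) = O(1 + log n)`. -/
def polylog (n : ℕ) (p₁ p₂ : ℝ) (a : ℕ) : ℝ := (1 + Real.log (n * lshL n p₁ p₂)) ^ a

/-- Points as seen by a program: number `0` is the query (if there is one), number `i + 1` is the
data point `P i`. -/
def point {n : ℕ} (P : Fin n ↪ X) (q : Option X) : ℕ → Option X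
  | 0 => q
  | i + 1 => if hi : i < n then some (P ⟨i, hi⟩) else none

/-- The oracle for the data set `P`, the drawn hash functions `h (ω 0), …, h (ω (N - 1))`, the
query `q` (`none` during preprocessing) and the outlier radius `R`. -/
def oracle {n N : ℕ} (h : H → X → ℕ) (P : Fin n ↪ X) (ω : Fin N → H) (q : Option X) (R : ℝ) :
    Oracle where
  hash l x := if hl : l < N then (point P q x).elim 0 (h (ω ⟨l, hl⟩)) else 0
  near x := ∃ y ∈ q, ∃ z ∈ point P q x, dist y z ≤ R

/-- `μ` (where `μ (i + 1)` is the probability that `P i` is reported, and `μ 0` the probability of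
the answer that there is no point to report) is a `(1 + ε)`-approximately uniform probability
distribution on the subset `S` of the data; if `S` is empty, the answer is that there is no
point. -/
def ApproxUniformOn {n : ℕ} (P : Fin n ↪ X) (S : Finset X) (ε : ℝ) (μ : ℕ → ℝ≥0∞) : Prop :=
  (∀ i : Fin n, P i ∈ S →
      1 / (S.card : ℝ) / (1 + ε) ≤ (μ (i + 1)).toReal ∧
      (μ (i + 1)).toReal ≤ (1 + ε) * (1 / (S.card : ℝ))) ∧
  (∀ i : Fin n, P i ∉ S → μ (i + 1) = 0) ∧
  (S.Nonempty → ∑ i : Fin n, μ (i + 1) = 1) ∧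
  (S = ∅ → μ 0 = 1)

end FairNN

end

/-!
The data structure consists of `m = t L` hash tables, `t = ⌈(b + 1) log n⌉ + 1`. The set `S`
reported from is the set of all points at distance at most `c r` from the query `q` that share a
bucket with it in at least one of the tables. A near point shares a bucket with `q` in a given table
with probability at least `p₁ ^ k`, independently over the tables, so a union bound shows that `S`
contains the whole `r`-neighborhood with probability at least `1 - n ^ (-b)`
(`measure_near_subset_found`, `failure_le`). As `n p₂ ^ k ≤ 1`, the expected number of far points in
the buckets of `q`, counted with multiplicity, is at most `m` (`lintegral_farSlots_le`).

A query draws from `S` by rejection sampling. It draws a pair of a table `i` and a member `x` of the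
bucket of `q` in table `i`, uniformly among all such pairs. If `x` is at distance at most `c r`, it
draws tables until it meets one, `j`, in which `x` and `q` share a bucket, and reports `x` if `j =
i`; otherwise it starts again. As `j` is uniform on the tables in which `x` shares a bucket with
`q`, a point in `d` buckets is accepted with probability exactly `1 / d`, which cancels its `d`
chances of being drawn, without `d` ever being computed. Hence the output is exactly uniform on `S`,
for every `ε`. The acceptance test for `x` draws `m / d` tables in expectation, so that one round
draws `m |S| / W` tables in expectation, where `W` is the number of pairs. There are `W / |S|`
rounds in expectation, and `W ≤ m |S| + far`, where `far` is the number of pairs with a far point.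
Altogether a query takes `O(log (n + m)) (k + 1) (m + far + 1)` steps in expectation
(`queryProg_le`, `queryTime_le`).

The buckets of `q` are located by binary search, so preprocessing has to sort the points in each
table by their keys (`keyCmp`, `IsDS`, `preProg_spec`). It computes the position of each point by
counting the points before it, which is slow but needs no working memory. The machine can neither
multiply nor divide: table `i` uses the hash functions `i, i + m, i + 2 m, …`, and binary search
reads the powers of two from the data structure.

The programs are analysed with an expectation transformer `wp`, which bounds from above the expected
number of steps and the expected value of a function of the final state (`cost_le_wp`), and is
infinite if the space bound may be violated. Upper bounds suffice for the output distribution too: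
no point of `S` has a probability above `1 / |S|`, and the probabilities add up to one because the
expected time is finite (`outputProb_query`).
-/

open scoped NNReal

namespace FairNN

/-! ### Expectations -/

/-- The expectation of a nonnegative function under a probability mass function. -/
noncomputable def avg {α : Type*} (μ : PMF α) (f : α → ℝ≥0∞) : ℝ≥0∞ := ∑' x, μ x * f x

lemma avg_pure {α : Type*} (x : α) (f : α → ℝ≥0∞) : avg (PMF.pure x) f = f x := by
  unfold avg
  rw [tsum_eq_single x]
  · simp
  · intro y hy; simp [hy]

lemma avg_bind {α β : Type*} (μ : PMF α) (κ : α → PMF β) (f : β → ℝ≥0∞) :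
    avg (μ.bind κ) f = avg μ (fun x => avg (κ x) f) := by
  unfold avg
  simp only [PMF.bind_apply, ← ENNReal.tsum_mul_right, ← ENNReal.tsum_mul_left]
  rw [ENNReal.tsum_comm]
  simp only [mul_assoc]

lemma avg_map {α β : Type*} (μ : PMF α) (g : α → β) (f : β → ℝ≥0∞) :
    avg (μ.map g) f = avg μ (fun x => f (g x)) := by
  rw [PMF.map, avg_bind]
  simp [avg_pure]

lemma avg_mono {α : Type*} (μ : PMF α) {f g : α → ℝ≥0∞} (h : ∀ x, f x ≤ g x) :
    avg μ f ≤ avg μ g :=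
  ENNReal.tsum_le_tsum fun x => mul_le_mul_right (h x) _

lemma avg_eq_top {α : Type*} (μ : PMF α) (f : α → ℝ≥0∞) (x : α) (hx : x ∈ μ.support)
    (hf : f x = ⊤) : avg μ f = ⊤ := by
  apply ENNReal.tsum_eq_top_of_eq_top ⟨x, _⟩
  rw [hf, ENNReal.mul_top]
  exact (PMF.mem_support_iff _ _).1 hx

lemma avg_sum {α ι : Type*} (μ : PMF α) (t : Finset ι) (f : ι → α → ℝ≥0∞) :
    avg μ (fun x => ∑ i ∈ t, f i x) = ∑ i ∈ t, avg μ (f i) := by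
  unfold avg
  simp only [Finset.mul_sum]
  exact Summable.tsum_finsetSum fun i _ => ENNReal.summable

lemma toOuterMeasure_eq_avg {α : Type*} (μ : PMF α) (A : Set α) :
    μ.toOuterMeasure A = avg μ (A.indicator 1) := by
  classical
  rw [PMF.toOuterMeasure_apply]
  refine tsum_congr fun x => ?_
  by_cases hx : x ∈ A <;> simp [hx]

lemma avg_uniformBelow {m : ℕ} (hm : 0 < m) (f : ℕ → ℝ≥0∞) :
    avg (uniformBelow m) f = (∑ v ∈ Finset.range m, f v) / m := by
  obtain ⟨m, rfl⟩ : ∃ m', m = m' + 1 := ⟨m - 1, by omega⟩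
  rw [uniformBelow, avg_map, avg, tsum_fintype, ENNReal.div_eq_inv_mul, Finset.mul_sum,
    ← Fin.sum_univ_eq_sum_range (fun v => ((m + 1 : ℕ) : ℝ≥0∞)⁻¹ * f v)]
  simp

/-! ### Weakest preconditions for expected cost -/

section wp

variable (O : Oracle) (data : ℕ → ℕ) (c : ℝ≥0∞) (B : ℕ)

/-- The expectation transformer of a program: `wp p f s` bounds the expected value of `f` in the
final state plus `c` times the number of steps, when `p` is started in the state `s`.  It is infinite
if a cell with address `≥ B` may be written.  For a loop it is the least pre-fixed point. -/
noncomputable def wp : Prog → (State → ℝ≥0∞) → State → ℝ≥0∞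
  | .skip, f, s => c + f s
  | .const d v, f, s => c + f (s.set d v)
  | .add d a b, f, s => c + f (s.set d (s.reg a + s.reg b))
  | .sub d a b, f, s => c + f (s.set d (s.reg a - s.reg b))
  | .read d a, f, s => c + f (s.set d (data (s.reg a)))
  | .load d a, f, s => c + f (s.set d (s.mem (s.reg a)))
  | .store a b, f, s => if s.reg a < B then c + f (s.put (s.reg a) (s.reg b)) else ⊤
  | .rand d a, f, s => c + avg (uniformBelow (s.reg a)) (fun v => f (s.set d v))
  | .hash d l x, f, s => c + f (s.set d (O.hash (s.reg l) (s.reg x)))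
  | .near d x, f, s => c + f (s.set d (open Classical in if O.near (s.reg x) then 1 else 0))
  | .seq p p', f, s => c + wp p (wp p' f) s
  | .ite a b p p', f, s => c + if s.reg a < s.reg b then wp p f s else wp p' f s
  | .loop a b p, f, s =>
      ⨅ I : {I : State → ℝ≥0∞ //
        ∀ s, c + (if s.reg a < s.reg b then wp p I s else f s) ≤ I s}, I.1 s

/-- No memory cell with address `≥ B` is in use. -/
def Good (s : State) : Prop := ∀ a, s.mem a ≠ 0 → a < B

variable {O data c B}

lemma Good.set {s : State} (h : Good B s) (d v : ℕ) : Good B (s.set d v) := h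

lemma Good.put {s : State} (h : Good B s) {a : ℕ} (ha : a < B) (v : ℕ) : Good B (s.put a v) := by
  intro a' ha'
  by_cases e : a' = a
  · exact e ▸ ha
  · exact h a' (by simpa [State.put, Function.update_of_ne e] using ha')

/-- Monotonicity, where only states that respect the space bound matter. -/
lemma wp_mono_good (p : Prog) : ∀ {f g : State → ℝ≥0∞} {s : State}, Good B s →
    (∀ s', Good B s' → f s' ≤ g s') → wp O data c B p f s ≤ wp O data c B p g s := by
  induction p with
  | skip => intro f g s hs h; simp only [wp]; gcongr; exact h _ hs
  | const d v => intro f g s hs h; simp only [wp]; gcongr; exact h _ (hs.set _ _)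
  | add d v => intro f g s hs h; simp only [wp]; gcongr; exact h _ (hs.set _ _)
  | sub d v => intro f g s hs h; simp only [wp]; gcongr; exact h _ (hs.set _ _)
  | read d v => intro f g s hs h; simp only [wp]; gcongr; exact h _ (hs.set _ _)
  | load d v => intro f g s hs h; simp only [wp]; gcongr; exact h _ (hs.set _ _)
  | store a b =>
    intro f g s hs h; simp only [wp]
    split_ifs with ha
    · gcongr; exact h _ (hs.put ha _)
    · exact le_rfl
  | rand d a =>
    intro f g s hs h; simp only [wp]; gcongr; exact avg_mono _ fun v => h _ (hs.set _ _)
  | hash d l x => intro f g s hs h; simp only [wp]; gcongr; exact h _ (hs.set _ _)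
  | near d x => intro f g s hs h; simp only [wp]; gcongr; exact h _ (hs.set _ _)
  | seq p p' ih ih' =>
    intro f g s hs h; simp only [wp]; gcongr
    exact ih hs fun s' hs' => ih' hs' h
  | ite a b p p' ih ih' =>
    intro f g s hs h; simp only [wp]; gcongr
    split_ifs
    · exact ih hs h
    · exact ih' hs h
  | loop a b p ih =>
    intro f g s hs h
    simp only [wp]
    refine le_iInf fun I => ?_
    classical
    -- a bound for `g` becomes a bound for `f` once it is made infinite off the good states
    have hI : ∀ s, c + (if s.reg a < s.reg b then
        wp O data c B p (fun s => if Good B s then I.1 s else ⊤) s else f s) ≤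
          if Good B s then I.1 s else ⊤ := by
      intro s'
      by_cases hs' : Good B s'
      · simp only [hs', if_true]
        refine le_trans ?_ (I.2 s')
        gcongr
        split_ifs
        · exact ih hs' fun s'' hs'' => by simp [hs'']
        · exact h _ hs'
      · simp [hs']
    refine (iInf_le _ ⟨_, hI⟩).trans ?_
    simp [hs]

lemma wp_mono (p : Prog) : ∀ {f g : State → ℝ≥0∞} (s : State),
    (∀ s', f s' ≤ g s') → wp O data c B p f s ≤ wp O data c B p g s := by
  induction p with
  | skip => intro f g s h; simp only [wp]; gcongr; exact h _
  | const d v => intro f g s h; simp only [wp]; gcongr; exact h _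
  | add d v => intro f g s h; simp only [wp]; gcongr; exact h _
  | sub d v => intro f g s h; simp only [wp]; gcongr; exact h _
  | read d v => intro f g s h; simp only [wp]; gcongr; exact h _
  | load d v => intro f g s h; simp only [wp]; gcongr; exact h _
  | store a b =>
    intro f g s h; simp only [wp]
    split_ifs with ha
    · gcongr; exact h _
    · exact le_rfl
  | rand d a => intro f g s h; simp only [wp]; gcongr; exact avg_mono _ fun v => h _
  | hash d l x => intro f g s h; simp only [wp]; gcongr; exact h _
  | near d x => intro f g s h; simp only [wp]; gcongr; exact h _
  | seq p p' ih ih' => intro f g s h; simp only [wp]; gcongr; exact ih s fun s' => ih' s' h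
  | ite a b p p' ih ih' =>
    intro f g s h; simp only [wp]; gcongr
    split_ifs
    · exact ih s h
    · exact ih' s h
  | loop a b p ih =>
    intro f g s h
    simp only [wp]
    refine le_iInf fun I => iInf_le_of_le ⟨I.1, fun s' => (le_trans ?_ (I.2 s'))⟩ le_rfl
    gcongr
    split_ifs
    · exact le_rfl
    · exact h _

/-- Park induction: a pre-fixed point bounds the expected cost of a loop. -/
lemma wp_loop_le {a b : ℕ} {p : Prog} {f : State → ℝ≥0∞} (I : State → ℝ≥0∞)
    (hI : ∀ s, c + (if s.reg a < s.reg b then wp O data c B p I s else f s) ≤ I s) (s : State) :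
    wp O data c B (.loop a b p) f s ≤ I s := by
  simp only [wp]
  exact iInf_le_of_le ⟨I, hI⟩ le_rfl

/-- The pre-fixed point that defines the expected cost of a loop is a fixed point (only one
inequality is needed). -/
lemma wp_loop_unfold (a b : ℕ) (p : Prog) (f : State → ℝ≥0∞) (s : State) :
    wp O data c B (.loop a b p) f s ≤
      c + if s.reg a < s.reg b then wp O data c B p (wp O data c B (.loop a b p) f) s else f s := by
  refine wp_loop_le (fun s => c + if s.reg a < s.reg b then
    wp O data c B p (wp O data c B (.loop a b p) f) s else f s) (fun s => ?_) s
  gcongr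
  split_ifs with h
  · refine wp_mono p s fun s' => ?_
    conv_rhs => rw [wp]
    refine le_iInf fun I => le_trans ?_ (I.2 s')
    gcongr
    split_ifs
    · exact wp_mono p s' fun s'' => wp_loop_le I.1 I.2 s''
    · exact le_rfl
  · exact le_rfl

/-! ### Soundness for the small-step semantics -/

variable (O data c B) in
open Classical in
/-- The expected cost of the first `T` steps from a configuration: `c` for each step, and `Φ` of the
final state if the machine halts in time.  The cost is infinite if the space bound may be
violated. -/
noncomputable def cost (Φ : State → ℝ≥0∞) : ℕ → Conf → ℝ≥0∞
  | 0, x => if Good B x.2 then 0 else ⊤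
  | T + 1, x =>
    if Good B x.2 then
      if x.1 = [] then Φ x.2 else c + avg (step O data x) (cost Φ T)
    else ⊤

lemma cost_le_succ (Φ : State → ℝ≥0∞) (T : ℕ) :
    ∀ x, cost O data c B Φ T x ≤ cost O data c B Φ (T + 1) x := by
  induction T with
  | zero => intro x; simp only [cost]; split_ifs <;> simp
  | succ T ih =>
    intro x
    rw [cost, cost]
    split_ifs
    · exact le_rfl
    · gcongr; exact avg_mono _ ih
    · exact le_rfl

lemma cost_cons {Φ : State → ℝ≥0∞} {T : ℕ} {p : Prog} {K : List Prog} {s : State}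
    (hs : Good B s) :
    cost O data c B Φ (T + 1) (p :: K, s) =
      c + avg (step O data (p :: K, s)) (cost O data c B Φ T) := by
  rw [cost]; simp [hs]

/-- The transformer `wp` bounds the cost of executing a program before the rest of the stack. -/
lemma cost_le_wp (Φ : State → ℝ≥0∞) (T : ℕ) : ∀ (p : Prog) (K : List Prog) (s : State), Good B s →
    cost O data c B Φ T (p :: K, s) ≤
      wp O data c B p (fun s' => cost O data c B Φ T (K, s')) s := by
  induction T with
  | zero => intro p K s hs; simp [cost, hs]
  | succ T ih =>
    intro p K s hs
    have up := fun x => cost_le_succ (O := O) (data := data) (c := c) (B := B) Φ T x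
    cases p with
    | loop a b p =>
      -- every pre-fixed point bounds the cost of the loop, by induction on the number of steps
      have key : ∀ T', T' ≤ T + 1 → ∀ I : State → ℝ≥0∞,
          (∀ s, c + (if s.reg a < s.reg b then wp O data c B p I s
            else cost O data c B Φ (T + 1) (K, s)) ≤ I s) → ∀ s, Good B s →
          cost O data c B Φ T' (.loop a b p :: K, s) ≤ I s := by
        intro T'
        induction T' with
        | zero => intro _ I _ s hs; simp [cost, hs]
        | succ T' ih' =>
          intro hT I hI s hs
          have hmono : ∀ x, cost O data c B Φ T' x ≤ cost O data c B Φ T x :=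
            fun x => monotone_nat_of_le_succ
              (f := fun T => cost O data c B Φ T x) (fun T => cost_le_succ Φ T x) (by omega)
          rw [cost_cons hs, step, avg_pure]
          refine le_trans ?_ (hI s)
          gcongr
          split_ifs with hab
          · refine (hmono _).trans ((ih p _ s hs).trans (wp_mono_good p hs fun s' hs' => ?_))
            by_cases hTT : T' = T
            · subst hTT; exact ih' (by omega) I hI s' hs'
            · refine (ih _ K s' hs').trans ?_
              refine wp_loop_le I (fun s'' => le_trans ?_ (hI s'')) s'
              gcongr
              split_ifs
              · exact le_rfl
              · exact up _
          · exact (hmono _).trans (up _)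
      simp only [wp]
      exact le_iInf fun I => key (T + 1) le_rfl I.1 I.2 s hs
    | store a b =>
      rw [cost_cons hs, step, avg_pure]
      simp only [wp]
      split_ifs
      · gcongr; exact up _
      · exact le_top
    | rand d a =>
      rw [cost_cons hs, step, avg_map]
      simp only [wp]
      gcongr
      exact avg_mono _ fun v => up _
    | seq p p' =>
      rw [cost_cons hs, step, avg_pure]
      simp only [wp]
      gcongr
      refine (ih p _ s hs).trans (wp_mono_good p hs fun s' hs' => ?_)
      exact (ih p' K s' hs').trans (wp_mono p' s' fun s'' => up _)
    | ite a b p p' =>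
      rw [cost_cons hs, step, avg_pure]
      simp only [wp]
      gcongr
      split_ifs
      · exact (ih p K s hs).trans (wp_mono p s fun s'' => up _)
      · exact (ih p' K s hs).trans (wp_mono p' s fun s'' => up _)
    | _ =>
      rw [cost_cons hs, step, avg_pure]
      simp only [wp]
      gcongr
      exact up _

lemma cost_single_le_wp (Φ : State → ℝ≥0∞) (T : ℕ) (p : Prog) (s : State) (hs : Good B s) :
    cost O data c B Φ T ([p], s) ≤ wp O data c B p Φ s := by
  refine (cost_le_wp Φ T p [] s hs).trans (wp_mono_good p hs fun s' hs' => ?_)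
  cases T <;> simp [cost, hs']

lemma run_succ_start (x : Conf) (T : ℕ) :
    run O data x (T + 1) = (step O data x).bind (fun y => run O data y T) := by
  induction T with
  | zero => simp [run]
  | succ T ih =>
    rw [run, ih, PMF.bind_bind]
    rfl

lemma run_halted (s : State) (T : ℕ) : run O data ([], s) T = PMF.pure ([], s) := by
  induction T with
  | zero => rfl
  | succ T ih => rw [run, ih, PMF.pure_bind]; rfl

lemma good_of_cost_ne_top (Φ : State → ℝ≥0∞) (T : ℕ) : ∀ x : Conf,
    cost O data c B Φ T x ≠ ⊤ → ∀ y ∈ (run O data x T).support, Good B y.2 := by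
  induction T with
  | zero =>
    intro x hx y hy
    simp only [run, PMF.support_pure, Set.mem_singleton_iff] at hy
    subst hy
    by_contra hb
    simp [cost, hb] at hx
  | succ T ih =>
    intro x hx y hy
    by_cases hg : Good B x.2
    · by_cases hh : x.1 = []
      · obtain ⟨K, s⟩ := x
        simp only at hh hg
        subst hh
        rw [run_halted] at hy
        simp only [PMF.support_pure, Set.mem_singleton_iff] at hy
        subst hy
        exact hg
      · rw [cost] at hx
        simp only [hg, hh, if_true, if_false] at hx
        rw [run_succ_start, PMF.mem_support_bind_iff] at hy
        obtain ⟨z, hz, hy⟩ := hy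
        refine ih z (fun htop => hx ?_) y hy
        rw [avg_eq_top _ _ z hz htop, add_top]
    · simp [cost, hg] at hx

lemma usesSpace_of_wp {p : Prog} {s : State} (hs : Good B s) (Φ : State → ℝ≥0∞)
    (h : wp O data c B p Φ s ≠ ⊤) {b : ℝ} (hb : (B : ℝ) ≤ b) :
    UsesSpace O data ([p], s) b := by
  intro T y hy a ha
  have := good_of_cost_ne_top Φ T ([p], s)
    (ne_top_of_le_ne_top h (cost_single_le_wp Φ T p s hs)) y hy a ha
  exact lt_of_lt_of_le (by exact_mod_cast this) hb

lemma toOuterMeasure_run_succ (x : Conf) (T : ℕ) (A : Set Conf) :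
    (run O data x (T + 1)).toOuterMeasure A =
      avg (step O data x) (fun y => (run O data y T).toOuterMeasure A) := by
  simp only [toOuterMeasure_eq_avg, run_succ_start, avg_bind]

/-- With cost `1` for each step, `cost` bounds the partial sums of the expected running time. -/
lemma sum_running_le_cost (T : ℕ) : ∀ x : Conf,
    ∑ T' ∈ Finset.range T, (run O data x T').toOuterMeasure {y | y.1 ≠ []} ≤
      cost O data 1 B (fun _ => 0) T x := by
  induction T with
  | zero => intro x; simp
  | succ T ih =>
    intro x
    by_cases hg : Good B x.2
    · by_cases hh : x.1 = []
      · obtain ⟨K, s⟩ := x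
        simp only at hh
        subst hh
        simp [run_halted, toOuterMeasure_eq_avg, avg_pure]
      · rw [Finset.sum_range_succ', cost]
        simp only [hg, hh, if_true, if_false]
        rw [add_comm]
        gcongr
        · rw [run, toOuterMeasure_eq_avg, avg_pure]
          exact Set.indicator_apply_le' (fun _ => le_rfl) (fun _ => zero_le_one)
        · simp only [toOuterMeasure_run_succ]
          rw [← avg_sum]
          exact avg_mono _ ih
    · simp [cost, hg]

lemma expectedTime_le_wp {p : Prog} {s : State} (hs : Good B s) :
    expectedTime O data ([p], s) ≤ wp O data 1 B p (fun _ => 0) s := by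
  rw [expectedTime, ENNReal.tsum_eq_iSup_nat]
  exact iSup_le fun T => (sum_running_le_cost T _).trans (cost_single_le_wp _ T p s hs)

/-- With cost `0` for each step, `cost` bounds the probability of halting in a given set. -/
lemma halted_le_cost (A : Set State) (T : ℕ) : ∀ x : Conf,
    (run O data x T).toOuterMeasure {y | y.1 = [] ∧ y.2 ∈ A} ≤
      cost O data 0 B (A.indicator 1) (T + 1) x := by
  induction T with
  | zero =>
    intro x
    rw [run, toOuterMeasure_eq_avg, avg_pure]
    refine Set.indicator_apply_le' (fun h => ?_) (fun _ => zero_le)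
    rw [cost]
    have h' : x.1 = [] ∧ x.2 ∈ A := h
    split_ifs <;> simp [h'.2, h'.1] at *
  | succ T ih =>
    intro x
    by_cases hg : Good B x.2
    · by_cases hh : x.1 = []
      · obtain ⟨K, s⟩ := x
        simp only at hh hg
        subst hh
        rw [run_halted, toOuterMeasure_eq_avg, avg_pure, cost]
        simp only [hg, if_true]
        refine Set.indicator_apply_le' (fun h => ?_) (fun _ => zero_le)
        have h' : s ∈ A := h.2
        simp [h']
      · rw [cost]
        simp only [hg, hh, if_true, if_false, zero_add, toOuterMeasure_run_succ]
        exact avg_mono _ ih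
    · rw [cost]; simp [hg]

lemma halted_le_wp {p : Prog} {s : State} (hs : Good B s) (A : Set State) (T : ℕ) :
    (run O data ([p], s) T).toOuterMeasure {y | y.1 = [] ∧ y.2 ∈ A} ≤
      wp O data 0 B p (A.indicator 1) s :=
  (halted_le_cost A T _).trans (cost_single_le_wp _ _ p s hs)

lemma outputProb_le_wp {p : Prog} {s : State} (hs : Good B s) (v : ℕ) :
    outputProb O data ([p], s) v ≤
      wp O data 0 B p ({s | s.reg 0 = v}.indicator 1) s :=
  iSup_le fun T => halted_le_wp hs {s | s.reg 0 = v} T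

lemma toOuterMeasure_compl_add {α : Type*} (μ : PMF α) (A : Set α) :
    μ.toOuterMeasure A + μ.toOuterMeasure Aᶜ = 1 := by
  classical
  rw [PMF.toOuterMeasure_apply, PMF.toOuterMeasure_apply, ← ENNReal.tsum_add, ← μ.tsum_coe]
  refine tsum_congr fun x => ?_
  exact Set.indicator_self_add_compl_apply A (⇑μ) x

/-- A machine with finite expected running time halts almost surely; if it may only output
elements of the finite set `V`, then the probabilities of these outputs add up to at least one. -/
lemma one_le_sum_outputProb {p : Prog} {s : State} (hs : Good B s)
    (htime : wp O data 1 B p (fun _ => 0) s ≠ ⊤) (V : Finset ℕ)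
    (hV : wp O data 0 B p ({s | s.reg 0 ∉ V}.indicator 1) s = 0) :
    1 ≤ ∑ v ∈ V, outputProb O data ([p], s) v := by
  have hfin : expectedTime O data ([p], s) ≠ ⊤ := ne_top_of_le_ne_top htime (expectedTime_le_wp hs)
  have hlim := ENNReal.tendsto_atTop_zero_of_tsum_ne_top hfin
  have hT : ∀ T, 1 ≤ (∑ v ∈ V, outputProb O data ([p], s) v) +
      (run O data ([p], s) T).toOuterMeasure {y | y.1 ≠ []} := by
    intro T
    rw [← toOuterMeasure_compl_add (run O data ([p], s) T) {y | y.1 ≠ []}, add_comm]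
    gcongr
    have hsub : ({y : Conf | y.1 ≠ []}ᶜ : Set Conf) ⊆
        (⋃ v ∈ V, {y | y.1 = [] ∧ y.2.reg 0 = v}) ∪ {y | y.1 = [] ∧ y.2 ∈ {s | s.reg 0 ∉ V}} := by
      intro y hy
      simp only [Set.mem_compl_iff, Set.mem_ofPred_eq, not_not] at hy
      by_cases hv : y.2.reg 0 ∈ V
      · left; simp [hy, hv]
      · right; exact ⟨hy, hv⟩
    refine (measure_mono hsub).trans ((measure_union_le _ _).trans ?_)
    have h0 : (run O data ([p], s) T).toOuterMeasure {y | y.1 = [] ∧ y.2 ∈ {s | s.reg 0 ∉ V}} = 0 :=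
      le_antisymm ((halted_le_wp hs _ T).trans hV.le) zero_le
    rw [h0, add_zero]
    refine (measure_biUnion_finset_le V _).trans ?_
    exact Finset.sum_le_sum fun v _ => le_iSup
      (fun T => (run O data ([p], s) T).toOuterMeasure {y | y.1 = [] ∧ y.2.reg 0 = v}) T
  have := ge_of_tendsto' (tendsto_const_nhds.add hlim) hT
  simpa using this

end wp

section programs

local infixr:60 " ;; " => Prog.seq

/-! ### Programs without random choices -/

/-- The program never draws a random number. -/
def RandFree : Prog → Prop
  | .rand _ _ => False
  | .seq p p' => RandFree p ∧ RandFree p'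
  | .ite _ _ p p' => RandFree p ∧ RandFree p'
  | .loop _ _ p => RandFree p
  | _ => True

lemma step_randFree (O : Oracle) (data : ℕ → ℕ) (x : Conf) (hx : ∀ p ∈ x.1, RandFree p) :
    ∃ y : Conf, step O data x = PMF.pure y ∧ ∀ p ∈ y.1, RandFree p := by
  obtain ⟨K, s⟩ := x
  cases K with
  | nil => exact ⟨_, rfl, hx⟩
  | cons p K =>
    simp only [List.mem_cons, forall_eq_or_imp] at hx
    obtain ⟨hp, hK⟩ := hx
    cases p with
    | rand d a => exact hp.elim
    | seq p p' =>
      refine ⟨_, rfl, ?_⟩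
      simp only [List.mem_cons, forall_eq_or_imp]
      exact ⟨hp.1, hp.2, hK⟩
    | ite a b p p' =>
      refine ⟨_, rfl, ?_⟩
      dsimp only
      split_ifs <;> simp only [List.mem_cons, forall_eq_or_imp]
      · exact ⟨hp.1, hK⟩
      · exact ⟨hp.2, hK⟩
    | loop a b p =>
      refine ⟨_, rfl, ?_⟩
      dsimp only
      split_ifs
      · simp only [List.mem_cons, forall_eq_or_imp]
        exact ⟨hp, hp, hK⟩
      · exact hK
    | _ => exact ⟨_, rfl, hK⟩

lemma run_randFree (O : Oracle) (data : ℕ → ℕ) (x : Conf) (hx : ∀ p ∈ x.1, RandFree p) (T : ℕ) :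
    ∃ y : Conf, run O data x T = PMF.pure y ∧ ∀ p ∈ y.1, RandFree p := by
  induction T with
  | zero => exact ⟨x, rfl, hx⟩
  | succ T ih =>
    obtain ⟨y, hy, hK⟩ := ih
    rw [run, hy, PMF.pure_bind]
    exact step_randFree O data y hK

/-! ### Total correctness triples for deterministic program parts -/

/-- Started in the state `s`, the program `p` reaches within `τ` steps a state with property `Q`
that does not depend on random choices, and it only writes memory cells with address `< B`. -/
def Ht (O : Oracle) (data : ℕ → ℕ) (B : ℕ) (p : Prog) (s : State) (τ : ℕ) (Q : State → Prop) :
    Prop :=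
  ∃ s', Q s' ∧ ∀ (c : ℝ≥0∞) (f : State → ℝ≥0∞), wp O data c B p f s ≤ τ * c + f s'

variable {O : Oracle} {data : ℕ → ℕ} {B : ℕ}

/-- A program without random choices that almost surely halts in a certain state does so after a
fixed number of steps. -/
lemma Ht.haltsWithMemory {p : Prog} (hp : RandFree p) {s : State} (hs : Good B s) {τ : ℕ}
    {Q : State → Prop} (h : Ht O data B p s τ Q) :
    ∃ s', Q s' ∧ HaltsWithMemory O data ([p], s) s'.mem := by
  obtain ⟨s', hQ, hs'⟩ := h
  refine ⟨s', hQ, ?_⟩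
  have htime : wp O data 1 B p (fun _ => 0) s ≠ ⊤ :=
    ne_top_of_le_ne_top (by simp) (hs' 1 fun _ => 0)
  have hfin : expectedTime O data ([p], s) ≠ ⊤ := ne_top_of_le_ne_top htime (expectedTime_le_wp hs)
  obtain ⟨T, hT⟩ := ((ENNReal.tendsto_atTop_zero_of_tsum_ne_top hfin).eventually
    (gt_mem_nhds (zero_lt_one))).exists
  obtain ⟨y, hy, -⟩ := run_randFree O data ([p], s) (by simpa using hp) T
  have hmem := (halted_le_wp hs {s | s.mem ≠ s'.mem} T).trans (hs' 0 _)
  rw [hy, toOuterMeasure_eq_avg, avg_pure] at hT hmem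
  obtain ⟨K, s₁⟩ := y
  have hK : K = [] := by
    by_contra hK
    simp [hK] at hT
  subst hK
  refine ⟨T, s₁, hy, ?_⟩
  by_contra hne
  simp [hne] at hmem

lemma Ht.wp_le {p : Prog} {s : State} {τ : ℕ} {Q : State → Prop} (h : Ht O data B p s τ Q)
    {c : ℝ≥0∞} {f : State → ℝ≥0∞} {b : ℝ≥0∞} (hf : ∀ s', Q s' → f s' ≤ b) :
    wp O data c B p f s ≤ τ * c + b := by
  obtain ⟨s', hQ, h⟩ := h
  exact (h c f).trans (by gcongr; exact hf s' hQ)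

lemma Ht.weaken {p : Prog} {s : State} {τ τ' : ℕ} {Q : State → Prop}
    (h : Ht O data B p s τ Q) (hτ : τ ≤ τ') : Ht O data B p s τ' Q := by
  obtain ⟨s', hQ, h⟩ := h
  exact ⟨s', hQ, fun c f => (h c f).trans (by gcongr)⟩

lemma Ht.imp {p : Prog} {s : State} {τ : ℕ} {Q Q' : State → Prop}
    (h : Ht O data B p s τ Q) (hQ : ∀ s', Q s' → Q' s') : Ht O data B p s τ Q' := by
  obtain ⟨s', hq, h⟩ := h
  exact ⟨s', hQ _ hq, h⟩

lemma Ht.seq {p p' : Prog} {s : State} {τ τ' : ℕ} {Q Q' : State → Prop}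
    (h : Ht O data B p s τ Q) (h' : ∀ s', Q s' → Ht O data B p' s' τ' Q') :
    Ht O data B (.seq p p') s (τ + τ' + 1) Q' := by
  obtain ⟨s₁, hQ, h⟩ := h
  obtain ⟨s₂, hQ', h'⟩ := h' s₁ hQ
  refine ⟨s₂, hQ', fun c f => ?_⟩
  simp only [wp]
  calc c + wp O data c B p (wp O data c B p' f) s
      ≤ c + (τ * c + (τ' * c + f s₂)) := by
        gcongr
        exact (h c _).trans (by gcongr; exact h' c f)
    _ = _ := by push_cast; ring

section basic

variable {s : State} {Q : State → Prop}

lemma Ht.skip (h : Q s) : Ht O data B .skip s 1 Q := ⟨s, h, fun c f => by simp [wp]⟩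
lemma Ht.const {d v : ℕ} (h : Q (s.set d v)) : Ht O data B (.const d v) s 1 Q :=
  ⟨_, h, fun c f => by simp [wp]⟩
lemma Ht.add {d a b : ℕ} (h : Q (s.set d (s.reg a + s.reg b))) :
    Ht O data B (.add d a b) s 1 Q := ⟨_, h, fun c f => by simp [wp]⟩
lemma Ht.sub {d a b : ℕ} (h : Q (s.set d (s.reg a - s.reg b))) :
    Ht O data B (.sub d a b) s 1 Q := ⟨_, h, fun c f => by simp [wp]⟩
lemma Ht.read {d a : ℕ} (h : Q (s.set d (data (s.reg a)))) :
    Ht O data B (.read d a) s 1 Q := ⟨_, h, fun c f => by simp [wp]⟩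
lemma Ht.load {d a : ℕ} (h : Q (s.set d (s.mem (s.reg a)))) :
    Ht O data B (.load d a) s 1 Q := ⟨_, h, fun c f => by simp [wp]⟩
lemma Ht.store {a b : ℕ} (ha : s.reg a < B) (h : Q (s.put (s.reg a) (s.reg b))) :
    Ht O data B (.store a b) s 1 Q := ⟨_, h, fun c f => by simp [wp, ha]⟩
lemma Ht.hash {d l x : ℕ} (h : Q (s.set d (O.hash (s.reg l) (s.reg x)))) :
    Ht O data B (.hash d l x) s 1 Q := ⟨_, h, fun c f => by simp [wp]⟩
open Classical in
lemma Ht.near {d x : ℕ} (h : Q (s.set d (if O.near (s.reg x) then 1 else 0))) :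
    Ht O data B (.near d x) s 1 Q := ⟨_, h, fun c f => by simp [wp]⟩

lemma Ht.ite {a b : ℕ} {p p' : Prog} {τ τ' : ℕ} (h : s.reg a < s.reg b → Ht O data B p s τ Q)
    (h' : ¬ s.reg a < s.reg b → Ht O data B p' s τ' Q) :
    Ht O data B (.ite a b p p') s (τ + τ' + 1) Q := by
  by_cases hab : s.reg a < s.reg b
  · obtain ⟨s', hQ, h⟩ := h hab
    refine ⟨s', hQ, fun c f => ?_⟩
    simp only [wp, hab, if_true]
    refine (add_le_add_right (h c f) c).trans ?_
    have : ((τ + τ' + 1 : ℕ) : ℝ≥0∞) * c + f s' = τ' * c + (c + (τ * c + f s')) := by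
      push_cast; ring
    rw [this]
    exact le_add_self
  · obtain ⟨s', hQ, h⟩ := h' hab
    refine ⟨s', hQ, fun c f => ?_⟩
    simp only [wp, hab, if_false]
    refine (add_le_add_right (h c f) c).trans ?_
    have : ((τ + τ' + 1 : ℕ) : ℝ≥0∞) * c + f s' = τ * c + (c + (τ' * c + f s')) := by
      push_cast; ring
    rw [this]
    exact le_add_self

lemma Ht.loop_exit {a b : ℕ} {p : Prog} (hab : ¬ s.reg a < s.reg b) (h : Q s) :
    Ht O data B (.loop a b p) s 1 Q := by
  refine ⟨s, h, fun c f => (wp_loop_unfold a b p f s).trans ?_⟩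
  simp [hab]

lemma Ht.loop_enter {a b : ℕ} {p : Prog} {τ τ' : ℕ} {Q' : State → Prop}
    (hab : s.reg a < s.reg b) (h : Ht O data B p s τ Q)
    (h' : ∀ s', Q s' → Ht O data B (.loop a b p) s' τ' Q') :
    Ht O data B (.loop a b p) s (τ + τ' + 1) Q' := by
  obtain ⟨s₁, hQ, h⟩ := h
  obtain ⟨s₂, hQ', h'⟩ := h' s₁ hQ
  refine ⟨s₂, hQ', fun c f => (wp_loop_unfold a b p f s).trans ?_⟩
  simp only [hab, if_true]
  calc c + wp O data c B p (wp O data c B (.loop a b p) f) s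
      ≤ c + (τ * c + (τ' * c + f s₂)) := by
        gcongr
        exact (h c _).trans (by gcongr; exact h' c f)
    _ = _ := by push_cast; ring

end basic

/-- A loop that is executed exactly `N` times, with an invariant indexed by the number of executions
so far. -/
lemma Ht.for {a b : ℕ} {p : Prog} (Inv : ℕ → State → Prop) (N τ : ℕ)
    (hstep : ∀ i < N, ∀ s, Inv i s → s.reg a < s.reg b ∧ Ht O data B p s τ (Inv (i + 1)))
    (hend : ∀ s, Inv N s → ¬ s.reg a < s.reg b) {s : State} (h0 : Inv 0 s) :
    Ht O data B (.loop a b p) s (N * (τ + 1) + 1) (Inv N) := by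
  have key : ∀ j i, i + j = N → ∀ s, Inv i s →
      Ht O data B (.loop a b p) s (j * (τ + 1) + 1) (Inv N) := by
    intro j
    induction j with
    | zero =>
      rintro i rfl s hs
      simpa using Ht.loop_exit (hend s hs) hs
    | succ j ih =>
      rintro i hi s hs
      obtain ⟨hab, hb⟩ := hstep i (by omega) s hs
      refine (Ht.loop_enter hab hb (ih (i + 1) (by omega))).weaken ?_
      rw [add_one_mul]; omega
  exact key N 0 (by omega) s h0

section seqs

variable {s : State} {Q : State → Prop} {p : Prog} {τ : ℕ}

lemma Ht.const_seq {d v : ℕ} (h : Ht O data B p (s.set d v) τ Q) :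
    Ht O data B (.seq (.const d v) p) s (1 + τ + 1) Q :=
  Ht.seq (Q := (· = s.set d v)) (Ht.const rfl) (by rintro _ rfl; exact h)
lemma Ht.add_seq {d a b : ℕ} (h : Ht O data B p (s.set d (s.reg a + s.reg b)) τ Q) :
    Ht O data B (.seq (.add d a b) p) s (1 + τ + 1) Q :=
  Ht.seq (Q := (· = s.set d (s.reg a + s.reg b))) (Ht.add rfl) (by rintro _ rfl; exact h)
lemma Ht.sub_seq {d a b : ℕ} (h : Ht O data B p (s.set d (s.reg a - s.reg b)) τ Q) :
    Ht O data B (.seq (.sub d a b) p) s (1 + τ + 1) Q :=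
  Ht.seq (Q := (· = s.set d (s.reg a - s.reg b))) (Ht.sub rfl) (by rintro _ rfl; exact h)
lemma Ht.read_seq {d a : ℕ} (h : Ht O data B p (s.set d (data (s.reg a))) τ Q) :
    Ht O data B (.seq (.read d a) p) s (1 + τ + 1) Q :=
  Ht.seq (Q := (· = s.set d (data (s.reg a)))) (Ht.read rfl) (by rintro _ rfl; exact h)
lemma Ht.load_seq {d a : ℕ} (h : Ht O data B p (s.set d (s.mem (s.reg a))) τ Q) :
    Ht O data B (.seq (.load d a) p) s (1 + τ + 1) Q :=
  Ht.seq (Q := (· = s.set d (s.mem (s.reg a)))) (Ht.load rfl) (by rintro _ rfl; exact h)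
lemma Ht.store_seq {a b : ℕ} (ha : s.reg a < B)
    (h : Ht O data B p (s.put (s.reg a) (s.reg b)) τ Q) :
    Ht O data B (.seq (.store a b) p) s (1 + τ + 1) Q :=
  Ht.seq (Q := (· = s.put (s.reg a) (s.reg b))) (Ht.store ha rfl) (by rintro _ rfl; exact h)
lemma Ht.hash_seq {d l x : ℕ} (h : Ht O data B p (s.set d (O.hash (s.reg l) (s.reg x))) τ Q) :
    Ht O data B (.seq (.hash d l x) p) s (1 + τ + 1) Q :=
  Ht.seq (Q := (· = s.set d (O.hash (s.reg l) (s.reg x)))) (Ht.hash rfl) (by rintro _ rfl; exact h)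

end seqs

lemma State.set_reg (s : State) (d v r : ℕ) : (s.set d v).reg r = if r = d then v else s.reg r := by
  simp [State.set, Function.update_apply]

lemma State.set_mem (s : State) (d v : ℕ) : (s.set d v).mem = s.mem := rfl

lemma State.put_reg (s : State) (a v : ℕ) : (s.put a v).reg = s.reg := rfl

lemma State.put_mem (s : State) (a v b : ℕ) :
    (s.put a v).mem b = if b = a then v else s.mem b := by
  simp [State.put, Function.update_apply]

/-! ### Comparison of the hash keys of two points -/

/-- The result of comparing the first `k` coordinates of the keys of the points `x` and `y` in table
`j`, where the last difference decides: `0`, `1` or `2` if the key of `x` is smaller than, equal to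
or larger than that of `y`.  Of `m` tables, table `j` uses the hash functions `j, j + m, j + 2 m, …`,
so that their numbers can be computed without multiplication. -/
def keyCmp (O : Oracle) (m j x y : ℕ) : ℕ → ℕ
  | 0 => 1
  | k + 1 =>
    if O.hash (j + m * k) x < O.hash (j + m * k) y then 0
    else if O.hash (j + m * k) y < O.hash (j + m * k) x then 2
    else keyCmp O m j x y k

/-- Comparison of the keys of the points `R[11]` and `R[12]` in table `R[10]`; result in `R[13]`.  The
registers `R[1] = k`, `R[4] = m`, `R[5] = 1`, `R[6] = 0` are read, and only `R[13], …, R[17]` are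
changed. -/
def cmpProg : Prog :=
  .const 13 1 ;; .add 14 10 6 ;; .const 15 0 ;;
  .loop 15 1 (
    .hash 16 14 11 ;; .hash 17 14 12 ;;
    .ite 16 17 (.const 13 0) (.ite 17 16 (.const 13 2) .skip) ;;
    .add 14 14 4 ;; .add 15 15 5)

/-- The registers holding `1` and `0` have these values. -/
def Std (s : State) : Prop := s.reg 5 = 1 ∧ s.reg 6 = 0

lemma cmpProg_spec {s : State} (h : Std s) :
    Ht O data B cmpProg s (15 * s.reg 1 + 8) fun s' =>
      s'.mem = s.mem ∧ (∀ r, r < 13 ∨ 17 < r → s'.reg r = s.reg r) ∧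
      s'.reg 13 = keyCmp O (s.reg 4) (s.reg 10) (s.reg 11) (s.reg 12) (s.reg 1) := by
  obtain ⟨h5, h6⟩ := h
  apply Ht.weaken
  · apply Ht.const_seq
    apply Ht.add_seq
    apply Ht.const_seq
    refine (Ht.for (fun i s' => s'.mem = s.mem ∧ (∀ r, r < 13 ∨ 17 < r → s'.reg r = s.reg r) ∧
      s'.reg 13 = keyCmp O (s.reg 4) (s.reg 10) (s.reg 11) (s.reg 12) i ∧
      s'.reg 14 = s.reg 10 + s.reg 4 * i ∧ s'.reg 15 = i) (s.reg 1) 14 ?_ ?_ ?_).imp ?_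
    · rintro i hi s' ⟨hm, hf, h13, h14, h15⟩
      refine ⟨by rw [h15, hf 1 (by omega)]; exact hi, ?_⟩
      apply Ht.weaken
      · apply Ht.hash_seq
        apply Ht.hash_seq
        apply Ht.seq (Q := fun s'' => s''.mem = s.mem ∧
          (∀ r, r < 13 ∨ 17 < r → s''.reg r = s.reg r) ∧
          s''.reg 13 = keyCmp O (s.reg 4) (s.reg 10) (s.reg 11) (s.reg 12) (i + 1) ∧
          s''.reg 14 = s.reg 10 + s.reg 4 * i ∧ s''.reg 15 = i)
        · have h11 := hf 11 (by omega)
          have h12 := hf 12 (by omega)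
          apply Ht.ite
          · intro hlt
            simp [State.set_reg] at hlt
            refine Ht.const ⟨hm, fun r hr => ?_, ?_, ?_, ?_⟩
            · simp only [State.set_reg]
              repeat rw [if_neg (by omega)]
              exact hf r hr
            · simp [State.set_reg, keyCmp, ← h14, ← h11, ← h12, hlt]
            · simp [State.set_reg, h14]
            · simp [State.set_reg, h15]
          · intro hlt
            simp [State.set_reg] at hlt
            apply Ht.ite
            · intro hlt'
              simp [State.set_reg] at hlt'
              refine Ht.const ⟨hm, fun r hr => ?_, ?_, ?_, ?_⟩
              · simp only [State.set_reg]
                repeat rw [if_neg (by omega)]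
                exact hf r hr
              · simp [State.set_reg, keyCmp, ← h14, ← h11, ← h12, hlt', hlt.not_gt]
              · simp [State.set_reg, h14]
              · simp [State.set_reg, h15]
            · intro hlt'
              simp [State.set_reg] at hlt'
              refine Ht.skip ⟨hm, fun r hr => ?_, ?_, ?_, ?_⟩
              · simp only [State.set_reg]
                repeat rw [if_neg (by omega)]
                exact hf r hr
              · simp [State.set_reg, keyCmp, ← h14, ← h11, ← h12, hlt.not_gt, hlt'.not_gt, h13]
              · simp [State.set_reg, h14]
              · simp [State.set_reg, h15]
        · rintro s'' ⟨hm', hf', h13', h14', h15'⟩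
          apply Ht.add_seq
          apply Ht.add
          refine ⟨hm', fun r hr => ?_, ?_, ?_, ?_⟩
          · simp only [State.set_reg]
            repeat rw [if_neg (by omega)]
            exact hf' r hr
          · simp [State.set_reg, h13']
          · simp [State.set_reg, h14', hf' 4]; ring
          · simp [State.set_reg, h15', hf' 5, h5]
      · norm_num
    · rintro s' ⟨hm, hf, h13, h14, h15⟩
      rw [h15, hf 1 (by omega)]; omega
    · refine ⟨rfl, fun r hr => ?_, ?_, ?_, ?_⟩
      · simp only [State.set_reg]
        repeat rw [if_neg (by omega)]
      · simp [State.set_reg, keyCmp]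
      · simp [State.set_reg, h6]
      · simp [State.set_reg]
    · rintro s' ⟨hm, hf, h13, h14, h15⟩
      exact ⟨hm, hf, h13⟩
  · omega

/-! ### The order of the points in one hash table -/

section order

variable {m j : ℕ}

lemma keyCmp_le_two (x y k : ℕ) : keyCmp O m j x y k ≤ 2 := by
  induction k with
  | zero => simp [keyCmp]
  | succ k ih => rw [keyCmp]; split_ifs <;> omega

lemma keyCmp_swap (x y k : ℕ) : keyCmp O m j y x k = 2 - keyCmp O m j x y k := by
  induction k with
  | zero => simp [keyCmp]
  | succ k ih => rw [keyCmp, keyCmp]; split_ifs <;> omega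

lemma keyCmp_self (x k : ℕ) : keyCmp O m j x x k = 1 := by
  induction k with
  | zero => simp [keyCmp]
  | succ k ih => rw [keyCmp]; simp [ih]

lemma keyCmp_eq_one {x y k : ℕ} : keyCmp O m j x y k = 1 ↔
    ∀ i < k, O.hash (j + m * i) x = O.hash (j + m * i) y := by
  induction k with
  | zero => simp [keyCmp]
  | succ k ih =>
    rw [keyCmp]
    constructor
    · intro h i hi
      split_ifs at h with h1 h2
      · omega
      · rcases Nat.lt_succ_iff_lt_or_eq.1 hi with hi | rfl
        · exact ih.1 h i hi
        · omega
    · intro h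
      rw [if_neg (by simp [h k]), if_neg (by simp [h k])]
      exact ih.2 fun i hi => h i (by omega)

/-- Transitivity of the comparison of keys. -/
lemma keyCmp_mono {x y : ℕ} (z : ℕ) {k : ℕ} (h : keyCmp O m j x y k ≤ 1) :
    keyCmp O m j x z k ≤ keyCmp O m j y z k := by
  induction k with
  | zero => simp [keyCmp]
  | succ k ih =>
    have := keyCmp_le_two (O := O) (m := m) (j := j) x z k
    rw [keyCmp] at h
    rw [keyCmp, keyCmp]
    split_ifs at h ⊢ <;> omega

variable (O m j) in
/-- The order in which points are stored in table `j`: by their keys of length `k`, and points with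
equal keys by their numbers. -/
def Before (k x y : ℕ) : Prop :=
  keyCmp O m j x y k = 0 ∨ keyCmp O m j x y k = 1 ∧ x < y

instance (k x y : ℕ) : Decidable (Before O m j k x y) := by
  unfold Before; infer_instance

lemma Before.irrefl {k x : ℕ} : ¬ Before O m j k x x := by
  simp [Before, keyCmp_self]

lemma Before.total {k x y : ℕ} (h : x ≠ y) : Before O m j k x y ∨ Before O m j k y x := by
  unfold Before
  have := keyCmp_le_two (O := O) (m := m) (j := j) x y k
  rw [keyCmp_swap x y]
  omega

lemma Before.cmp_le {k x y : ℕ} (h : Before O m j k x y) : keyCmp O m j x y k ≤ 1 := by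
  unfold Before at h; omega

lemma Before.trans {k x y z : ℕ} (h : Before O m j k x y) (h' : Before O m j k y z) :
    Before O m j k x z := by
  have h1 := keyCmp_mono z h.cmp_le
  have h2 := keyCmp_mono x h'.cmp_le
  rw [keyCmp_swap x y, keyCmp_swap x z] at h2
  have := keyCmp_le_two (O := O) (m := m) (j := j) x z k
  have := keyCmp_le_two (O := O) (m := m) (j := j) x y k
  unfold Before at *
  omega

variable (O m j) in
/-- The position of the point `x` in table `j` for the data points `1, …, n`. -/
def rank (n k x : ℕ) : ℕ := ((Finset.Icc 1 n).filter fun y => Before O m j k y x).card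

lemma rank_lt_rank {n k x y : ℕ} (hx : x ∈ Finset.Icc 1 n) (h : Before O m j k x y) :
    rank O m j n k x < rank O m j n k y := by
  refine Finset.card_lt_card ?_
  rw [Finset.ssubset_iff_of_subset]
  · exact ⟨x, by simp [h, Finset.mem_Icc.1 hx], by simp [Before.irrefl]⟩
  · intro z hz
    simp only [Finset.mem_filter] at hz ⊢
    exact ⟨hz.1, hz.2.trans h⟩

lemma rank_lt {n k x : ℕ} (hx : x ∈ Finset.Icc 1 n) : rank O m j n k x < n := by
  have : rank O m j n k x < (Finset.Icc 1 n).card := by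
    refine Finset.card_lt_card ?_
    rw [Finset.ssubset_iff_of_subset (Finset.filter_subset _ _)]
    exact ⟨x, hx, by simp [Before.irrefl]⟩
  simpa using this

lemma rank_injOn {n k : ℕ} : Set.InjOn (rank O m j n k) (Finset.Icc 1 n) := by
  intro x hx y hy h
  by_contra hne
  rcases Before.total (O := O) (m := m) (j := j) (k := k) hne with hb | hb
  · exact (rank_lt_rank hx hb).ne h
  · exact (rank_lt_rank hy hb).ne' h

lemma exists_rank_eq {n k y : ℕ} (hy : y < n) : ∃ x ∈ Finset.Icc 1 n, rank O m j n k x = y := by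
  have := Finset.surjOn_of_injOn_of_card_le (s := Finset.Icc 1 n) (t := Finset.range n)
    (rank O m j n k) (fun x hx => by simpa using rank_lt hx) rank_injOn (by simp)
  obtain ⟨x, hx, h⟩ := this (by simpa using hy)
  exact ⟨x, hx, h⟩

variable (O m j) in
/-- The number of data points whose key compares with the key of the query (point `0`) below the
threshold `θ`; the bucket of the query consists of the positions from the value at `θ = 1` to the
value at `θ = 2`. -/
def below (n k θ : ℕ) : ℕ := ((Finset.Icc 1 n).filter fun x => keyCmp O m j x 0 k < θ).card

lemma below_le (n k θ : ℕ) : below O m j n k θ ≤ n := by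
  exact (Finset.card_filter_le _ _).trans (by simp)

lemma below_mono (n k : ℕ) {θ θ' : ℕ} (h : θ ≤ θ') : below O m j n k θ ≤ below O m j n k θ' :=
  Finset.card_le_card fun x hx => by
    simp only [Finset.mem_filter] at hx ⊢
    exact ⟨hx.1, by omega⟩

/-- The points below a threshold occupy the first positions of the table, so that binary search
applies. -/
lemma rank_lt_below {n k θ x : ℕ} (hx : x ∈ Finset.Icc 1 n) :
    rank O m j n k x < below O m j n k θ ↔ keyCmp O m j x 0 k < θ := by
  constructor
  · contrapose!
    intro h
    refine Finset.card_le_card fun y hy => ?_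
    simp only [Finset.mem_filter] at hy ⊢
    refine ⟨hy.1, ?_⟩
    have hne : y ≠ x := by rintro rfl; omega
    refine (Before.total hne).resolve_right fun hb => ?_
    have := keyCmp_mono 0 hb.cmp_le
    omega
  · intro h
    refine Finset.card_lt_card ?_
    rw [Finset.ssubset_iff_of_subset]
    · exact ⟨x, by simp [h, Finset.mem_Icc.1 hx], by simp [Before.irrefl]⟩
    · intro y hy
      simp only [Finset.mem_filter] at hy ⊢
      have := keyCmp_mono 0 hy.2.cmp_le
      exact ⟨hy.1, by omega⟩

lemma keyCmp_congr {O' : Oracle} {x y k : ℕ} (hx : ∀ l, O.hash l x = O'.hash l x)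
    (hy : ∀ l, O.hash l y = O'.hash l y) : keyCmp O m j x y k = keyCmp O' m j x y k := by
  induction k with
  | zero => rfl
  | succ k ih => rw [keyCmp, keyCmp, hx, hy, ih]

lemma rank_congr {O' : Oracle} {n k x : ℕ} (h : ∀ l, ∀ x ∈ Finset.Icc 1 n, O.hash l x = O'.hash l x)
    (hx : x ∈ Finset.Icc 1 n) : rank O m j n k x = rank O' m j n k x := by
  unfold rank
  congr 1
  refine Finset.filter_congr fun y hy => ?_
  unfold Before
  rw [keyCmp_congr (fun l => h l y hy) (fun l => h l x hx)]

end order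

/-! ### Preprocessing -/

/-- The data structure of `m` tables for `n` points with keys of length `k`: a header, the powers of
two that are at most `n + m` (they serve for binary search, as the machine cannot divide), and then
each table, which lists the points in the order of their keys. -/
structure IsDS (O : Oracle) (n k m : ℕ) (D : ℕ → ℕ) : Prop where
  size : D 0 = n
  keyLen : D 1 = k
  tables : D 2 = m
  bits : D 3 = (n + m).size
  pow : ∀ i < (n + m).size, D (4 + i) = 2 ^ i
  entry : ∀ i < m, ∀ x ∈ Finset.Icc 1 n,
    D (4 + (n + m).size + i * n + rank O m i n k x) = x

lemma IsDS.congr {O' : Oracle} {n k m : ℕ} {D : ℕ → ℕ} (hD : IsDS O n k m D)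
    (h : ∀ l, ∀ x ∈ Finset.Icc 1 n, O.hash l x = O'.hash l x) : IsDS O' n k m D where
  __ := hD
  entry i hi x hx := by rw [← rank_congr h hx]; exact hD.entry i hi x hx

/-- A bound on the addresses and on the stored numbers. -/
def spaceBound (n k m : ℕ) : ℕ := 4 + (n + m).size + m * n + 2 * m + n + k

/-- Computes the position of each point in each table by counting the points before it. -/
def fillProg : Prog :=
  .loop 10 4 (
    .const 11 1 ;;
    .loop 11 24 (
      .add 25 21 6 ;; .const 12 1 ;;
      .loop 12 24 (
        cmpProg ;;
        .ite 5 13 (.add 25 25 5) (.ite 13 5 .skip (.ite 12 11 (.add 25 25 5) .skip)) ;;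
        .add 12 12 5) ;;
      .store 25 11 ;; .add 11 11 5) ;;
    .add 21 21 0 ;; .add 10 10 5)

/-- The header of the data structure; `R[0], …, R[3]` are `n, k, L, t`, and there are `m = t L`
tables. -/
def headerProg : Prog :=
  .const 5 1 ;;
  .loop 20 3 (.add 4 4 2 ;; .add 20 20 5) ;;
  .add 9 0 4 ;; .add 9 9 5 ;; .const 8 1 ;; .const 21 4 ;;
  .loop 8 9 (.store 21 8 ;; .add 8 8 8 ;; .add 21 21 5 ;; .add 7 7 5) ;;
  .store 6 0 ;; .store 5 1 ;; .const 22 2 ;; .store 22 4 ;; .const 22 3 ;; .store 22 7 ;;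
  .add 24 0 5

/-- The preprocessing program. -/
def preProg : Prog := headerProg ;; fillProg

/-- The memory contents while the tables are being filled, when table `i` has been filled up to
the point `x` (exclusive) and the previous tables completely. -/
structure Filled (O : Oracle) (n k m i x : ℕ) (D : ℕ → ℕ) : Prop where
  size : D 0 = n
  keyLen : D 1 = k
  tables : D 2 = m
  bits : D 3 = (n + m).size
  pow : ∀ i < (n + m).size, D (4 + i) = 2 ^ i
  entry : ∀ i' < m, ∀ x' ∈ Finset.Icc 1 n, (i' < i ∨ i' = i ∧ x' < x) →
    D (4 + (n + m).size + i' * n + rank O m i' n k x') = x'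
  bound : ∀ a, D a ≤ spaceBound n k m

/-- The registers that are constant while the tables are being filled. -/
def FillRegs (n k m : ℕ) (s : State) : Prop :=
  s.reg 0 = n ∧ s.reg 1 = k ∧ s.reg 4 = m ∧ s.reg 5 = 1 ∧ s.reg 6 = 0 ∧ s.reg 24 = n + 1

lemma size_le_self (a : ℕ) : a.size ≤ a := by
  rcases Nat.eq_zero_or_pos a.size with h | h
  · omega
  · have h1 : 2 ^ (a.size - 1) ≤ a := Nat.lt_size.1 (by omega)
    have h2 : a.size - 1 < 2 ^ (a.size - 1) := Nat.lt_two_pow_self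
    omega

/-- The inner loop of `fillProg` adds the position of the point `x` in table `i` to `R[25]`. -/
lemma countProg_spec {n k m i x : ℕ} {s : State} (hs : FillRegs n k m s) (h10 : s.reg 10 = i)
    (h11 : s.reg 11 = x) (h12 : s.reg 12 = 1) (b : ℕ) (h25 : s.reg 25 = b) :
    Ht O data B (.loop 12 24 (
        cmpProg ;;
        .ite 5 13 (.add 25 25 5) (.ite 13 5 .skip (.ite 12 11 (.add 25 25 5) .skip)) ;;
        .add 12 12 5)) s (n * (15 * k + 22) + 1) fun s' =>
      s'.mem = s.mem ∧ FillRegs n k m s' ∧ s'.reg 10 = i ∧ s'.reg 11 = x ∧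
      s'.reg 21 = s.reg 21 ∧ s'.reg 25 = b + rank O m i n k x := by
  have hcard : ∀ y, ((Finset.Ico 1 (1 + (y + 1))).filter fun z => Before O m i k z x).card =
      ((Finset.Ico 1 (1 + y)).filter fun z => Before O m i k z x).card +
        if Before O m i k (1 + y) x then 1 else 0 := by
    intro y
    rw [← add_assoc, ← Finset.insert_Ico_right_eq_Ico_add_one (by omega), Finset.filter_insert]
    split_ifs
    · rw [Finset.card_insert_of_notMem (by simp)]
    · simp
  refine (Ht.for (fun y s' => s'.mem = s.mem ∧ FillRegs n k m s' ∧ s'.reg 10 = i ∧ s'.reg 11 = x ∧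
    s'.reg 21 = s.reg 21 ∧ s'.reg 12 = 1 + y ∧
    s'.reg 25 = b + ((Finset.Ico 1 (1 + y)).filter fun z => Before O m i k z x).card)
      n (15 * k + 21) ?_ ?_ ?_).imp ?_
  · rintro y hy s1 ⟨hm, ⟨h0, h1, h4, h5, h6, h24⟩, h10, h11, h21, h12, h25⟩
    refine ⟨by rw [h12, h24]; omega, ?_⟩
    apply Ht.weaken
    · apply Ht.seq (cmpProg_spec ⟨h5, h6⟩)
      rintro s2 ⟨hm2, hf2, h13⟩
      rw [h4, h10, h11, h12, h1] at h13
      have hle := keyCmp_le_two (O := O) (m := m) (j := i) x (1 + y) k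
      have hfr : FillRegs n k m s2 := by
        unfold FillRegs
        rw [hf2 0 (by omega), hf2 1 (by omega), hf2 4 (by omega), hf2 5 (by omega),
          hf2 6 (by omega), hf2 24 (by omega)]
        exact ⟨h0, h1, h4, h5, h6, h24⟩
      have g5 : s2.reg 5 = 1 := by rw [hf2 5 (by omega), h5]
      have g10 : s2.reg 10 = i := by rw [hf2 10 (by omega), h10]
      have g11 : s2.reg 11 = x := by rw [hf2 11 (by omega), h11]
      have g12 : s2.reg 12 = 1 + y := by rw [hf2 12 (by omega), h12]
      have g21 : s2.reg 21 = s.reg 21 := by rw [hf2 21 (by omega), h21]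
      have g25 := hf2 25 (by omega)
      rw [h25] at g25
      apply Ht.seq (Q := fun s' => s'.mem = s.mem ∧ FillRegs n k m s' ∧ s'.reg 10 = i ∧
        s'.reg 11 = x ∧ s'.reg 21 = s.reg 21 ∧ s'.reg 12 = 1 + y ∧
        s'.reg 25 = b + ((Finset.Ico 1 (1 + (y + 1))).filter fun z => Before O m i k z x).card)
      · have hadd : Before O m i k (1 + y) x → Ht O data B (.add 25 25 5) s2 1 fun s' =>
            s'.mem = s.mem ∧ FillRegs n k m s' ∧ s'.reg 10 = i ∧
            s'.reg 11 = x ∧ s'.reg 21 = s.reg 21 ∧ s'.reg 12 = 1 + y ∧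
            s'.reg 25 = b + ((Finset.Ico 1 (1 + (y + 1))).filter
              fun z => Before O m i k z x).card := by
          intro hb
          apply Ht.add
          refine ⟨by rw [State.set_mem, hm2, hm], ?_⟩
          rw [hcard, if_pos hb]
          simpa [FillRegs, State.set_reg, g10, g11, g12, g21, g25, g5, add_assoc] using hfr
        have hskip : ¬ Before O m i k (1 + y) x → Ht O data B .skip s2 1 fun s' =>
            s'.mem = s.mem ∧ FillRegs n k m s' ∧ s'.reg 10 = i ∧
            s'.reg 11 = x ∧ s'.reg 21 = s.reg 21 ∧ s'.reg 12 = 1 + y ∧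
            s'.reg 25 = b + ((Finset.Ico 1 (1 + (y + 1))).filter
              fun z => Before O m i k z x).card := by
          intro hb
          apply Ht.skip
          refine ⟨by rw [hm2, hm], hfr, g10, g11, g21, g12, ?_⟩
          rw [hcard, if_neg hb, g25, add_zero]
        have hbef : Before O m i k (1 + y) x ↔ 1 < s2.reg 13 ∨ s2.reg 13 = 1 ∧ 1 + y < x := by
          rw [Before, keyCmp_swap x (1 + y), h13]; omega
        rw [hbef] at hadd hskip
        apply Ht.ite
        · intro hlt
          exact hadd (by omega)
        · intro hlt
          apply Ht.ite
          · intro hlt'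
            exact hskip (by omega)
          · intro hlt'
            apply Ht.ite
            · intro hlt''
              exact hadd (by omega)
            · intro hlt''
              exact hskip (by omega)
      · rintro s3 ⟨hm3, hfr3, k10, k11, k21, k12, k25⟩
        apply Ht.add
        refine ⟨by rw [State.set_mem, hm3], ?_⟩
        have k5 := hfr3.2.2.2.1
        simpa [FillRegs, State.set_reg, k10, k11, k12, k21, k25, k5, add_assoc] using hfr3
    · rw [h1]; omega
  · rintro s' ⟨hm, hfr, h10, h11, h21, h12, h25⟩
    rw [h12, hfr.2.2.2.2.2]; omega
  · exact ⟨rfl, hs, h10, h11, rfl, h12, by simp [h25]⟩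
  · rintro s' ⟨hm, hfr, h10, h11, h21, h12, h25⟩
    refine ⟨hm, hfr, h10, h11, h21, ?_⟩
    rw [h25, rank]
    congr 3
    ext z; simp; omega

/-- Storing the point `x` at its position in table `i` does not destroy other entries. -/
lemma Filled.put {n k m i x : ℕ} {D : ℕ → ℕ} (h : Filled O n k m i x D)
    (hx : x ∈ Finset.Icc 1 n) :
    Filled O n k m i (x + 1) (Function.update D (4 + (n + m).size + i * n + rank O m i n k x) x) := by
  have hne : ∀ a, a < 4 + (n + m).size →
      Function.update D (4 + (n + m).size + i * n + rank O m i n k x) x a = D a := fun a ha =>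
    Function.update_of_ne (by omega) _ _
  refine ⟨?_, ?_, ?_, ?_, ?_, ?_, ?_⟩
  · rw [hne _ (by omega), h.size]
  · rw [hne _ (by omega), h.keyLen]
  · rw [hne _ (by omega), h.tables]
  · rw [hne _ (by omega), h.bits]
  · intro j hj; rw [hne _ (by omega), h.pow j hj]
  · intro i' hi' x' hx' hlt
    by_cases hxx : i' = i ∧ x' = x
    · obtain ⟨rfl, rfl⟩ := hxx
      simp
    · rw [Function.update_of_ne]
      · exact h.entry i' hi' x' hx' (by omega)
      · -- distinct entries have distinct addresses
        intro he
        have hr := rank_lt (O := O) (m := m) (j := i) (k := k) hx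
        have hr' := rank_lt (O := O) (m := m) (j := i') (k := k) hx'
        have he' : i' * n + rank O m i' n k x' = i * n + rank O m i n k x := by omega
        have hii : i' = i := by
          have h1 : (i' * n + rank O m i' n k x') / n = i' := by
            rw [mul_comm, Nat.mul_add_div (by omega), Nat.div_eq_of_lt hr', add_zero]
          have h2 : (i * n + rank O m i n k x) / n = i := by
            rw [mul_comm, Nat.mul_add_div (by omega), Nat.div_eq_of_lt hr, add_zero]
          rw [← h1, ← h2, he']
        subst hii
        exact hxx ⟨rfl, rank_injOn (by simpa using hx') (by simpa using hx)
          (by omega : rank O m i' n k x' = rank O m i' n k x)⟩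
  · intro a
    by_cases ha : a = 4 + (n + m).size + i * n + rank O m i n k x
    · subst ha
      have := (Finset.mem_Icc.1 hx).2
      simp only [Function.update_self, spaceBound]
      omega
    · rw [Function.update_of_ne ha]; exact h.bound a

lemma fillProg_spec {n k m : ℕ} {s : State} (hs : FillRegs n k m s) (h10 : s.reg 10 = 0)
    (h21 : s.reg 21 = 4 + (n + m).size) (hD : Filled O n k m 0 1 s.mem)
    (hB : spaceBound n k m ≤ B) :
    ∃ τ, Ht O data B fillProg s τ fun s' => Filled O n k m m 1 s'.mem := by
  refine ⟨_, (Ht.for (fun i s' => FillRegs n k m s' ∧ s'.reg 10 = i ∧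
    s'.reg 21 = 4 + (n + m).size + i * n ∧ Filled O n k m i 1 s'.mem) m
    (n * (n * (15 * k + 22) + 1 + 10) + 10) ?_ ?_ ?_).imp ?_⟩
  · rintro i hi s1 ⟨hr1, h10, h21, hD1⟩
    refine ⟨by rw [h10, hr1.2.2.1]; exact hi, ?_⟩
    apply Ht.weaken
    · apply Ht.const_seq
      apply Ht.seq
      · refine Ht.for (fun x s' => FillRegs n k m s' ∧ s'.reg 10 = i ∧
          s'.reg 21 = 4 + (n + m).size + i * n ∧ s'.reg 11 = 1 + x ∧
          Filled O n k m i (1 + x) s'.mem) n (n * (15 * k + 22) + 1 + 8) ?_ ?_ ?_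
        · rintro x hx s2 ⟨hr2, h10, h21, h11, hD2⟩
          have hr2' := hr2
          obtain ⟨h0, h1, h4, h5, h6, h24⟩ := hr2'
          have hxm : 1 + x ∈ Finset.Icc 1 n := Finset.mem_Icc.2 ⟨by omega, by omega⟩
          refine ⟨by rw [h11, h24]; omega, ?_⟩
          apply Ht.weaken
          · apply Ht.add_seq
            apply Ht.const_seq
            apply Ht.seq
            · apply countProg_spec (n := n) (k := k) (m := m) (i := i) (x := 1 + x)
                (b := 4 + (n + m).size + i * n)
              · simpa [FillRegs, State.set_reg] using hr2
              · simpa [State.set_reg] using h10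
              · simpa [State.set_reg] using h11
              · simp [State.set_reg]
              · simp [State.set_reg, h21, h6]
            · rintro s3 ⟨hm3, hr3, k10, k11, k21, k25⟩
              simp only [State.set_mem, State.set_reg] at hm3 k21
              apply Ht.store_seq
              · rw [k25]
                refine lt_of_lt_of_le ?_ hB
                have := rank_lt (O := O) (m := m) (j := i) (k := k) hxm
                have h' : (i + 1) * n ≤ m * n := Nat.mul_le_mul_right n hi
                rw [add_one_mul] at h'
                unfold spaceBound
                omega
              · apply Ht.add
                refine ⟨?_, ?_, ?_, ?_, ?_⟩
                · simpa [FillRegs, State.set_reg, State.put_reg] using hr3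
                · simpa [State.set_reg, State.put_reg] using k10
                · simpa [State.set_reg, State.put_reg, k21] using h21
                · simp [State.set_reg, State.put_reg, k11, hr3.2.2.2.1]; omega
                · have := hD2.put hxm
                  rw [← hm3, ← k25] at this
                  rw [State.set_mem, k11]
                  exact this
          · omega
        · rintro s' ⟨hr, h10, h21, h11, -⟩
          rw [h11, hr.2.2.2.2.2]; omega
        · refine ⟨by simpa [FillRegs, State.set_reg] using hr1, by simpa [State.set_reg] using h10,
            by simpa [State.set_reg] using h21, by simp [State.set_reg], hD1⟩
      · rintro s3 ⟨hr3, k10, k21, k11, hD3⟩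
        apply Ht.add_seq
        apply Ht.add
        refine ⟨by simpa [FillRegs, State.set_reg] using hr3,
          by simp [State.set_reg, k10, hr3.2.2.2.1],
          by simp [State.set_reg, k21, hr3.1]; ring, ?_⟩
        refine { hD3 with entry := fun i' hi' x' hx' hlt => hD3.entry i' hi' x' hx' ?_ }
        have := Finset.mem_Icc.1 hx'
        omega
    · have : n * (n * (15 * k + 22) + 1 + 8 + 1) ≤ n * (n * (15 * k + 22) + 1 + 10) :=
        Nat.mul_le_mul_left _ (by omega)
      omega
  · rintro s' ⟨hr, h10, -⟩
    rw [h10, hr.2.2.1]; omega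
  · exact ⟨hs, h10, by simp [h21], hD⟩
  · rintro s' ⟨-, -, -, h⟩
    exact h

lemma headerProg_spec (n k L t : ℕ) (hB : spaceBound n k (t * L) ≤ B) :
    ∃ τ, Ht O data B headerProg ⟨fun i => [n, k, L, t].getD i 0, fun _ => 0⟩ τ fun s' =>
      FillRegs n k (t * L) s' ∧ s'.reg 10 = 0 ∧ s'.reg 21 = 4 + (n + t * L).size ∧
      Filled O n k (t * L) 0 1 s'.mem := by
  set m := t * L with hm
  have hsz := size_le_self (n + m)
  apply Exists.intro
  apply Ht.const_seq
  apply Ht.seq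
  · refine Ht.for (fun i s' => s'.mem = (fun _ => 0) ∧ s'.reg 4 = i * L ∧ s'.reg 20 = i ∧
      s'.reg 5 = 1 ∧ ∀ r, r ≠ 4 → r ≠ 5 → r ≠ 20 → s'.reg r = [n, k, L, t].getD r 0) t 3 ?_ ?_ ?_
    · rintro i hi s1 ⟨hm1, h4, h20, h5, hf⟩
      refine ⟨by rw [h20, hf 3 (by omega) (by omega) (by omega)]; simpa using hi, ?_⟩
      refine Ht.weaken (τ := 1 + 1 + 1) ?_ (by norm_num)
      apply Ht.add_seq
      apply Ht.add
      refine ⟨hm1, ?_, ?_, ?_, ?_⟩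
      · simp [State.set_reg, h4, hf 2, add_one_mul]
      · simp [State.set_reg, h20, h5]
      · simp [State.set_reg, h5]
      · intro r h h' h''
        simp [State.set_reg, h, h'', hf r h h' h'']
    · rintro s1 ⟨hm1, h4, h20, h5, hf⟩
      rw [h20, hf 3 (by omega) (by omega) (by omega)]
      simp
    · refine ⟨rfl, by simp [State.set_reg], by simp [State.set_reg], by simp [State.set_reg], ?_⟩
      intro r h h' h''
      simp [State.set_reg, h']
  rintro s1 ⟨hm1, h4, h20, h5, hf⟩
  have e0 : s1.reg 0 = n := by simp [hf 0]
  have e1 : s1.reg 1 = k := by simp [hf 1]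
  have e6 : s1.reg 6 = 0 := by simp [hf 6]
  have e7 : s1.reg 7 = 0 := by simp [hf 7]
  have e10 : s1.reg 10 = 0 := by simp [hf 10]
  apply Ht.add_seq
  apply Ht.add_seq
  apply Ht.const_seq
  apply Ht.const_seq
  apply Ht.seq
  · refine Ht.for (fun i s' => s'.reg 0 = n ∧ s'.reg 1 = k ∧ s'.reg 4 = m ∧ s'.reg 5 = 1 ∧
      s'.reg 6 = 0 ∧ s'.reg 10 = 0 ∧ s'.reg 9 = n + m + 1 ∧ s'.reg 8 = 2 ^ i ∧ s'.reg 7 = i ∧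
      s'.reg 21 = 4 + i ∧ (∀ j < i, s'.mem (4 + j) = 2 ^ j) ∧
      ∀ a, s'.mem a ≤ spaceBound n k m) (n + m).size 7 ?_ ?_ ?_
    · rintro i hi s2 ⟨h0, h1, h4, h5, h6, h10, h9, h8, h7, h21, hp, hb⟩
      have hle := Nat.lt_size.1 hi
      refine ⟨by rw [h8, h9]; omega, ?_⟩
      apply Ht.weaken
      · apply Ht.store_seq
        · rw [h21]
          refine lt_of_lt_of_le ?_ hB
          unfold spaceBound; omega
        apply Ht.add_seq
        apply Ht.add_seq
        apply Ht.add
        simp only [State.set_mem, State.put_mem]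
        simp [State.set_reg, State.put_reg, h0, h1, h4, h5, h6, h10, h9, h8, h7, h21]
        refine ⟨by ring, by ring, fun j hj => ?_, fun a => ?_⟩
        · split_ifs with he
          · rw [he]
          · exact hp j (by omega)
        · split_ifs with he
          · unfold spaceBound; omega
          · exact hb a
      · norm_num
    · rintro s2 ⟨h0, h1, h4, h5, h6, h10, h9, h8, h7, h21, hp, hb⟩
      rw [h8, h9]
      have := Nat.lt_size_self (n + m)
      omega
    · simp [State.set_reg, State.set_mem, e0, e1, e6, e7, e10, h4, h5, hm1, hm]
  rintro s2 ⟨h0, h1, h4, h5, h6, h10, h9, h8, h7, h21, hp, hb⟩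
  have hB' : 3 < B := lt_of_lt_of_le (by unfold spaceBound; omega) hB
  apply Ht.store_seq
  · rw [h6]; omega
  apply Ht.store_seq
  · simp [State.put_reg, h5]; omega
  apply Ht.const_seq
  apply Ht.store_seq
  · simp [State.put_reg, State.set_reg]; omega
  apply Ht.const_seq
  apply Ht.store_seq
  · simp [State.put_reg, State.set_reg]; omega
  apply Ht.add
  refine ⟨?_, ?_, ?_, ?_⟩
  · simp [FillRegs, State.put_reg, State.set_reg, *]
  · simp [State.put_reg, State.set_reg, *]
  · simp [State.put_reg, State.set_reg, *]
  · constructor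
    · simp [State.put_reg, State.set_reg, State.set_mem, State.put_mem, *]
    · simp [State.put_reg, State.set_reg, State.set_mem, State.put_mem, *]
    · simp [State.put_reg, State.set_reg, State.set_mem, State.put_mem, *]
    · simp [State.put_reg, State.set_reg, State.set_mem, State.put_mem, *]
    · intro i hi
      simp only [State.put_reg, State.set_reg, State.set_mem, State.put_mem, h5, h6]
      simp
      rw [if_neg (by omega), if_neg (by omega), if_neg (by omega), hp i hi]
    · intro i' _ x' hx' hlt
      have := Finset.mem_Icc.1 hx'
      omega
    · intro a
      simp only [State.put_reg, State.set_reg, State.set_mem, State.put_mem, h5, h6, h0, h1, h4, h7]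
      simp
      have := hb a
      split_ifs <;> first | exact this | (unfold spaceBound; omega)

lemma preProg_spec (n k L t : ℕ) (hB : spaceBound n k (t * L) ≤ B) :
    ∃ τ, Ht O data B preProg ⟨fun i => [n, k, L, t].getD i 0, fun _ => 0⟩ τ fun s' =>
      IsDS O n k (t * L) s'.mem ∧ ∀ a, s'.mem a ≤ spaceBound n k (t * L) := by
  obtain ⟨τ, h⟩ := headerProg_spec (O := O) (data := data) n k L t hB
  obtain ⟨s₁, ⟨hr, h10, h21, hD⟩, h⟩ := h
  obtain ⟨τ', h'⟩ := fillProg_spec (data := data) hr h10 h21 hD hB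
  apply Exists.intro
  apply Ht.seq (Q := (· = s₁)) ⟨s₁, rfl, h⟩
  rintro _ rfl
  refine h'.imp fun s' hs' => ⟨⟨hs'.size, hs'.keyLen, hs'.tables, hs'.bits, hs'.pow, ?_⟩, hs'.bound⟩
  exact fun i hi x hx => hs'.entry i hi x hx (Or.inl hi)

lemma preProg_randFree : RandFree preProg := by
  simp [preProg, headerProg, fillProg, cmpProg, RandFree]

/-! ### The slots of the buckets of a query -/

section slots

variable (O) (n k m : ℕ)

/-- The position of the first entry of table `i` in the data structure. -/
def tableStart (i : ℕ) : ℕ := 4 + (n + m).size + i * n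

/-- The points in the bucket of the query in table `i`. -/
def bucket (i : ℕ) : Finset ℕ := (Finset.Icc 1 n).filter fun x => keyCmp O m i x 0 k = 1

/-- The total size of the buckets of the query in the first `i` tables. -/
def cum (i : ℕ) : ℕ :=
  ∑ i' ∈ Finset.range i, (below O m i' n k 2 - below O m i' n k 1)

/-- The members of all buckets of the query, counted with multiplicity, are numbered by slots
`r < cum m`; this is the table to which a slot belongs. -/
def slotTable (r : ℕ) : ℕ := Nat.findGreatest (fun i => cum O n k m i ≤ r) (m - 1)

/-- Adding the number of a slot of table `i` to `offset i` gives the address of its entry. -/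
def offset (i : ℕ) : ℕ := tableStart n m i + below O m i n k 1 - cum O n k m i

/-- The point in a slot. -/
def slotPoint (D : ℕ → ℕ) (r : ℕ) : ℕ := D (offset O n k m (slotTable O n k m r) + r)

variable {O n k m}

lemma cum_succ (i : ℕ) :
    cum O n k m (i + 1) = cum O n k m i + (below O m i n k 2 - below O m i n k 1) :=
  Finset.sum_range_succ _ _

lemma cum_mono : Monotone (cum O n k m) :=
  monotone_nat_of_le_succ fun i => by rw [cum_succ]; omega

lemma cum_le (i : ℕ) : cum O n k m i ≤ i * n := by
  refine (Finset.sum_le_card_nsmul _ _ n fun i' _ => ?_).trans (by simp)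
  exact (Nat.sub_le _ _).trans (below_le n k 2)

lemma le_slotTable {r v : ℕ} (hr : r < cum O n k m m) :
    v ≤ slotTable O n k m r ↔ v < m ∧ cum O n k m v ≤ r := by
  have hm : 0 < m := by
    rcases Nat.eq_zero_or_pos m with rfl | h
    · simp [cum] at hr
    · exact h
  have h0 : cum O n k m (slotTable O n k m r) ≤ r :=
    Nat.findGreatest_spec (P := fun i => cum O n k m i ≤ r) (Nat.zero_le (m - 1)) (by simp [cum])
  constructor
  · intro h
    have : slotTable O n k m r ≤ m - 1 := Nat.findGreatest_le _
    exact ⟨by omega, (cum_mono h).trans h0⟩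
  · rintro ⟨h1, h2⟩
    exact Nat.le_findGreatest (by omega) h2

lemma slotTable_lt {r : ℕ} (hr : r < cum O n k m m) : slotTable O n k m r < m :=
  ((le_slotTable hr).1 le_rfl).1

lemma slotTable_eq {i y : ℕ} (hi : i < m) (hy : y < below O m i n k 2 - below O m i n k 1) :
    slotTable O n k m (cum O n k m i + y) = i := by
  have hlt : cum O n k m i + y < cum O n k m (i + 1) := by rw [cum_succ]; omega
  have hr : cum O n k m i + y < cum O n k m m := hlt.trans_le (cum_mono hi)
  apply le_antisymm
  · by_contra! h
    have := ((le_slotTable hr).1 (show i + 1 ≤ _ from h)).2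
    omega
  · exact (le_slotTable hr).2 ⟨hi, by omega⟩

lemma mem_bucket_iff_rank {i x : ℕ} (hx : x ∈ Finset.Icc 1 n) : x ∈ bucket O n k m i ↔
    below O m i n k 1 ≤ rank O m i n k x ∧ rank O m i n k x < below O m i n k 2 := by
  rw [rank_lt_below hx, ← not_lt, rank_lt_below hx, bucket, Finset.mem_filter]
  constructor
  · rintro ⟨-, h⟩; omega
  · intro h; exact ⟨hx, by omega⟩

/-- The bucket of the query in table `i` is the segment of the table between the two results of
the binary search. -/
lemma sum_slots_table {D : ℕ → ℕ} (hD : IsDS O n k m D) {i : ℕ} (hi : i < m) {M : Type*}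
    [AddCommMonoid M] (G : ℕ → M) :
    ∑ y ∈ Finset.range (below O m i n k 2 - below O m i n k 1),
      G (D (tableStart n m i + below O m i n k 1 + y)) = ∑ x ∈ bucket O n k m i, G x := by
  have hmem : ∀ x ∈ bucket O n k m i, x ∈ Finset.Icc 1 n := fun x hx => Finset.mem_of_mem_filter x hx
  symm
  refine Finset.sum_bij (fun x _ => rank O m i n k x - below O m i n k 1) ?_ ?_ ?_ ?_
  · intro x hx
    have := (mem_bucket_iff_rank (hmem x hx)).1 hx
    simp only [Finset.mem_range]; omega
  · intro x hx x' hx' h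
    have h1 := (mem_bucket_iff_rank (hmem x hx)).1 hx
    have h2 := (mem_bucket_iff_rank (hmem x' hx')).1 hx'
    exact rank_injOn (by simpa using hmem x hx) (by simpa using hmem x' hx')
      (show rank O m i n k x = rank O m i n k x' by omega)
  · intro y hy
    simp only [Finset.mem_range] at hy
    have hle := below_le (O := O) (m := m) (j := i) n k 2
    obtain ⟨x, hx, hr⟩ := exists_rank_eq (O := O) (m := m) (j := i) (k := k) (n := n)
      (y := below O m i n k 1 + y) (by omega)
    exact ⟨x, (mem_bucket_iff_rank hx).2 (by omega), by omega⟩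
  · intro x hx
    have h1 := (mem_bucket_iff_rank (hmem x hx)).1 hx
    have := hD.entry i hi x (hmem x hx)
    rw [tableStart, add_assoc _ (below O m i n k 1), Nat.add_sub_cancel' h1.1, this]

/-- Summing over the slots is summing over the members of all buckets. -/
lemma sum_slots {D : ℕ → ℕ} (hD : IsDS O n k m D) {M : Type*} [AddCommMonoid M]
    (G : ℕ → ℕ → M) :
    ∑ r ∈ Finset.range (cum O n k m m), G (slotTable O n k m r) (slotPoint O n k m D r) =
      ∑ i ∈ Finset.range m, ∑ x ∈ bucket O n k m i, G i x := by
  have key : ∀ i ≤ m, ∑ r ∈ Finset.range (cum O n k m i),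
      G (slotTable O n k m r) (slotPoint O n k m D r) =
      ∑ i ∈ Finset.range i, ∑ x ∈ bucket O n k m i, G i x := by
    intro i
    induction i with
    | zero => intro _; simp [cum]
    | succ i ih =>
      intro hi
      rw [cum_succ, Finset.sum_range_add, ih (by omega), Finset.sum_range_succ,
        ← sum_slots_table hD (by omega)]
      congr 1
      refine Finset.sum_congr rfl fun y hy => ?_
      rw [Finset.mem_range] at hy
      rw [slotPoint, slotTable_eq (by omega) hy, offset]
      have := cum_le (O := O) (n := n) (k := k) (m := m) i
      congr 2
      unfold tableStart
      omega
  exact key m le_rfl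

end slots

/-! ### Binary search -/

/-- The memory and the registers that matter outside of a search are unchanged: `R[11], …, R[17]` are
used by comparisons, and the registers from `R[30]` on by the search itself. -/
def Same (s s' : State) : Prop :=
  s'.mem = s.mem ∧ ∀ r, (r < 11 ∨ 18 ≤ r ∧ r < 30) → s'.reg r = s.reg r

lemma Same.refl (s : State) : Same s s := ⟨rfl, fun _ _ => rfl⟩

lemma Same.trans {s s' s'' : State} (h : Same s s') (h' : Same s' s'') : Same s s'' :=
  ⟨h'.1.trans h.1, fun r hr => (h'.2 r hr).trans (h.2 r hr)⟩

lemma Same.set {s s' : State} (h : Same s s') {d : ℕ} (v : ℕ)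
    (hd : ¬ (d < 11 ∨ 18 ≤ d ∧ d < 30)) : Same s (s'.set d v) :=
  ⟨h.1, fun r hr => by rw [State.set_reg, if_neg (by rintro rfl; exact hd hr)]; exact h.2 r hr⟩

/-- Binary search for the largest number `v` that passes a monotone test (or `0`), from the most
significant bit to the least significant one; result in `R[30]`.  The test reads `v` from `R[32]` and puts its result in `R[35]`. The
powers of two are read from the data structure. -/
def bsProg (test : Prog) : Prog :=
  .const 30 0 ;; .add 31 7 6 ;;
  .loop 6 31 (
    .sub 31 31 5 ;; .const 34 4 ;; .add 34 34 31 ;; .read 34 34 ;; .add 32 30 34 ;;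
    test ;;
    .ite 6 35 (.add 30 32 6) .skip)

lemma bsProg_spec {test : Prog} {s : State} {a J τ : ℕ} (h5 : s.reg 5 = 1) (h6 : s.reg 6 = 0)
    (h7 : s.reg 7 = J) (hpow : ∀ i < J, data (4 + i) = 2 ^ i) (ha : a < 2 ^ J)
    (htest : ∀ s', Same s s' → 1 ≤ s'.reg 32 → Ht O data B test s' τ fun s'' =>
      Same s s'' ∧ s''.reg 30 = s'.reg 30 ∧ s''.reg 31 = s'.reg 31 ∧ s''.reg 32 = s'.reg 32 ∧
      s''.reg 35 = if s'.reg 32 ≤ a then 1 else 0) :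
    Ht O data B (bsProg test) s (J * (τ + 15) + 5) fun s' => Same s s' ∧ s'.reg 30 = a := by
  apply Ht.weaken
  · apply Ht.const_seq
    apply Ht.add_seq
    refine (Ht.for (fun i s' => Same s s' ∧ s'.reg 31 = J - i ∧ s'.reg 30 ≤ a ∧
      a < s'.reg 30 + 2 ^ (J - i)) J (τ + 14) ?_ ?_ ?_).imp ?_
    · rintro i hi s1 ⟨hs, h31, hle, hlt⟩
      have e5 : s1.reg 5 = 1 := by rw [hs.2 5 (by omega), h5]
      have e6 : s1.reg 6 = 0 := by rw [hs.2 6 (by omega), h6]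
      have hJ : J - i = (J - (i + 1)) + 1 := by omega
      refine ⟨by rw [h31, e6]; omega, ?_⟩
      rw [hJ, pow_succ] at hlt
      apply Ht.weaken
      · apply Ht.sub_seq
        apply Ht.const_seq
        apply Ht.add_seq
        apply Ht.read_seq
        apply Ht.add_seq
        set s2 := State.set _ 32 _ with hs2
        have hS : Same s s2 := ((((hs.set _ (by omega)).set _ (by omega)).set _ (by omega)).set _
          (by omega)).set _ (by omega)
        have g30 : s2.reg 30 = s1.reg 30 := by simp [hs2, State.set_reg]
        have g31 : s2.reg 31 = J - (i + 1) := by simp [hs2, State.set_reg, h31, e5]; omega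
        have g32 : s2.reg 32 = s1.reg 30 + 2 ^ (J - (i + 1)) := by
          simp only [hs2, State.set_reg, h31, e5]
          simp
          have := hpow (J - (i + 1)) (by omega)
          rw [hJ]
          simpa using this
        have hpos : 0 < 2 ^ (J - (i + 1)) := by positivity
        apply Ht.seq (htest s2 hS (by omega))
        rintro s3 ⟨hS3, k30, k31, k32, k35⟩
        have k6 : s3.reg 6 = 0 := by rw [hS3.2 6 (by omega), h6]
        rw [g30] at k30
        rw [g31] at k31
        rw [g32] at k32
        rw [g32] at k35
        apply Ht.ite
        · intro h
          have hv : s1.reg 30 + 2 ^ (J - (i + 1)) ≤ a := by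
            by_contra hv
            rw [if_neg hv] at k35
            omega
          apply Ht.add
          refine ⟨hS3.set _ (by omega), ?_, ?_, ?_⟩
          · simp [State.set_reg, k31]
          · simp [State.set_reg, k32, k6, hv]
          · simp [State.set_reg, k32, k6]; omega
        · intro h
          have hv : ¬ s1.reg 30 + 2 ^ (J - (i + 1)) ≤ a := by
            intro hv
            rw [if_pos hv] at k35
            omega
          apply Ht.skip
          exact ⟨hS3, k31, by omega, by omega⟩
      · omega
    · rintro s' ⟨hs, h31, -⟩
      rw [h31, hs.2 6 (by omega), h6]; omega
    · refine ⟨((Same.refl s).set _ (by omega)).set _ (by omega), ?_, ?_, ?_⟩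
      · simp [State.set_reg, h6, h7]
      · simp [State.set_reg]
      · simpa [State.set_reg] using ha
    · rintro s' ⟨hs, h31, hle, hlt⟩
      simp at hlt
      exact ⟨hs, by omega⟩
  · rw [show τ + 15 = τ + 14 + 1 by omega]; omega

/-! ### The deterministic parts of the query -/

/-- The registers that are constant during a query. -/
def QRegs (n k m : ℕ) (s : State) : Prop :=
  s.reg 0 = n ∧ s.reg 1 = k ∧ s.reg 4 = m ∧ s.reg 5 = 1 ∧ s.reg 6 = 0 ∧ s.reg 7 = (n + m).size

lemma QRegs.same {n k m : ℕ} {s s' : State} (h : QRegs n k m s) (hs : Same s s') :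
    QRegs n k m s' := by
  unfold QRegs
  rw [hs.2 0 (by omega), hs.2 1 (by omega), hs.2 4 (by omega), hs.2 5 (by omega),
    hs.2 6 (by omega), hs.2 7 (by omega)]
  exact h

/-- Tests whether the point at position `R[32] - 1` of table `R[10]`, which starts at address
`R[21]`, has a key below the threshold `R[22]` relative to the key of the query. -/
def lookupTest : Prog :=
  .const 35 0 ;;
  .ite 0 32 .skip (
    .add 33 21 32 ;; .sub 33 33 5 ;; .read 11 33 ;; .const 12 0 ;; cmpProg ;;
    .ite 13 22 (.const 35 1) .skip)

lemma lookupTest_spec {n k m i : ℕ} (hD : IsDS O n k m data) (hi : i < m) {s : State}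
    (hs : QRegs n k m s) (h10 : s.reg 10 = i) (h21 : s.reg 21 = tableStart n m i)
    (hv : 1 ≤ s.reg 32) :
    Ht O data B lookupTest s (15 * k + 26) fun s' => Same s s' ∧ s'.reg 30 = s.reg 30 ∧
      s'.reg 31 = s.reg 31 ∧ s'.reg 32 = s.reg 32 ∧
      s'.reg 35 = if s.reg 32 ≤ below O m i n k (s.reg 22) then 1 else 0 := by
  obtain ⟨h0, h1, h4, h5, h6, h7⟩ := hs
  have hle := below_le (O := O) (m := m) (j := i) n k (s.reg 22)
  apply Ht.weaken
  · apply Ht.const_seq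
    apply Ht.ite
    · intro h
      simp [State.set_reg, h0] at h
      apply Ht.skip
      rw [if_neg (by omega)]
      exact ⟨(Same.refl s).set _ (by omega), by simp [State.set_reg]⟩
    · intro h
      simp [State.set_reg, h0] at h
      apply Ht.add_seq
      apply Ht.sub_seq
      apply Ht.read_seq
      apply Ht.const_seq
      obtain ⟨x, hx, hr⟩ := exists_rank_eq (O := O) (m := m) (j := i) (k := k) (n := n)
        (y := s.reg 32 - 1) (by omega)
      have hent := hD.entry i hi x hx
      set s1 := State.set _ 12 _ with hs1
      have hS : Same s s1 := (((((Same.refl s).set _ (by omega)).set _ (by omega)).set _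
        (by omega)).set _ (by omega)).set _ (by omega)
      have g11 : s1.reg 11 = x := by
        simp [hs1, State.set_reg, h5, h21]
        rw [← hent, hr, tableStart]
        congr 1
        omega
      have g35 : s1.reg 35 = 0 := by simp [hs1, State.set_reg]
      have g12 : s1.reg 12 = 0 := by simp [hs1, State.set_reg]
      have g30 : s1.reg 30 = s.reg 30 := by simp [hs1, State.set_reg]
      have g31 : s1.reg 31 = s.reg 31 := by simp [hs1, State.set_reg]
      have g32 : s1.reg 32 = s.reg 32 := by simp [hs1, State.set_reg]
      clear_value s1
      apply Ht.seq
      · apply Ht.weaken (cmpProg_spec (s := s1) ⟨?_, ?_⟩) (τ' := 15 * k + 8)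
        · rw [hS.2 1 (by omega), h1]
        · rw [hS.2 5 (by omega), h5]
        · rw [hS.2 6 (by omega), h6]
      rintro s2 ⟨hm2, hf2, k13⟩
      rw [g11, g12, hS.2 4 (by omega), hS.2 10 (by omega), hS.2 1 (by omega), h4, h10, h1] at k13
      have hS2 : Same s s2 := hS.trans ⟨hm2, fun r hr => hf2 r (by omega)⟩
      have hiff : s.reg 32 ≤ below O m i n k (s.reg 22) ↔ s2.reg 13 < s2.reg 22 := by
        rw [k13, hS2.2 22 (by omega), ← rank_lt_below hx, hr]
        omega
      apply Ht.ite
      · intro h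
        apply Ht.const
        rw [if_pos (hiff.2 h)]
        refine ⟨hS2.set _ (by omega), ?_⟩
        simp [State.set_reg, *]
      · intro h
        apply Ht.skip
        rw [if_neg (fun h' => h (hiff.1 h'))]
        refine ⟨hS2, ?_⟩
        rw [hf2 30 (by omega), hf2 31 (by omega), hf2 32 (by omega), hf2 35 (by omega)]
        exact ⟨g30, g31, g32, g35⟩
  · omega

/-- Reads the header of the data structure. -/
def loadProg : Prog :=
  .const 5 1 ;; .read 0 6 ;; .read 1 5 ;; .const 20 2 ;; .read 4 20 ;; .const 20 3 ;;
  .read 7 20 ;; .const 20 4 ;; .add 21 20 7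

/-- Locates the bucket of the query in each table.  Afterwards cell `i` holds the number of the first
slot of table `i`, cell `m + i` the offset of its slots, and `R[24]` the number of slots. -/
def tablesProg : Prog :=
  .const 10 0 ;; .const 24 0 ;;
  .loop 10 4 (
    .const 22 1 ;; bsProg lookupTest ;; .add 25 30 6 ;;
    .const 22 2 ;; bsProg lookupTest ;;
    .store 10 24 ;;
    .add 26 21 25 ;; .sub 26 26 24 ;; .add 27 4 10 ;; .store 27 26 ;;
    .add 24 24 30 ;; .sub 24 24 25 ;; .add 21 21 0 ;; .add 10 10 5)

lemma loadProg_spec {n k m : ℕ} (hD : IsDS O n k m data) (e : ℕ) :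
    Ht O data B loadProg ⟨fun i => [e].getD i 0, fun _ => 0⟩ 17 fun s' =>
      QRegs n k m s' ∧ s'.reg 21 = tableStart n m 0 := by
  apply Ht.weaken
  · apply Ht.const_seq
    apply Ht.read_seq
    apply Ht.read_seq
    apply Ht.const_seq
    apply Ht.read_seq
    apply Ht.const_seq
    apply Ht.read_seq
    apply Ht.const_seq
    apply Ht.add
    simp [QRegs, State.set_reg, hD.size, hD.keyLen, hD.tables, hD.bits, tableStart]
  · norm_num

lemma lookup_spec {n k m i : ℕ} (hD : IsDS O n k m data) (hi : i < m) {s : State}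
    (hs : QRegs n k m s) (h10 : s.reg 10 = i) (h21 : s.reg 21 = tableStart n m i) (θ : ℕ)
    (h22 : s.reg 22 = θ) :
    Ht O data B (bsProg lookupTest) s ((n + m).size * (15 * k + 41) + 5) fun s' =>
      Same s s' ∧ s'.reg 30 = below O m i n k θ := by
  refine bsProg_spec (τ := 15 * k + 26) hs.2.2.2.1 hs.2.2.2.2.1 hs.2.2.2.2.2 hD.pow ?_ ?_
  · have := Nat.lt_size_self (n + m)
    have := below_le (O := O) (m := m) (j := i) n k θ
    omega
  · intro s' hS hv
    refine (lookupTest_spec hD hi (hs.same hS) (by rw [hS.2 10 (by omega), h10])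
      (by rw [hS.2 21 (by omega), h21]) hv).imp ?_
    rintro s'' ⟨hS', h30, h31, h32, h35⟩
    rw [hS.2 22 (by omega), h22] at h35
    exact ⟨hS.trans hS', h30, h31, h32, h35⟩

/-- The memory contents after the buckets of the query have been located in the first `i` tables. -/
def Located (O : Oracle) (n k m i : ℕ) (mem : ℕ → ℕ) : Prop :=
  ∀ i' < i, mem i' = cum O n k m i' ∧ mem (m + i') = offset O n k m i'

lemma tablesProg_spec {n k m : ℕ} (hD : IsDS O n k m data) {s : State} (hs : QRegs n k m s)
    (h21 : s.reg 21 = tableStart n m 0) (hB : spaceBound n k m ≤ B) :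
    Ht O data B tablesProg s (m * (2 * ((n + m).size * (15 * k + 41)) + 40) + 5) fun s' =>
      QRegs n k m s' ∧ s'.reg 24 = cum O n k m m ∧ Located O n k m m s'.mem := by
  apply Ht.weaken
  · apply Ht.const_seq
    apply Ht.const_seq
    refine (Ht.for (fun i s' => QRegs n k m s' ∧ s'.reg 10 = i ∧ s'.reg 21 = tableStart n m i ∧
      s'.reg 24 = cum O n k m i ∧ Located O n k m i s'.mem) m
      (2 * ((n + m).size * (15 * k + 41)) + 39) ?_ ?_ ?_).imp ?_
    · rintro i hi s1 ⟨hq, h10, h21, h24, hloc⟩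
      refine ⟨by rw [h10, hq.2.2.1]; exact hi, ?_⟩
      apply Ht.weaken
      · apply Ht.const_seq
        apply Ht.seq
        · apply lookup_spec hD hi (θ := 1)
          · simpa [QRegs, State.set_reg] using hq
          · simpa [State.set_reg] using h10
          · simpa [State.set_reg] using h21
          · simp [State.set_reg]
        rintro s2 ⟨hS2, h30⟩
        have hq2 : QRegs n k m s2 := QRegs.same (by simpa [QRegs, State.set_reg] using hq) hS2
        have k10 : s2.reg 10 = i := by simpa [State.set_reg, h10] using hS2.2 10 (by omega)
        have k21 : s2.reg 21 = tableStart n m i := by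
          simpa [State.set_reg, h21] using hS2.2 21 (by omega)
        have k24 : s2.reg 24 = cum O n k m i := by
          simpa [State.set_reg, h24] using hS2.2 24 (by omega)
        have hm2 : s2.mem = s1.mem := hS2.1
        clear hS2
        apply Ht.add_seq
        apply Ht.const_seq
        apply Ht.seq
        · apply lookup_spec hD hi (θ := 2)
          · simpa [QRegs, State.set_reg] using hq2
          · simpa [State.set_reg] using k10
          · simpa [State.set_reg] using k21
          · simp [State.set_reg]
        rintro s3 ⟨hS3, l30⟩
        have hq3 : QRegs n k m s3 := QRegs.same (by simpa [QRegs, State.set_reg] using hq2) hS3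
        have l10 : s3.reg 10 = i := by simpa [State.set_reg, k10] using hS3.2 10 (by omega)
        have l21 : s3.reg 21 = tableStart n m i := by
          simpa [State.set_reg, k21] using hS3.2 21 (by omega)
        have l24 : s3.reg 24 = cum O n k m i := by
          simpa [State.set_reg, k24] using hS3.2 24 (by omega)
        have l25 : s3.reg 25 = below O m i n k 1 := by
          simpa [State.set_reg, h30, hq2.2.2.2.2.1] using hS3.2 25 (by omega)
        have hm3 : s3.mem = s1.mem := hS3.1.trans hm2
        obtain ⟨l0, l1, l4, l5, l6, l7⟩ := hq3
        have hspace : m + i < B ∧ i < B := by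
          have : 2 * m < B := lt_of_lt_of_le (by unfold spaceBound; omega) hB
          omega
        apply Ht.store_seq
        · rw [l10]; exact hspace.2
        apply Ht.add_seq
        apply Ht.sub_seq
        apply Ht.add_seq
        apply Ht.store_seq
        · simp [State.set_reg, State.put_reg, l4, l10]; exact hspace.1
        apply Ht.add_seq
        apply Ht.sub_seq
        apply Ht.add_seq
        apply Ht.add
        refine ⟨?_, ?_, ?_, ?_, ?_⟩
        · simp [QRegs, State.set_reg, State.put_reg, l0, l1, l4, l5, l6, l7]
        · simp [State.set_reg, State.put_reg, l10, l5]
        · simp [State.set_reg, State.put_reg, l21, l0, tableStart]; ring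
        · have := below_mono (O := O) (m := m) (j := i) n k (show 1 ≤ 2 by omega)
          simp [State.set_reg, State.put_reg, l24, l25, l30, cum_succ]
          omega
        · intro i' hi'
          simp [State.set_reg, State.put_reg, State.set_mem, State.put_mem, l4, l10, l21, l24, l25,
            hm3]
          rw [if_neg (by omega), if_neg (by omega : ¬ m + i' = i)]
          rcases Nat.lt_succ_iff_lt_or_eq.1 hi' with hlt | rfl
          · rw [if_neg (by omega), if_neg (by omega)]
            exact hloc i' hlt
          · simp [offset]
      · rw [two_mul]; omega
    · rintro s' ⟨hq, h10, -⟩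
      rw [h10, hq.2.2.1]; omega
    · refine ⟨by simpa [QRegs, State.set_reg] using hs, by simp [State.set_reg],
        by simpa [State.set_reg] using h21, by simp [State.set_reg, cum], ?_⟩
      intro i' hi'; omega
    · rintro s' ⟨hq, -, -, h24, hloc⟩
      exact ⟨hq, h24, hloc⟩
  · exact le_of_eq (by ring)

/-- Tests whether the slots of table `R[32]` do not begin after slot `R[23]`. -/
def pickTest : Prog :=
  .const 35 0 ;; .ite 32 4 (.load 33 32 ;; .ite 23 33 .skip (.const 35 1)) .skip

/-- Puts the table of slot `R[23]` in `R[30]` and its point in `R[11]`, and tests whether this point is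
near. -/
def pickProg : Prog :=
  bsProg pickTest ;; .add 33 4 30 ;; .load 33 33 ;; .add 33 33 23 ;; .read 11 33 ;;
  .const 12 0 ;; .near 36 11

lemma pickTest_spec {n k m r : ℕ} {s : State} (hs : QRegs n k m s)
    (hloc : Located O n k m m s.mem) (h23 : s.reg 23 = r) (hr : r < cum O n k m m) :
    Ht O data B pickTest s 9 fun s' => Same s s' ∧ s'.reg 30 = s.reg 30 ∧
      s'.reg 31 = s.reg 31 ∧ s'.reg 32 = s.reg 32 ∧
      s'.reg 35 = if s.reg 32 ≤ slotTable O n k m r then 1 else 0 := by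
  have hiff := le_slotTable (v := s.reg 32) hr
  apply Ht.weaken
  · apply Ht.const_seq
    apply Ht.ite
    · intro h
      simp [State.set_reg, hs.2.2.1] at h
      have hc := (hloc _ h).1
      apply Ht.load_seq
      apply Ht.ite
      · intro h'
        simp [State.set_reg, State.set_mem, h23, hc] at h'
        apply Ht.skip
        rw [if_neg (by rw [hiff]; omega)]
        exact ⟨((Same.refl s).set _ (by omega)).set _ (by omega), by simp [State.set_reg]⟩
      · intro h'
        simp [State.set_reg, State.set_mem, h23, hc] at h'
        apply Ht.const
        rw [if_pos (hiff.2 ⟨h, h'⟩)]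
        exact ⟨(((Same.refl s).set _ (by omega)).set _ (by omega)).set _ (by omega),
          by simp [State.set_reg]⟩
    · intro h
      simp [State.set_reg, hs.2.2.1] at h
      apply Ht.skip
      rw [if_neg (by rw [hiff]; omega)]
      exact ⟨(Same.refl s).set _ (by omega), by simp [State.set_reg]⟩
  · norm_num

open Classical in
lemma pickProg_spec {n k m r : ℕ} (hD : IsDS O n k m data) {s : State} (hs : QRegs n k m s)
    (hloc : Located O n k m m s.mem) (h23 : s.reg 23 = r) (hr : r < cum O n k m m) :
    Ht O data B pickProg s (24 * (n + m).size + 20) fun s' => Same s s' ∧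
      s'.reg 30 = slotTable O n k m r ∧ s'.reg 11 = slotPoint O n k m data r ∧ s'.reg 12 = 0 ∧
      s'.reg 36 = if O.near (slotPoint O n k m data r) then 1 else 0 := by
  have hlt := slotTable_lt hr
  apply Ht.weaken
  · apply Ht.seq
    · apply bsProg_spec (a := slotTable O n k m r) (τ := 9) hs.2.2.2.1 hs.2.2.2.2.1 hs.2.2.2.2.2
        hD.pow
      · have := Nat.lt_size_self (n + m)
        omega
      · intro s' hS hv
        refine (pickTest_spec (hs.same hS) (by rw [hS.1]; exact hloc)
          (by rw [hS.2 23 (by omega), h23]) hr).imp ?_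
        rintro s'' ⟨hS', h30, h31, h32, h35⟩
        exact ⟨hS.trans hS', h30, h31, h32, h35⟩
    rintro s1 ⟨hS, h30⟩
    have h4 : s1.reg 4 = m := (hs.same hS).2.2.1
    have h23' : s1.reg 23 = r := by rw [hS.2 23 (by omega), h23]
    have hoff : s1.mem (m + slotTable O n k m r) = offset O n k m (slotTable O n k m r) := by
      rw [hS.1]; exact (hloc _ hlt).2
    apply Ht.add_seq
    apply Ht.load_seq
    apply Ht.add_seq
    apply Ht.read_seq
    apply Ht.const_seq
    apply Ht.near
    refine ⟨(((((hS.set _ (by omega)).set _ (by omega)).set _ (by omega)).set _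
      (by omega)).set _ (by omega)).set _ (by omega), ?_, ?_, ?_, ?_⟩
    · simp [State.set_reg, h30]
    · simp [State.set_reg, State.set_mem, h30, h4, h23', hoff, slotPoint]
    · simp [State.set_reg]
    · simp [State.set_reg, State.set_mem, h30, h4, h23', hoff, slotPoint]
      congr
  · omega

/-- Searches the slots for a near point; sets `R[28]` if there is one. -/
def scanProg : Prog :=
  .const 23 0 ;; .const 28 0 ;;
  .loop 23 24 (pickProg ;; .ite 6 36 (.const 28 1 ;; .add 23 24 6) (.add 23 23 5))

open Classical in
/-- The number of slots with a point that is not near. -/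
noncomputable def farSlots (O : Oracle) (n k m : ℕ) (D : ℕ → ℕ) : ℕ :=
  ((Finset.range (cum O n k m m)).filter fun r => ¬ O.near (slotPoint O n k m D r)).card

/-- The search stops at the first near point, so that it visits at most `farSlots + 1` slots. -/
lemma scanProg_spec {n k m : ℕ} (hD : IsDS O n k m data) {s : State} (hs : QRegs n k m s)
    (hloc : Located O n k m m s.mem) (h24 : s.reg 24 = cum O n k m m) :
    Ht O data B scanProg s
      ((farSlots O n k m data + 1) * (24 * (n + m).size + 28) + 5) fun s' =>
      QRegs n k m s' ∧ Located O n k m m s'.mem ∧ s'.reg 24 = cum O n k m m ∧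
      ((s'.reg 28 = 1 ∧ ∃ r < cum O n k m m, O.near (slotPoint O n k m data r)) ∨
       (s'.reg 28 = 0 ∧ ∀ r < cum O n k m m, ¬ O.near (slotPoint O n k m data r))) := by
  classical
  -- the first `N` slots have no near point
  obtain ⟨N, hN, hfar, hnear⟩ : ∃ N ≤ cum O n k m m,
      (∀ r < N, ¬ O.near (slotPoint O n k m data r)) ∧
      (N < cum O n k m m → O.near (slotPoint O n k m data N)) := by
    by_cases h : ∃ r < cum O n k m m, O.near (slotPoint O n k m data r)
    · refine ⟨Nat.find h, (Nat.find_spec h).1.le, fun r hr hn => ?_, fun _ => (Nat.find_spec h).2⟩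
      exact Nat.find_min h hr ⟨hr.trans (Nat.find_spec h).1, hn⟩
    · push Not at h
      exact ⟨_, le_rfl, h, fun h => absurd h (lt_irrefl _)⟩
  have hNfar : N ≤ farSlots O n k m data := by
    rw [← Finset.card_range N]
    refine Finset.card_le_card fun r hr => ?_
    simp only [Finset.mem_range, Finset.mem_filter] at hr ⊢
    exact ⟨by omega, hfar r hr⟩
  set W := cum O n k m m with hW
  have hbody : ∀ r < W, ∀ s, QRegs n k m s → Located O n k m m s.mem → s.reg 24 = W →
      s.reg 23 = r → s.reg 28 = 0 → Ht O data B
        (pickProg ;; .ite 6 36 (.const 28 1 ;; .add 23 24 6) (.add 23 23 5)) s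
        (24 * (n + m).size + 27) fun s' => QRegs n k m s' ∧ Located O n k m m s'.mem ∧
          s'.reg 24 = W ∧ s'.reg 23 = (if O.near (slotPoint O n k m data r) then W else r + 1) ∧
          s'.reg 28 = if O.near (slotPoint O n k m data r) then 1 else 0 := by
    intro r hr s hs hloc h24 h23 h28
    apply Ht.weaken
    · apply Ht.seq (pickProg_spec hD hs hloc h23 hr)
      rintro s1 ⟨hS, h30, h11, h12, h36⟩
      have hq := hs.same hS
      have hl : Located O n k m m s1.mem := by rw [hS.1]; exact hloc
      have k24 : s1.reg 24 = W := by rw [hS.2 24 (by omega), h24]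
      have k23 : s1.reg 23 = r := by rw [hS.2 23 (by omega), h23]
      have k28 : s1.reg 28 = 0 := by rw [hS.2 28 (by omega), h28]
      apply Ht.ite
      · intro h
        rw [hq.2.2.2.2.1, h36] at h
        split_ifs at h with hn
        · apply Ht.const_seq
          apply Ht.add
          refine ⟨by simpa [QRegs, State.set_reg] using hq, hl, by simp [State.set_reg, k24], ?_, ?_⟩
          · simp [State.set_reg, k24, hq.2.2.2.2.1, hn]
          · simp [State.set_reg, hn]
        · omega
      · intro h
        rw [hq.2.2.2.2.1, h36] at h
        split_ifs at h with hn
        · omega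
        · apply Ht.add
          refine ⟨by simpa [QRegs, State.set_reg] using hq, hl, by simp [State.set_reg, k24], ?_, ?_⟩
          · simp [State.set_reg, k23, hq.2.2.2.1, hn]
          · simp [State.set_reg, hn, k28]
    · omega
  have hmul : ∀ N', N' ≤ N + 1 → N' * (24 * (n + m).size + 27 + 1) + 1 ≤
      (farSlots O n k m data + 1) * (24 * (n + m).size + 28) + 1 := by
    intro N' hN'
    gcongr
    omega
  apply Ht.weaken
  · apply Ht.const_seq
    apply Ht.const_seq
    refine Ht.weaken (τ := (farSlots O n k m data + 1) * (24 * (n + m).size + 28) + 1) ?_ le_rfl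
    have hinit : ∀ v w, QRegs n k m ((s.set 23 v).set 28 w) := fun v w => by
      simpa [QRegs, State.set_reg] using hs
    by_cases hlt : N < W
    · refine ((Ht.for (fun i s' => QRegs n k m s' ∧ Located O n k m m s'.mem ∧ s'.reg 24 = W ∧
        s'.reg 23 = (if i ≤ N then i else W) ∧ s'.reg 28 = if i ≤ N then 0 else 1) (N + 1)
        (24 * (n + m).size + 27) ?_ ?_ ?_).imp ?_).weaken (hmul (N + 1) le_rfl)
      · rintro i hi s1 ⟨hq, hl, k24, k23, k28⟩
        rw [if_pos (by omega)] at k23 k28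
        refine ⟨by omega, (hbody i (by omega) s1 hq hl k24 k23 k28).imp ?_⟩
        rintro s2 ⟨hq2, hl2, l24, l23, l28⟩
        refine ⟨hq2, hl2, l24, ?_, ?_⟩
        · rw [l23]
          by_cases hiN : i = N
          · subst hiN; simp [hnear hlt]
          · rw [if_neg (hfar i (by omega)), if_pos (by omega)]
        · rw [l28]
          by_cases hiN : i = N
          · subst hiN; simp [hnear hlt]
          · rw [if_neg (hfar i (by omega)), if_pos (by omega)]
      · rintro s1 ⟨-, -, k24, k23, -⟩
        rw [if_neg (by omega)] at k23
        omega
      · exact ⟨hinit 0 0, hloc, by simpa [State.set_reg] using h24, by simp [State.set_reg],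
          by simp [State.set_reg]⟩
      · rintro s1 ⟨hq, hl, k24, -, k28⟩
        rw [if_neg (by omega)] at k28
        exact ⟨hq, hl, k24, Or.inl ⟨k28, N, hlt, hnear hlt⟩⟩
    · obtain rfl : N = W := by omega
      refine ((Ht.for (fun i s' => QRegs n k m s' ∧ Located O n k m m s'.mem ∧ s'.reg 24 = W ∧
        s'.reg 23 = i ∧ s'.reg 28 = 0) W
        (24 * (n + m).size + 27) ?_ ?_ ?_).imp ?_).weaken (hmul W (by omega))
      · rintro i hi s1 ⟨hq, hl, k24, k23, k28⟩
        refine ⟨by omega, (hbody i (by omega) s1 hq hl k24 k23 k28).imp ?_⟩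
        rintro s2 ⟨hq2, hl2, l24, l23, l28⟩
        rw [if_neg (hfar i hi)] at l23 l28
        exact ⟨hq2, hl2, l24, l23, l28⟩
      · rintro s1 ⟨-, -, k24, k23, -⟩
        omega
      · exact ⟨hinit 0 0, hloc, by simpa [State.set_reg] using h24, by simp [State.set_reg],
          by simp [State.set_reg]⟩
      · rintro s1 ⟨hq, hl, k24, -, k28⟩
        exact ⟨hq, hl, k24, Or.inr ⟨k28, hfar⟩⟩
  · omega

/-! ### Rejection sampling -/

/-- For the point `R[11]`, draws tables until the point is in the bucket of the query in the table
drawn, and accepts (sets `R[29]`) if this is table `R[30]`. -/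
def acceptProg : Prog :=
  .const 37 0 ;;
  .loop 37 5 (
    .rand 10 4 ;; cmpProg ;; .ite 13 5 .skip (.ite 5 13 .skip (.const 37 1))) ;;
  .ite 10 30 .skip (.ite 30 10 .skip (.const 29 1))

/-- Draws slots until the point in the slot is near and accepted. -/
def sampleProg : Prog :=
  .const 29 0 ;;
  .loop 29 5 (.rand 23 24 ;; pickProg ;; .ite 6 36 acceptProg .skip) ;;
  .add 0 11 6

/-- The query program. -/
def queryProg : Prog :=
  loadProg ;; tablesProg ;; scanProg ;; .ite 6 28 sampleProg (.const 0 0)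

/-- The states in which the sampling loop is left or repeated. -/
def SampleState (O : Oracle) (n k m : ℕ) (s : State) : Prop :=
  QRegs n k m s ∧ Located O n k m m s.mem ∧ s.reg 24 = cum O n k m m

lemma SampleState.same {n k m : ℕ} {s s' : State} (h : SampleState O n k m s) (hs : Same s s') :
    SampleState O n k m s' :=
  ⟨h.1.same hs, by rw [hs.1]; exact h.2.1, by rw [hs.2 24 (by omega)]; exact h.2.2⟩

/-- The states during the acceptance test for the point `x` of a slot of table `i`. -/
def AcceptState (O : Oracle) (n k m i x : ℕ) (s : State) : Prop :=
  SampleState O n k m s ∧ s.reg 29 = 0 ∧ s.reg 30 = i ∧ s.reg 11 = x ∧ s.reg 12 = 0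

lemma AcceptState.set {n k m i x : ℕ} {s : State} (h : AcceptState O n k m i x s) {d : ℕ} (v : ℕ)
    (hd : d = 10 ∨ d = 37) : AcceptState O n k m i x (s.set d v) := by
  unfold AcceptState SampleState QRegs at *
  rcases hd with rfl | rfl <;> simpa [State.set_reg, State.set_mem] using h

/-- The loop that draws tables, when drawing table `j` from the tables that contain the point
continues with an expected cost of at most `F j`. -/
lemma drawTable_le {n k m i x : ℕ} (hm : 0 < m) {c y : ℝ≥0} {F : ℕ → ℝ≥0}
    (hy : (15 * k + 20) * c +
      (∑ j ∈ Finset.range m, if keyCmp O m j x 0 k = 1 then F j else y) / m ≤ y)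
    {f : State → ℝ≥0∞}
    (hf : ∀ s, AcceptState O n k m i x s → f s ≤ F (s.reg 10)) {s : State}
    (hs : AcceptState O n k m i x s) (h37 : s.reg 37 = 0) :
    wp O data c B (.loop 37 5 (
      .rand 10 4 ;; cmpProg ;; .ite 13 5 .skip (.ite 5 13 .skip (.const 37 1)))) f s ≤ y := by
  classical
  refine (wp_loop_le (fun s => if AcceptState O n k m i x s ∧ s.reg 37 = 0 then (y : ℝ≥0∞)
    else if AcceptState O n k m i x s ∧ s.reg 37 = 1 then c + F (s.reg 10) else ⊤) ?_ s).trans ?_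
  · intro s
    by_cases h0 : AcceptState O n k m i x s ∧ s.reg 37 = 0
    · rw [if_pos h0]
      obtain ⟨hA, h37⟩ := h0
      have hq := hA.1.1
      rw [if_pos (by rw [h37, hq.2.2.2.1]; omega)]
      simp only [wp]
      rw [hq.2.2.1, avg_uniformBelow hm]
      have hbody : ∀ j, wp O data c B (cmpProg ;; .ite 13 5 .skip (.ite 5 13 .skip (.const 37 1)))
          (fun s => if AcceptState O n k m i x s ∧ s.reg 37 = 0 then (y : ℝ≥0∞)
            else if AcceptState O n k m i x s ∧ s.reg 37 = 1 then c + F (s.reg 10) else ⊤)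
          (s.set 10 j) ≤ (15 * k + 16 : ℕ) * c +
            (c + ((if keyCmp O m j x 0 k = 1 then F j else y : ℝ≥0) : ℝ≥0∞)) := by
        intro j
        have hA1 := hA.set j (d := 10) (by omega)
        have hq1 := hA1.1.1
        have h37' : (s.set 10 j).reg 37 = 0 := by simpa [State.set_reg] using h37
        have h10' : (s.set 10 j).reg 10 = j := by simp [State.set_reg]
        generalize s.set 10 j = s1 at *
        have hHt : Ht O data B (cmpProg ;; .ite 13 5 .skip (.ite 5 13 .skip (.const 37 1))) s1
            (15 * k + 16) fun s' => AcceptState O n k m i x s' ∧ s'.reg 10 = j ∧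
              s'.reg 37 = if keyCmp O m j x 0 k = 1 then 1 else 0 := by
          apply Ht.weaken
          · apply Ht.seq (cmpProg_spec ⟨hq1.2.2.2.1, hq1.2.2.2.2.1⟩)
            rintro s2 ⟨hm2, hf2, h13⟩
            rw [hq1.2.2.1, h10', hA1.2.2.2.1, hA1.2.2.2.2, hq1.2.1] at h13
            have hA2 : AcceptState O n k m i x s2 := by
              unfold AcceptState
              rw [hf2 29 (by omega), hf2 30 (by omega), hf2 11 (by omega), hf2 12 (by omega)]
              exact ⟨hA1.1.same ⟨hm2, fun r hr => hf2 r (by omega)⟩, hA1.2⟩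
            have k5 := hA2.1.1.2.2.2.1
            have k10 : s2.reg 10 = j := by rw [hf2 10 (by omega), h10']
            have k37 : s2.reg 37 = 0 := by rw [hf2 37 (by omega), h37']
            have hno : keyCmp O m j x 0 k ≠ 1 → Ht O data B .skip s2 1 fun s' =>
                AcceptState O n k m i x s' ∧ s'.reg 10 = j ∧
                s'.reg 37 = if keyCmp O m j x 0 k = 1 then 1 else 0 := fun h =>
              Ht.skip ⟨hA2, k10, by rw [if_neg h, k37]⟩
            apply Ht.ite
            · intro h
              exact hno (by omega)
            · intro h
              apply Ht.ite
              · intro h'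
                exact hno (by omega)
              · intro h'
                apply Ht.const
                refine ⟨hA2.set 1 (by omega), by simp [State.set_reg, k10], ?_⟩
                rw [if_pos (by omega)]
                simp [State.set_reg]
          · rw [hq1.2.1]; omega
        refine hHt.wp_le ?_
        rintro s' ⟨hA', h10, h37⟩
        by_cases h1 : keyCmp O m j x 0 k = 1
        · simp [h1] at h37 ⊢
          simp [hA', h37, h10]
        · simp [h1] at h37 ⊢
          simp [hA', h37]
      calc (c : ℝ≥0∞) + (c + (c + (∑ j ∈ Finset.range m, _) / (m : ℝ≥0∞)))
          ≤ c + (c + (c + (∑ j ∈ Finset.range m, ((15 * k + 16 : ℕ) * c +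
            (c + ((if keyCmp O m j x 0 k = 1 then F j else y : ℝ≥0) : ℝ≥0∞)))) / m)) := by
            exact add_le_add_right (add_le_add_right (add_le_add_right
              (ENNReal.div_le_div_right (Finset.sum_le_sum fun j _ => hbody j) _) _) _) _
        _ = (((15 * k + 20) * c +
              (∑ j ∈ Finset.range m, if keyCmp O m j x 0 k = 1 then F j else y) / m : ℝ≥0) :
              ℝ≥0∞) := by
            have hm' : (m : ℝ≥0) ≠ 0 := by positivity
            have e : (((15 * k + 20) * c +
              (∑ j ∈ Finset.range m, if keyCmp O m j x 0 k = 1 then F j else y) / m : ℝ≥0)) =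
              c + (c + (c + (∑ j ∈ Finset.range m, ((15 * k + 16 : ℕ) * c +
                (c + (if keyCmp O m j x 0 k = 1 then F j else y)))) / m)) := by
              rw [Finset.sum_add_distrib, Finset.sum_add_distrib, Finset.sum_const,
                Finset.sum_const, Finset.card_range]
              simp only [nsmul_eq_mul]
              field_simp
              push_cast
              ring
            rw [e, ENNReal.coe_add, ENNReal.coe_add, ENNReal.coe_add, ENNReal.coe_div hm']
            push_cast
            rfl
        _ ≤ y := by exact_mod_cast hy
    · rw [if_neg h0]
      by_cases h1 : AcceptState O n k m i x s ∧ s.reg 37 = 1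
      · rw [if_pos h1, if_neg (by rw [h1.2, h1.1.1.1.2.2.2.1]; omega)]
        gcongr
        exact hf s h1.1
      · rw [if_neg h1]; exact le_top
  · rw [if_pos ⟨hs, h37⟩]

/-- The acceptance test for the point `x` of a slot of table `i`, when the expected cost after
acceptance and rejection is at most `a` and `U`. -/
lemma acceptProg_le {n k m i x : ℕ} (hm : 0 < m) {c y a U : ℝ≥0}
    (hy : (15 * k + 20) * c + (∑ j ∈ Finset.range m, if keyCmp O m j x 0 k = 1 then
      (if j = i then 6 * c + a else 6 * c + U) else y) / m ≤ y)
    {f : State → ℝ≥0∞}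
    (hacc : ∀ s, SampleState O n k m s → s.reg 29 = 1 → s.reg 11 = x → f s ≤ a)
    (hrej : ∀ s, SampleState O n k m s → s.reg 29 = 0 → f s ≤ U) {s : State}
    (hs : AcceptState O n k m i x s) :
    wp O data c B acceptProg f s ≤ 3 * c + y := by
  have h : wp O data c B (.loop 37 5 (
      .rand 10 4 ;; cmpProg ;; .ite 13 5 .skip (.ite 5 13 .skip (.const 37 1))))
      (wp O data c B (.ite 10 30 .skip (.ite 30 10 .skip (.const 29 1))) f) (s.set 37 0) ≤ y := by
    refine drawTable_le hm hy ?_ (hs.set 0 (by omega)) (by simp [State.set_reg])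
    intro s' hA
    have hHt : Ht O data B (.ite 10 30 .skip (.ite 30 10 .skip (.const 29 1))) s' 5 fun s'' =>
        s'' = if s'.reg 10 = i then s'.set 29 1 else s' := by
      have e := hA.2.2.1
      apply Ht.weaken
      · apply Ht.ite
        · intro h
          apply Ht.skip
          rw [if_neg (by omega)]
        · intro h
          apply Ht.ite
          · intro h'
            apply Ht.skip
            rw [if_neg (by omega)]
          · intro h'
            apply Ht.const
            rw [if_pos (by omega)]
      · norm_num
    refine (hHt.wp_le (b := ((if s'.reg 10 = i then a else U : ℝ≥0) : ℝ≥0∞)) ?_).trans ?_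
    · rintro _ rfl
      split_ifs with h
      · refine hacc _ ?_ (by simp [State.set_reg]) (by simp [State.set_reg, hA.2.2.2.1])
        have := hA.1
        unfold SampleState QRegs at *
        simpa [State.set_reg, State.set_mem] using this
      · exact hrej s' hA.1 hA.2.1
    · split_ifs <;> push_cast <;> gcongr <;> norm_num
  simp only [acceptProg]
  rw [wp, wp, wp]
  calc (c : ℝ≥0∞) + (c + (c + _)) ≤ c + (c + (c + y)) := by gcongr
    _ = _ := by ring

/-- The points that a query may report: the near points in the buckets of the query. -/
def IsFound (O : Oracle) (n k m x : ℕ) : Prop :=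
  x ∈ Finset.Icc 1 n ∧ O.near x ∧ ∃ i < m, x ∈ bucket O n k m i

open Classical in
/-- The set of the points that a query may report. -/
noncomputable def found (O : Oracle) (n k m : ℕ) : Finset ℕ :=
  (Finset.Icc 1 n).filter (IsFound O n k m)

/-- The sampling loop, if `U` bounds the expected cost of one round followed by the rest of the
loop. -/
lemma sampleLoop_le {n k m : ℕ} (hm : 0 < m) (hD : IsDS O n k m data) {c U : ℝ≥0}
    {y g : ℕ → ℝ≥0} (hW : 0 < cum O n k m m)
    (hy : ∀ i < m, ∀ x ∈ bucket O n k m i, O.near x →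
      (15 * k + 20) * c + (∑ j ∈ Finset.range m, if keyCmp O m j x 0 k = 1 then
        (if j = i then 6 * c + (c + g x) else 6 * c + U) else y x) / m ≤ y x)
    (hU : (24 * (n + m).size + 40) * c + (∑ r ∈ Finset.range (cum O n k m m),
      (open Classical in if O.near (slotPoint O n k m data r) then y (slotPoint O n k m data r)
        else U)) / (cum O n k m m) ≤ U)
    {f : State → ℝ≥0∞} (hf : ∀ s, SampleState O n k m s → f s ≤ g (s.reg 11))
    {s : State} (hs : SampleState O n k m s) (h29 : s.reg 29 = 0) :
    wp O data c B (.loop 29 5 (.rand 23 24 ;; pickProg ;; .ite 6 36 acceptProg .skip)) f s ≤ U := by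
  classical
  set W := cum O n k m m with hWdef
  refine (wp_loop_le (fun s => if SampleState O n k m s ∧ s.reg 29 = 0 then (U : ℝ≥0∞)
    else if SampleState O n k m s ∧ s.reg 29 = 1 then ((c + g (s.reg 11) : ℝ≥0) : ℝ≥0∞)
    else ⊤) ?_ s).trans ?_
  · intro s
    by_cases h0 : SampleState O n k m s ∧ s.reg 29 = 0
    · rw [if_pos h0]
      obtain ⟨hS, h29⟩ := h0
      have hq := hS.1
      rw [if_pos (by rw [h29, hq.2.2.2.1]; omega)]
      rw [wp, wp, hS.2.2, ← hWdef, avg_uniformBelow hW]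
      set I : State → ℝ≥0∞ := fun s => if SampleState O n k m s ∧ s.reg 29 = 0 then (U : ℝ≥0∞)
        else if SampleState O n k m s ∧ s.reg 29 = 1 then ((c + g (s.reg 11) : ℝ≥0) : ℝ≥0∞)
        else ⊤ with hI
      have hbody : ∀ r ∈ Finset.range W,
          wp O data c B (pickProg ;; .ite 6 36 acceptProg .skip) I (s.set 23 r) ≤
          (24 * (n + m).size + 20 : ℕ) * c + (5 * c +
            ((if O.near (slotPoint O n k m data r) then y (slotPoint O n k m data r)
              else U : ℝ≥0) : ℝ≥0∞)) := by
        intro r hr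
        rw [Finset.mem_range] at hr
        have hS1 : SampleState O n k m (s.set 23 r) := by
          unfold SampleState QRegs at *
          simpa [State.set_reg, State.set_mem] using hS
        have h29' : (s.set 23 r).reg 29 = 0 := by simpa [State.set_reg] using h29
        have h23' : (s.set 23 r).reg 23 = r := by simp [State.set_reg]
        generalize s.set 23 r = s1 at *
        rw [wp]
        have hp := pickProg_spec (B := B) hD hS1.1 hS1.2.1 h23' hr
        refine (add_le_add_right (hp.wp_le (c := (c : ℝ≥0∞)) (b := 4 * c +
            ((if O.near (slotPoint O n k m data r) then y (slotPoint O n k m data r)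
              else U : ℝ≥0) : ℝ≥0∞)) ?_) _).trans ?_
        · rintro s2 ⟨hsame, h30, h11, h12, h36⟩
          have hS2 := hS1.same hsame
          have k29 : s2.reg 29 = 0 := by rw [hsame.2 29 (by omega), h29']
          have k6 := hS2.1.2.2.2.2.1
          rw [wp, k6, h36]
          by_cases hn : O.near (slotPoint O n k m data r)
          · simp only [hn, if_true]
            rw [if_pos (by omega)]
            have hxi : slotPoint O n k m data r ∈ bucket O n k m (slotTable O n k m r) := by
              -- otherwise the sum over all slots would contain a term that the sum over the
              -- buckets does not have
              by_contra hx
              have hsum := sum_slots hD (fun i x => if x ∈ bucket O n k m i then 0 else 1)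
              have hz : ∑ i ∈ Finset.range m, ∑ x ∈ bucket O n k m i,
                  (if x ∈ bucket O n k m i then 0 else 1) = 0 :=
                Finset.sum_eq_zero fun i _ => Finset.sum_eq_zero fun x hx => if_pos hx
              rw [hz, Finset.sum_eq_zero_iff] at hsum
              have := hsum r (by simpa using hr)
              simp [hx] at this
            have := acceptProg_le (data := data) (B := B) hm (hy _ (slotTable_lt hr) _ hxi hn)
              (f := I) ?_ ?_ (s := s2) ⟨hS2, k29, h30, h11, h12⟩
            · calc (c : ℝ≥0∞) + _ ≤ c + (3 * c + y (slotPoint O n k m data r)) := by gcongr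
                _ = _ := by ring
            · intro s' hs' h29 h11
              simp [hI, hs', h29, h11]
            · intro s' hs' h29
              simp [hI, hs', h29]
          · simp only [hn, if_false]
            rw [if_neg (by omega), wp]
            simp only [hI, hS2, k29]
            simp only [true_and, if_true]
            calc (c : ℝ≥0∞) + (c + U) = 2 * c + U := by ring
              _ ≤ 4 * c + U := by gcongr; norm_num
        · apply le_of_eq; ring
      calc (c : ℝ≥0∞) + (c + (c + (∑ r ∈ Finset.range W, _) / (W : ℝ≥0∞)))
          ≤ c + (c + (c + (∑ r ∈ Finset.range W, ((24 * (n + m).size + 20 : ℕ) * c + (5 * c +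
            ((if O.near (slotPoint O n k m data r) then y (slotPoint O n k m data r)
              else U : ℝ≥0) : ℝ≥0∞)))) / W)) := by
            gcongr with r hr
            exact hbody r hr
        _ = (((24 * (n + m).size + 28) * c + (∑ r ∈ Finset.range W,
            (if O.near (slotPoint O n k m data r) then y (slotPoint O n k m data r)
              else U)) / W : ℝ≥0) : ℝ≥0∞) := by
            have hW' : (W : ℝ≥0) ≠ 0 := by positivity
            have e : (((24 * (n + m).size + 28) * c + (∑ r ∈ Finset.range W,
                (if O.near (slotPoint O n k m data r) then y (slotPoint O n k m data r)
                  else U)) / W : ℝ≥0)) =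
              c + (c + (c + (∑ r ∈ Finset.range W, ((24 * (n + m).size + 20 : ℕ) * c + (5 * c +
              (if O.near (slotPoint O n k m data r) then y (slotPoint O n k m data r)
                else U)))) / W)) := by
              rw [Finset.sum_add_distrib, Finset.sum_add_distrib, Finset.sum_const,
                Finset.sum_const, Finset.card_range]
              simp only [nsmul_eq_mul]
              field_simp
              push_cast
              ring
            rw [e, ENNReal.coe_add, ENNReal.coe_add, ENNReal.coe_add, ENNReal.coe_div hW']
            push_cast
            rfl
        _ ≤ U := by
            refine le_trans ?_ (ENNReal.coe_le_coe.2 hU)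
            rw [ENNReal.coe_le_coe]
            gcongr
            norm_num
    · rw [if_neg h0]
      by_cases h1 : SampleState O n k m s ∧ s.reg 29 = 1
      · rw [if_pos h1, if_neg (by rw [h1.2, h1.1.1.2.2.2.1]; omega), ENNReal.coe_add]
        gcongr
        exact hf s h1.1
      · rw [if_neg h1]; exact le_top
  · rw [if_pos ⟨hs, h29⟩]

/-! ### The expected cost of a query -/

/-- The number of buckets that contain a point. -/
def deg (O : Oracle) (k m x : ℕ) : ℕ :=
  ((Finset.range m).filter fun j => keyCmp O m j x 0 k = 1).card

lemma deg_le (k m x : ℕ) : deg O k m x ≤ m := by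
  exact (Finset.card_filter_le _ _).trans (by simp)

lemma mem_bucket {n k m i x : ℕ} :
    x ∈ bucket O n k m i ↔ x ∈ Finset.Icc 1 n ∧ keyCmp O m i x 0 k = 1 := by
  rw [bucket, Finset.mem_filter]

lemma mem_found {n k m x : ℕ} :
    x ∈ found O n k m ↔ x ∈ Finset.Icc 1 n ∧ O.near x ∧ 0 < deg O k m x := by
  simp only [found, Finset.mem_filter, IsFound, deg, Finset.card_pos]
  constructor
  · rintro ⟨h, -, hn, i, hi, hb⟩
    exact ⟨h, hn, i, by simp [hi, (mem_bucket.1 hb).2]⟩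
  · rintro ⟨h, hn, i, hi⟩
    simp only [Finset.mem_filter, Finset.mem_range] at hi
    exact ⟨h, h, hn, i, hi.1, mem_bucket.2 ⟨h, hi.2⟩⟩

lemma sum_bucket {n k m : ℕ} (h : ℕ → ℝ≥0) :
    ∑ i ∈ Finset.range m, ∑ x ∈ bucket O n k m i, h x =
      ∑ x ∈ Finset.Icc 1 n, deg O k m x * h x := by
  simp only [bucket, Finset.sum_filter]
  rw [Finset.sum_comm]
  refine Finset.sum_congr rfl fun x _ => ?_
  rw [← Finset.sum_filter, Finset.sum_const, nsmul_eq_mul, deg]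

lemma cum_eq_sum {n k m : ℕ} {D : ℕ → ℕ} (hD : IsDS O n k m D) :
    (cum O n k m m : ℝ≥0) = ∑ x ∈ Finset.Icc 1 n, (deg O k m x : ℝ≥0) := by
  have h1 := sum_slots hD (fun _ _ => (1 : ℝ≥0))
  have h2 := sum_bucket (O := O) (n := n) (k := k) (m := m) (fun _ => 1)
  rw [h2] at h1
  simpa using h1

open Classical in
lemma farSlots_eq_sum {n k m : ℕ} {D : ℕ → ℕ} (hD : IsDS O n k m D) :
    (farSlots O n k m D : ℝ≥0) =
      ∑ x ∈ Finset.Icc 1 n, (deg O k m x : ℝ≥0) * if O.near x then 0 else 1 := by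
  rw [← sum_bucket, ← sum_slots hD (fun _ x => if O.near x then (0 : ℝ≥0) else 1), farSlots,
    Finset.card_filter]
  push_cast
  refine Finset.sum_congr rfl fun r _ => ?_
  split_ifs <;> simp_all

/-- A near point is in at most `m` buckets, and all other slots hold far points. -/
lemma cum_le_found {n k m : ℕ} {D : ℕ → ℕ} (hD : IsDS O n k m D) :
    (cum O n k m m : ℝ≥0) ≤ (found O n k m).card * m + farSlots O n k m D := by
  classical
  rw [cum_eq_sum hD, farSlots_eq_sum hD]
  have hS : ((found O n k m).card : ℝ≥0) * m =
      ∑ x ∈ Finset.Icc 1 n, if x ∈ found O n k m then (m : ℝ≥0) else 0 := by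
    rw [← Finset.sum_filter, Finset.sum_const, nsmul_eq_mul]
    congr 3
    ext x
    simp only [Finset.mem_filter, mem_found]
    tauto
  rw [hS, ← Finset.sum_add_distrib]
  refine Finset.sum_le_sum fun x hx => ?_
  by_cases hn : O.near x
  · rcases Nat.eq_zero_or_pos (deg O k m x) with h0 | h0
    · simp [h0]
    · have : x ∈ found O n k m := mem_found.2 ⟨hx, hn, h0⟩
      simp only [this, if_true, hn, mul_zero, add_zero]
      exact_mod_cast deg_le k m x
  · simp [hn]

/-- The expected cost of the acceptance test for `x` and the rest of the sampling loop. -/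
noncomputable def acceptCost (O : Oracle) (k m : ℕ) (c U : ℝ≥0) (g : ℕ → ℝ≥0) (x : ℕ) : ℝ≥0 :=
  ((15 * k + 20) * m * c + (6 * c + (c + g x)) + (deg O k m x - 1 : ℕ) * (6 * c + U)) / deg O k m x

/-- `acceptCost` satisfies the recursion of the loop that draws tables: the draw succeeds in `deg x` of
the `m` tables, one of which is table `i`, and starts over in the others. -/
lemma acceptCost_spec {n k m i x : ℕ} (hi : i < m) (hx : x ∈ bucket O n k m i) (c U : ℝ≥0)
    (g : ℕ → ℝ≥0) :
    (15 * k + 20) * c + (∑ j ∈ Finset.range m, if keyCmp O m j x 0 k = 1 then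
        (if j = i then 6 * c + (c + g x) else 6 * c + U) else acceptCost O k m c U g x) / m ≤
      acceptCost O k m c U g x := by
  set y := acceptCost O k m c U g x with hy
  set T := (Finset.range m).filter fun j => keyCmp O m j x 0 k = 1 with hT
  have hiT : i ∈ T := by simp [hT, hi, (mem_bucket.1 hx).2]
  have hd : deg O k m x = T.card := rfl
  have hdpos : 0 < deg O k m x := Finset.card_pos.2 ⟨i, hiT⟩
  have hsum : (∑ j ∈ Finset.range m, if keyCmp O m j x 0 k = 1 then
      (if j = i then 6 * c + (c + g x) else 6 * c + U) else y) =
      (6 * c + (c + g x)) + (deg O k m x - 1 : ℕ) * (6 * c + U) + (m - deg O k m x : ℕ) * y := by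
    rw [Finset.sum_ite, Finset.sum_const, ← Finset.add_sum_erase T _ hiT, if_pos rfl,
      Finset.sum_congr rfl (g := fun _ => 6 * c + U)
        (fun j hj => if_neg (Finset.ne_of_mem_erase hj)),
      Finset.sum_const, Finset.card_erase_of_mem hiT, nsmul_eq_mul, nsmul_eq_mul, ← hd]
    congr 3
    rw [Finset.filter_not, Finset.card_sdiff_of_subset (Finset.filter_subset _ _),
      Finset.card_range, ← hT, hd]
  have hmul : deg O k m x * y = (15 * k + 20) * m * c + (6 * c + (c + g x)) +
      (deg O k m x - 1 : ℕ) * (6 * c + U) := by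
    rw [hy, acceptCost]
    exact mul_div_cancel₀ _ (by positivity)
  have hm : (m : ℝ≥0) ≠ 0 := by
    have : 0 < m := by omega
    positivity
  have hmd : (m : ℝ≥0) = deg O k m x + (m - deg O k m x : ℕ) := by
    have := deg_le (O := O) k m x
    exact_mod_cast (Nat.add_sub_of_le this).symm
  rw [hsum]
  refine le_of_eq ((mul_right_inj' hm).1 ?_)
  rw [mul_add, mul_div_cancel₀ _ hm]
  conv_rhs => rw [hmd, add_mul, hmul]
  ring

/-- A bound on the expected cost of one round of the sampling loop and the rounds after it. -/
noncomputable def roundCost (O : Oracle) (n k m : ℕ) (D : ℕ → ℕ) (c : ℝ≥0) (g : ℕ → ℝ≥0) : ℝ≥0 :=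
  ((24 * (n + m).size + 46) * (m + farSlots O n k m D) + (15 * k + 20) * m + 1) * c +
    (∑ x ∈ found O n k m, g x) / (found O n k m).card

/-- A found point `x` is drawn with `deg x` slots and accepted with probability `1 / deg x`, so it
weighs `1` in the total over the slots, and the acceptance tests for it cost `O(k m)` in total. -/
lemma roundCost_spec {n k m : ℕ} {D : ℕ → ℕ} (hD : IsDS O n k m D)
    (hS : (found O n k m).Nonempty) (c : ℝ≥0) (g : ℕ → ℝ≥0) (hW : 0 < cum O n k m m) :
    (24 * (n + m).size + 40) * c + (∑ r ∈ Finset.range (cum O n k m m),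
      (open Classical in if O.near (slotPoint O n k m D r) then
        acceptCost O k m c (roundCost O n k m D c g) g (slotPoint O n k m D r)
        else roundCost O n k m D c g)) / (cum O n k m m) ≤ roundCost O n k m D c g := by
  classical
  set U := roundCost O n k m D c g with hU
  have hcard : 0 < (found O n k m).card := Finset.card_pos.2 hS
  have hSU : (found O n k m).card * U = (found O n k m).card *
      (((24 * (n + m).size + 46) * (m + farSlots O n k m D) + (15 * k + 20) * m + 1) * c) +
      ∑ x ∈ found O n k m, g x := by
    rw [hU, roundCost, mul_add, mul_div_cancel₀ _ (by positivity)]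
  rw [sum_slots hD (fun _ x => if O.near x then acceptCost O k m c U g x else U), sum_bucket]
  have hterm : ∀ x ∈ Finset.Icc 1 n,
      deg O k m x * (if O.near x then acceptCost O k m c U g x else U) +
        (if x ∈ found O n k m then U else 0) ≤
      deg O k m x * (6 * c + U) +
        if x ∈ found O n k m then (15 * k + 20) * m * c + c + g x else 0 := by
    intro x hx
    by_cases hxS : x ∈ found O n k m
    · obtain ⟨-, hn, hpos⟩ := mem_found.1 hxS
      simp only [hxS, if_true, hn]
      have hmul : deg O k m x * acceptCost O k m c U g x = (15 * k + 20) * m * c +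
          (6 * c + (c + g x)) + (deg O k m x - 1 : ℕ) * (6 * c + U) := by
        rw [acceptCost]
        exact mul_div_cancel₀ _ (by positivity)
      rw [hmul]
      have hd : (deg O k m x : ℝ≥0) = (deg O k m x - 1 : ℕ) + 1 := by
        exact_mod_cast (Nat.sub_add_cancel hpos).symm
      rw [hd]
      apply le_of_eq
      ring
    · simp only [hxS, if_false, add_zero]
      by_cases hn : O.near x
      · have : deg O k m x = 0 := by
          by_contra h0
          exact hxS (mem_found.2 ⟨hx, hn, by omega⟩)
        simp [this]
      · simp only [hn, if_false]
        gcongr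
        exact le_add_self
  have hfilter : (Finset.Icc 1 n).filter (· ∈ found O n k m) = found O n k m := by
    ext x
    simp only [Finset.mem_filter, mem_found]
    tauto
  have htot := Finset.sum_le_sum hterm
  rw [Finset.sum_add_distrib, Finset.sum_add_distrib, ← Finset.sum_filter, ← Finset.sum_filter,
    hfilter, Finset.sum_const, Finset.sum_add_distrib, Finset.sum_const, ← Finset.sum_mul,
    ← cum_eq_sum hD, nsmul_eq_mul, nsmul_eq_mul, hSU] at htot
  have hWle := cum_le_found hD
  have hcard' : (1 : ℝ≥0) ≤ (found O n k m).card := by exact_mod_cast hcard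
  set Z := ∑ x ∈ Finset.Icc 1 n,
    (deg O k m x : ℝ≥0) * (if O.near x then acceptCost O k m c U g x else U)
  have hW' : (0 : ℝ≥0) < cum O n k m m := by exact_mod_cast hW
  have hWle' : (cum O n k m m : ℝ≥0) ≤ (found O n k m).card * (m + farSlots O n k m D) := by
    refine hWle.trans ?_
    rw [mul_add]
    gcongr
    exact le_mul_of_one_le_left zero_le hcard'
  have hmain : (24 * (n + m).size + 40) * c * cum O n k m m + Z ≤ U * cum O n k m m := by
    have h1 : (24 * (n + m).size + 46) * c * cum O n k m m ≤ (24 * (n + m).size + 46) * c *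
      ((found O n k m).card * (m + farSlots O n k m D)) := by gcongr
    rw [← NNReal.coe_le_coe] at htot h1 ⊢
    push_cast at htot h1 ⊢
    nlinarith [htot, h1]
  have hdiv := (div_le_iff₀ hW').2 hmain
  rwa [add_div, mul_div_cancel_right₀ _ hW'.ne'] at hdiv

lemma exists_near_slot {n k m : ℕ} {D : ℕ → ℕ} (hD : IsDS O n k m D) :
    (∃ r < cum O n k m m, O.near (slotPoint O n k m D r)) ↔ (found O n k m).Nonempty := by
  classical
  have h := sum_slots hD (fun _ x => if O.near x then 1 else 0)
  have h' : (∑ r ∈ Finset.range (cum O n k m m),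
      if O.near (slotPoint O n k m D r) then 1 else 0) = 0 ↔
      (∑ i ∈ Finset.range m, ∑ x ∈ bucket O n k m i, if O.near x then 1 else 0) = 0 := by
    rw [h]
  simp only [Finset.sum_eq_zero_iff, Finset.mem_range, ite_eq_right_iff, one_ne_zero,
    imp_false] at h'
  constructor
  · rintro ⟨r, hr, hn⟩
    by_contra hne
    refine h'.2 (fun i hi x hx hnx => hne ⟨x, mem_found.2 ⟨(mem_bucket.1 hx).1, hnx, ?_⟩⟩) r hr hn
    exact Finset.card_pos.2 ⟨i, by simp [hi, (mem_bucket.1 hx).2]⟩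
  · rintro ⟨x, hx⟩
    by_contra hne
    push Not at hne
    obtain ⟨h1, h2, h3⟩ := mem_found.1 hx
    obtain ⟨i, hi⟩ := Finset.card_pos.1 h3
    simp only [Finset.mem_filter, Finset.mem_range] at hi
    exact h'.1 hne i hi.1 x (mem_bucket.2 ⟨h1, hi.2⟩) h2

/-- A bound on the expected number of steps of a query with `far` slots of far points. -/
def queryTime (n k m far : ℕ) : ℕ :=
  m * (2 * ((n + m).size * (15 * k + 41)) + 40) + (far + 1) * (24 * (n + m).size + 28) +
    (24 * (n + m).size + 46) * (m + far) + (15 * k + 20) * m + 50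

/-- The query costs at most `c` per step in expectation, plus the average of `φ` over the points
found, or `φ 0` if there are none. -/
lemma queryProg_le {n k m : ℕ} (hm : 0 < m) (hD : IsDS O n k m data) (hB : spaceBound n k m ≤ B)
    (e : ℕ) (c : ℝ≥0) (φ : ℕ → ℝ≥0) :
    wp O data c B queryProg (fun s => φ (s.reg 0)) ⟨fun i => [e].getD i 0, fun _ => 0⟩ ≤
      ((queryTime n k m (farSlots O n k m data) * c + if (found O n k m).Nonempty then
        (∑ x ∈ found O n k m, φ x) / (found O n k m).card else φ 0 : ℝ≥0) : ℝ≥0∞) := by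
  set R : ℝ≥0 := if (found O n k m).Nonempty then
        (∑ x ∈ found O n k m, φ x) / (found O n k m).card else φ 0 with hR
  set J := (n + m).size with hJ
  set far := farSlots O n k m data with hfar
  set T1 := (24 * J + 46) * (m + far) + (15 * k + 20) * m + 1 with hT1
  have hend : ∀ s, SampleState O n k m s →
      ((s.reg 28 = 1 ∧ ∃ r < cum O n k m m, O.near (slotPoint O n k m data r)) ∨
       (s.reg 28 = 0 ∧ ∀ r < cum O n k m m, ¬ O.near (slotPoint O n k m data r))) →
      wp O data c B (.ite 6 28 sampleProg (.const 0 0)) (fun s => φ (s.reg 0)) s ≤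
        ((T1 + 10 : ℕ) : ℝ≥0∞) * c + R := by
    intro s hs h
    rw [wp, hs.1.2.2.2.2.1]
    rcases h with ⟨h28, hex⟩ | ⟨h28, hnex⟩
    · have hW : 0 < cum O n k m m := by obtain ⟨r, hr, -⟩ := hex; omega
      have hne := (exists_near_slot hD).1 hex
      have hcard : ((found O n k m).card : ℝ≥0) ≠ 0 := by
        have := Finset.card_pos.2 hne
        positivity
      rw [if_pos (by omega), sampleProg, wp, wp, wp]
      have hsl := sampleLoop_le (data := data) (B := B) (c := c)
        (U := roundCost O n k m data c fun x => c + φ x)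
        (y := acceptCost O k m c (roundCost O n k m data c fun x => c + φ x) fun x => c + φ x)
        (g := fun x => c + φ x) hm hD hW
        (fun i hi x hx _ => acceptCost_spec hi hx c _ _) (roundCost_spec hD hne c _ hW)
        (f := wp O data c B (.add 0 11 6) fun s => φ (s.reg 0)) ?_ (s := s.set 29 0) ?_ ?_
      · have hround : roundCost O n k m data c (fun x => c + φ x) = (T1 + 1 : ℕ) * c + R := by
          rw [roundCost, hR, if_pos hne, Finset.sum_add_distrib, Finset.sum_const, nsmul_eq_mul,
            add_div, mul_div_cancel_left₀ _ hcard, hT1]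
          push_cast
          ring
        rw [hround] at hsl
        calc (c : ℝ≥0∞) + (c + (c + (c + _)))
            ≤ c + (c + (c + (c + (((T1 + 1 : ℕ) * c + R : ℝ≥0) : ℝ≥0∞)))) := by gcongr
          _ = ((T1 + 5 : ℕ) : ℝ≥0∞) * c + R := by push_cast; ring
          _ ≤ _ := by gcongr; norm_num
      · intro s' hs'
        rw [wp]
        simp [State.set_reg, hs'.1.2.2.2.2.1]
      · have := hs
        unfold SampleState QRegs at *
        simpa [State.set_reg, State.set_mem] using this
      · simp [State.set_reg]
    · have hne : ¬ (found O n k m).Nonempty := by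
        rw [← exists_near_slot hD]
        push Not
        exact hnex
      rw [if_neg (by omega), wp, hR, if_neg hne]
      simp only [State.set_reg, if_true]
      calc (c : ℝ≥0∞) + (c + φ 0) = (2 : ℕ) * c + φ 0 := by push_cast; ring
        _ ≤ _ := by gcongr; omega
  have hload := loadProg_spec (B := B) hD e
  have hall : wp O data c B loadProg (fun s => c + wp O data c B tablesProg (fun s => c +
      wp O data c B scanProg (wp O data c B (.ite 6 28 sampleProg (.const 0 0))
        fun s => φ (s.reg 0)) s) s) ⟨fun i => [e].getD i 0, fun _ => 0⟩ ≤
      (17 : ℕ) * c + (c + ((m * (2 * (J * (15 * k + 41)) + 40) + 5 : ℕ) * c +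
        (c + (((far + 1) * (24 * J + 28) + 5 : ℕ) * c + ((T1 + 10 : ℕ) * c + R))))) := by
    refine hload.wp_le ?_
    rintro s1 ⟨hq1, h21⟩
    gcongr
    refine (tablesProg_spec hD hq1 h21 hB).wp_le ?_
    rintro s2 ⟨hq2, h24, hl2⟩
    gcongr
    refine (scanProg_spec hD hq2 hl2 h24).wp_le ?_
    rintro s3 ⟨hq3, hl3, h24', h⟩
    exact hend s3 ⟨hq3, hl3, h24'⟩ h
  rw [queryProg, wp]
  refine (add_le_add_right hall (c : ℝ≥0∞)).trans ?_
  rw [ENNReal.coe_add, ENNReal.coe_mul, ENNReal.coe_natCast]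
  have : (c : ℝ≥0∞) + ((17 : ℕ) * c + (c + ((m * (2 * (J * (15 * k + 41)) + 40) + 5 : ℕ) * c +
        (c + (((far + 1) * (24 * J + 28) + 5 : ℕ) * c + ((T1 + 10 : ℕ) * c + R)))))) =
      ((17 + (m * (2 * (J * (15 * k + 41)) + 40) + 5) + ((far + 1) * (24 * J + 28) + 5) +
        (T1 + 10) + 3 : ℕ) : ℝ≥0∞) * c + R := by
    push_cast; ring
  rw [this]
  gcongr
  rw [hT1, queryTime, ← hJ]
  omega

lemma queryTime_le (n k m far : ℕ) :
    queryTime n k m far ≤ 300 * (((n + m).size + 1) * (k + 1) * (m + far + 1)) := by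
  unfold queryTime
  generalize (n + m).size = J
  have h1 : m * (2 * (J * (15 * k + 41)) + 40) ≤ 82 * ((J + 1) * (k + 1) * m) := by
    have : 2 * (J * (15 * k + 41)) + 40 ≤ 82 * ((J + 1) * (k + 1)) := by nlinarith
    nlinarith
  have h2 : (far + 1) * (24 * J + 28) ≤ 28 * ((J + 1) * (k + 1) * (far + 1)) := by
    have : 24 * J + 28 ≤ 28 * ((J + 1) * (k + 1)) := by nlinarith
    nlinarith
  have h3 : (24 * J + 46) * (m + far) ≤ 46 * ((J + 1) * (k + 1) * (m + far)) := by
    have : 24 * J + 46 ≤ 46 * ((J + 1) * (k + 1)) := by nlinarith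
    nlinarith
  have h4 : (15 * k + 20) * m ≤ 20 * ((J + 1) * (k + 1) * m) := by
    have : 15 * k + 20 ≤ 20 * ((J + 1) * (k + 1)) := by nlinarith
    nlinarith
  have h5 : 1 ≤ (J + 1) * (k + 1) := by nlinarith
  generalize (J + 1) * (k + 1) = A at *
  nlinarith

end programs

/-! ### The output distribution -/

section output

variable {O : Oracle} {data : ℕ → ℕ} {n k m : ℕ}

lemma good_start (p : Prog) (inputs : List ℕ) (B : ℕ) : Good B (start p inputs).2 := by
  intro a ha
  exact absurd rfl ha

lemma wp_query_indicator (hm : 0 < m) (hD : IsDS O n k m data) (e : ℕ) (V : ℕ → Prop)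
    [DecidablePred V] :
    wp O data 0 (spaceBound n k m) queryProg ({s | V (s.reg 0)}.indicator 1)
      (start queryProg [e]).2 ≤
    ((if (found O n k m).Nonempty then (((found O n k m).filter V).card : ℝ≥0) /
      (found O n k m).card else if V 0 then 1 else 0 : ℝ≥0) : ℝ≥0∞) := by
  have h := queryProg_le (data := data) hm hD le_rfl e 0 (fun v => if V v then 1 else 0)
  have hf : ({s : State | V (s.reg 0)}.indicator 1 : State → ℝ≥0∞) =
      fun s => (((fun v => if V v then 1 else 0) (s.reg 0) : ℝ≥0) : ℝ≥0∞) := by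
    funext s
    by_cases hs : V (s.reg 0) <;> simp [hs]
  rw [hf]
  refine h.trans (le_of_eq ?_)
  rw [mul_zero, zero_add, ← Finset.sum_filter, Finset.sum_const]
  simp

lemma wp_query_time (hm : 0 < m) (hD : IsDS O n k m data) (e : ℕ) :
    wp O data 1 (spaceBound n k m) queryProg (fun _ => 0) (start queryProg [e]).2 ≤
      (queryTime n k m (farSlots O n k m data) : ℝ≥0∞) := by
  have h := queryProg_le (data := data) hm hD le_rfl e 1 (fun _ => 0)
  rw [ENNReal.coe_add] at h
  refine le_trans h ?_
  simp

/-- If nothing is found, then the output is `0` almost surely. -/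
lemma outputProb_query_of_empty (hm : 0 < m) (hD : IsDS O n k m data) (e : ℕ)
    (hS : ¬ (found O n k m).Nonempty) (v : ℕ) :
    outputProb O data (start queryProg [e]) v = if v = 0 then 1 else 0 := by
  have hle : outputProb O data (start queryProg [e]) v ≤ _ :=
    (outputProb_le_wp (good_start queryProg [e] _) v).trans (wp_query_indicator hm hD e (· = v))
  rw [if_neg hS] at hle
  split_ifs at hle ⊢ with h0 h1 h1
  · subst h0
    refine le_antisymm (by simpa using hle) ?_
    have htime := ne_top_of_le_ne_top (ENNReal.natCast_ne_top _) (wp_query_time hm hD e)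
    have h0 := wp_query_indicator hm hD e (· ∉ ({0} : Finset ℕ))
    rw [if_neg hS, if_neg (by simp)] at h0
    have : 1 ≤ ∑ v ∈ {0}, outputProb O data (start queryProg [e]) v :=
      one_le_sum_outputProb (good_start queryProg [e] _) htime {0} (le_antisymm (by simpa using h0) zero_le)
    simpa using this
  · exact absurd h0.symm h1
  · exact absurd h1.symm h0
  · exact le_antisymm (by simpa using hle) zero_le

/-- The output is exactly uniform on the points found: no output is too likely, and the probabilities
add up to one because the query halts almost surely. -/
lemma outputProb_query (hm : 0 < m) (hD : IsDS O n k m data) (e : ℕ)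
    (hS : (found O n k m).Nonempty) (v : ℕ) :
    outputProb O data (start queryProg [e]) v =
      if v ∈ found O n k m then ((found O n k m).card : ℝ≥0∞)⁻¹ else 0 := by
  have hcard := Finset.card_pos.2 hS
  have hcard0 : ((found O n k m).card : ℝ≥0) ≠ 0 := by positivity
  have hle : ∀ v, outputProb O data (start queryProg [e]) v ≤
      if v ∈ found O n k m then ((found O n k m).card : ℝ≥0∞)⁻¹ else 0 := by
    intro v
    have hle : outputProb O data (start queryProg [e]) v ≤ _ :=
      (outputProb_le_wp (good_start queryProg [e] _) v).trans (wp_query_indicator hm hD e (· = v))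
    rw [if_pos hS] at hle
    refine hle.trans ?_
    rw [Finset.filter_eq']
    split_ifs with hv
    · simp [ENNReal.coe_inv hcard0]
    · simp
  have htime := ne_top_of_le_ne_top (ENNReal.natCast_ne_top _) (wp_query_time hm hD e)
  have h0 := wp_query_indicator hm hD e (· ∉ found O n k m)
  rw [if_pos hS, Finset.filter_eq_empty_iff.2 (by simp)] at h0
  have hsum : 1 ≤ ∑ v ∈ found O n k m, outputProb O data (start queryProg [e]) v :=
    one_le_sum_outputProb (good_start queryProg [e] _) htime (found O n k m) (le_antisymm (by simpa using h0) zero_le)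
  refine le_antisymm (hle v) ?_
  split_ifs with hv
  · rw [← Finset.add_sum_erase _ _ hv] at hsum
    have hrest : ∑ w ∈ (found O n k m).erase v, outputProb O data (start queryProg [e]) w ≤
        ((found O n k m).card - 1 : ℕ) * ((found O n k m).card : ℝ≥0∞)⁻¹ := by
      refine (Finset.sum_le_card_nsmul _ _ ((found O n k m).card : ℝ≥0∞)⁻¹
        fun w hw => (hle w).trans ?_).trans ?_
      · rw [if_pos (Finset.mem_of_mem_erase hw)]
      · rw [Finset.card_erase_of_mem hv, nsmul_eq_mul]
    have hone : (1 : ℝ≥0∞) = ((found O n k m).card : ℝ≥0∞)⁻¹ +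
        ((found O n k m).card - 1 : ℕ) * ((found O n k m).card : ℝ≥0∞)⁻¹ := by
      rw [← one_add_mul, ← Nat.cast_one, ← Nat.cast_add, Nat.add_sub_of_le hcard,
        ENNReal.mul_inv_cancel (by exact_mod_cast hcard0) (ENNReal.natCast_ne_top _), Nat.cast_one]
    have hfin : ((found O n k m).card - 1 : ℕ) * ((found O n k m).card : ℝ≥0∞)⁻¹ ≠ ⊤ :=
      ENNReal.mul_ne_top (ENNReal.natCast_ne_top _)
        (ENNReal.inv_ne_top.2 (by exact_mod_cast hcard0))
    rw [hone] at hsum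
    exact (ENNReal.add_le_add_iff_right hfin).1 (hsum.trans (by gcongr))
  · exact zero_le

end output

section approx

variable {X : Type*} {n : ℕ}

open Classical in
/-- The points of the data set whose numbers are in `F`; point `i` has number `i + 1`. -/
noncomputable def pointSet (P : Fin n ↪ X) (F : Finset ℕ) : Finset X :=
  (Finset.univ.filter fun i : Fin n => (i : ℕ) + 1 ∈ F).map P

lemma mem_pointSet {P : Fin n ↪ X} {F : Finset ℕ} {i : Fin n} :
    P i ∈ pointSet P F ↔ (i : ℕ) + 1 ∈ F := by
  simp [pointSet]

lemma sum_pointSet {F : Finset ℕ} (hF : F ⊆ Finset.Icc 1 n) {M : Type*} [AddCommMonoid M]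
    (g : ℕ → M) : ∑ v ∈ F, g v = ∑ i : Fin n, if (i : ℕ) + 1 ∈ F then g (i + 1) else 0 := by
  rw [Fin.sum_univ_eq_sum_range (fun i => if i + 1 ∈ F then g (i + 1) else 0) n,
    ← Finset.sum_filter]
  refine Finset.sum_bij' (fun v _ => v - 1) (fun i _ => i + 1) ?_ ?_ ?_ ?_ ?_
  · intro v hv
    have := Finset.mem_Icc.1 (hF hv)
    simp only [Finset.mem_filter, Finset.mem_range]
    rw [Nat.sub_add_cancel this.1]
    exact ⟨by omega, hv⟩
  · intro i hi
    exact (Finset.mem_filter.1 hi).2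
  · intro v hv
    have := Finset.mem_Icc.1 (hF hv)
    omega
  · intro i _; simp
  · intro v hv
    have := Finset.mem_Icc.1 (hF hv)
    rw [Nat.sub_add_cancel this.1]

lemma card_pointSet {P : Fin n ↪ X} {F : Finset ℕ} (hF : F ⊆ Finset.Icc 1 n) :
    (pointSet P F).card = F.card := by
  classical
  rw [pointSet, Finset.card_map, Finset.card_filter, Finset.card_eq_sum_ones, sum_pointSet hF]

lemma approxUniformOn_query [MetricSpace X] {O : Oracle} {data : ℕ → ℕ} {k m : ℕ} (hm : 0 < m)
    (hD : IsDS O n k m data) (P : Fin n ↪ X) (e : ℕ) {ε : ℝ} (hε : 0 < ε) :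
    ApproxUniformOn P (pointSet P (found O n k m)) ε
      (outputProb O data (start queryProg [e])) := by
  have hF : found O n k m ⊆ Finset.Icc 1 n := fun x hx => (mem_found.1 hx).1
  have hc := card_pointSet (P := P) hF
  by_cases hS : (found O n k m).Nonempty
  · have hout := outputProb_query hm hD e hS
    have hcard := Finset.card_pos.2 hS
    refine ⟨fun i hi => ?_, fun i hi => ?_, fun _ => ?_, fun h => ?_⟩
    · rw [hout, if_pos (mem_pointSet.1 hi), hc, ENNReal.toReal_inv, ENNReal.toReal_natCast,
        one_div]
      constructor
      · exact div_le_self (by positivity) (by linarith)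
      · exact le_mul_of_one_le_left (by positivity) (by linarith)
    · rw [hout, if_neg (fun h => hi (mem_pointSet.2 h))]
    · simp only [hout]
      rw [← sum_pointSet hF (fun _ => ((found O n k m).card : ℝ≥0∞)⁻¹), Finset.sum_const,
        nsmul_eq_mul]
      refine ENNReal.mul_inv_cancel ?_ (ENNReal.natCast_ne_top _)
      exact_mod_cast hcard.ne'
    · rw [← Finset.card_eq_zero, hc] at h
      omega
  · have hout := outputProb_query_of_empty hm hD e hS
    have hempty : pointSet P (found O n k m) = ∅ := by
      rw [← Finset.card_eq_zero, hc, Finset.not_nonempty_iff_eq_empty.1 hS, Finset.card_empty]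
    refine ⟨fun i hi => ?_, fun i _ => ?_, fun h => ?_, fun _ => ?_⟩
    · simp [hempty] at hi
    · rw [hout, if_neg (by omega)]
    · simp [hempty] at h
    · rw [hout, if_pos rfl]

end approx

/-! ### Collision probabilities -/

section prob

variable {H : Type*} [MeasurableSpace H] {ν : Measure H} [IsProbabilityMeasure ν] {N k m : ℕ}

/-- The event that all functions of table `i` are in the set `E`. -/
def tableEvent (N m i : ℕ) (E : Set H) : Set (Fin N → H) :=
  {ω | ∀ l : Fin N, (l : ℕ) % m = i → ω l ∈ E}

lemma measurableSet_tableEvent {E : Set H} (hE : MeasurableSet E) (i : ℕ) :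
    MeasurableSet (tableEvent N m i E) := by
  have : tableEvent N m i E =
      ⋂ l : Fin N, ⋂ _ : (l : ℕ) % m = i, (fun ω : Fin N → H => ω l) ⁻¹' E := by
    ext ω; simp [tableEvent]
  rw [this]
  exact MeasurableSet.iInter fun l => MeasurableSet.iInter fun _ => measurable_pi_apply l hE

open Classical in
lemma measure_tableEvent_prod (E : Set H) (i : ℕ) :
    Measure.pi (fun _ : Fin N => ν) (tableEvent N m i E) =
      ∏ l : Fin N, if (l : ℕ) % m = i then ν E else 1 := by
  have : tableEvent N m i E =
      Set.univ.pi fun l : Fin N => if (l : ℕ) % m = i then E else Set.univ := by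
    ext ω
    simp only [tableEvent, Set.mem_ofPred_eq, Set.mem_univ_pi]
    refine forall_congr' fun l => ?_
    split_ifs with h <;> simp [h]
  rw [this, Measure.pi_pi]
  refine Finset.prod_congr rfl fun l _ => ?_
  split_ifs <;> simp

lemma measure_tableEvent (hN : N = m * k) (E : Set H) {i : ℕ} (hi : i < m) :
    Measure.pi (fun _ : Fin N => ν) (tableEvent N m i E) = ν E ^ k := by
  classical
  rw [measure_tableEvent_prod, ← Finset.prod_filter, Finset.prod_const]
  congr 1
  subst hN
  have hlt : ∀ j : Fin k, i + m * j < m * k := fun j => by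
    have h := Nat.mul_le_mul_left m j.isLt
    rw [Nat.succ_eq_add_one, mul_add_one] at h
    omega
  symm
  refine (Finset.card_fin k).symm.trans ?_
  refine Finset.card_bij (fun j _ => ⟨i + m * j, hlt j⟩) ?_ ?_ ?_
  · intro j _
    simp [Nat.mod_eq_of_lt hi]
  · intro j _ j' _ h
    have h' : m * (j : ℕ) = m * j' := by simpa using h
    exact Fin.ext (Nat.eq_of_mul_eq_mul_left (by omega) h')
  · intro l hl
    simp only [Finset.mem_filter, Finset.mem_univ, true_and] at hl
    refine ⟨⟨l / m, Nat.div_lt_of_lt_mul l.isLt⟩, Finset.mem_univ _, Fin.ext ?_⟩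
    simp only
    rw [← hl, Nat.mod_add_div]

/-- The tables use disjoint sets of hash functions, so their events are independent. -/
lemma measure_no_tableEvent (hN : N = m * k) {E : Set H} (hE : MeasurableSet E) :
    Measure.pi (fun _ : Fin N => ν) {ω | ∀ i < m, ω ∉ tableEvent N m i E} =
      (1 - ν E ^ k) ^ m := by
  classical
  have hmeas := fun i : Fin m => measurableSet_tableEvent (N := N) (m := m) hE i
  have hind : ProbabilityTheory.iIndepSet (fun i : Fin m => tableEvent N m i E)
      (Measure.pi (fun _ : Fin N => ν)) := by
    rw [ProbabilityTheory.iIndepSet_iff_meas_biInter hmeas]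
    intro s
    have : (⋂ i ∈ s, tableEvent N m i E) =
        Set.univ.pi fun l : Fin N => if ∃ i ∈ s, (l : ℕ) % m = i then E else Set.univ := by
      ext ω
      simp only [Set.mem_iInter, tableEvent, Set.mem_ofPred_eq, Set.mem_univ_pi]
      constructor
      · intro h l
        split_ifs with hl
        · obtain ⟨i, hi, hl⟩ := hl
          exact h i hi l hl
        · trivial
      · intro h i hi l hl
        have := h l
        rwa [if_pos ⟨i, hi, hl⟩] at this
    rw [this, Measure.pi_pi]
    simp only [measure_tableEvent_prod]
    rw [Finset.prod_comm]
    refine Finset.prod_congr rfl fun l _ => ?_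
    split_ifs with hl
    · obtain ⟨i, hi, hl⟩ := hl
      rw [Finset.prod_eq_single i]
      · rw [if_pos hl]
      · intro i' _ hne
        rw [if_neg fun h => hne (Fin.ext (h.symm.trans hl))]
      · exact fun h => absurd hi h
    · rw [measure_univ, Finset.prod_eq_one]
      intro i hi
      rw [if_neg fun h => hl ⟨i, hi, h⟩]
  have hset : {ω : Fin N → H | ∀ i < m, ω ∉ tableEvent N m i E} =
      ⋂ i : Fin m, (tableEvent N m i E)ᶜ := by
    ext ω
    simp [Fin.forall_iff]
  rw [hset, ((ProbabilityTheory.iIndepSet_iff_iIndep _ _).1 hind).meas_iInter fun i =>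
    MeasurableSet.compl (MeasurableSpace.measurableSet_generateFrom rfl)]
  rw [Finset.prod_congr rfl (g := fun _ => 1 - ν E ^ k), Finset.prod_const, Finset.card_univ,
    Fintype.card_fin]
  intro i _
  rw [prob_compl_eq_one_sub (hmeas i), measure_tableEvent hN E i.isLt]

end prob

section lsh

variable {X : Type*} [MetricSpace X] {H : Type*} {n N k m : ℕ}

/-- The data point `a` shares the bucket of the query in table `i` if and only if all functions of
this table collide. -/
lemma keyCmp_oracle (hN : N = m * k) (h : H → X → ℕ) (P : Fin n ↪ X) (ω : Fin N → H) (q : X)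
    (R : ℝ) {i : ℕ} (hi : i < m) (a : Fin n) :
    keyCmp (oracle h P ω (some q) R) m i (a + 1) 0 k = 1 ↔
      ω ∈ tableEvent N m i {w | h w (P a) = h w q} := by
  rw [keyCmp_eq_one]
  subst hN
  constructor
  · intro hk l hl
    have hlm : (l : ℕ) / m < k := Nat.div_lt_of_lt_mul l.isLt
    have := hk _ hlm
    rw [← hl, Nat.mod_add_div] at this
    simpa [oracle, point] using this
  · intro hk j hj
    have hlt : i + m * j < m * k := by
      have h := Nat.mul_le_mul_left m hj
      rw [Nat.succ_eq_add_one, mul_add_one] at h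
      omega
    have := hk ⟨i + m * j, hlt⟩ (by simp [Nat.mod_eq_of_lt hi])
    simpa [oracle, point, hlt] using this

lemma near_oracle (h : H → X → ℕ) (P : Fin n ↪ X) (ω : Fin N → H) (q : X) (R : ℝ) (a : Fin n) :
    (oracle h P ω (some q) R).near (a + 1) ↔ dist q (P a) ≤ R := by
  simp [oracle, point]

lemma succ_mem_found (hN : N = m * k) (h : H → X → ℕ) (P : Fin n ↪ X) (ω : Fin N → H) (q : X)
    (R : ℝ) (a : Fin n) :
    (a : ℕ) + 1 ∈ found (oracle h P ω (some q) R) n k m ↔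
      dist q (P a) ≤ R ∧ ∃ i < m, ω ∈ tableEvent N m i {w | h w (P a) = h w q} := by
  rw [mem_found, near_oracle, deg, Finset.card_pos]
  have ha : (a : ℕ) + 1 ∈ Finset.Icc 1 n := Finset.mem_Icc.2 ⟨by omega, a.isLt⟩
  simp only [ha, true_and]
  refine and_congr_right fun _ => ⟨?_, ?_⟩
  · rintro ⟨i, hi⟩
    simp only [Finset.mem_filter, Finset.mem_range] at hi
    exact ⟨i, hi.1, (keyCmp_oracle hN h P ω q R hi.1 a).1 hi.2⟩
  · rintro ⟨i, hi, hω⟩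
    exact ⟨i, by simp [hi, (keyCmp_oracle hN h P ω q R hi a).2 hω]⟩

lemma oracle_hash_point (h : H → X → ℕ) (P : Fin n ↪ X) (ω : Fin N → H) (q q' : Option X) (R : ℝ) :
    ∀ l, ∀ x ∈ Finset.Icc 1 n, (oracle h P ω q R).hash l x = (oracle h P ω q' R).hash l x := by
  intro l x hx
  obtain ⟨y, rfl⟩ : ∃ y, x = y + 1 := ⟨x - 1, by have := Finset.mem_Icc.1 hx; omega⟩
  simp [oracle, point]

variable [MeasurableSpace H] {ν : Measure H} {h : H → X → ℕ} {r c p₁ p₂ : ℝ}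

lemma IsLSHFamily.measurableSet_collision (hh : IsLSHFamily ν h r c p₁ p₂) (x y : X) :
    MeasurableSet {w | h w x = h w y} :=
  measurableSet_eq_fun (hh.measurable x) (hh.measurable y)

variable [IsProbabilityMeasure ν]

lemma IsLSHFamily.p₁_le_one (hh : IsLSHFamily ν h r c p₁ p₂) (hr : 0 ≤ r) (x : X) : p₁ ≤ 1 := by
  have := hh.near x x (by simpa using hr)
  simpa using this

open Classical in
/-- The expected number of slots with far points is at most the number of tables. -/
lemma lintegral_farSlots_le (hh : IsLSHFamily ν h r c p₁ p₂) (hN : N = m * k) (P : Fin n ↪ X)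
    (D : (Fin N → H) → ℕ → ℕ) (q : X)
    (hD : ∀ ω, IsDS (oracle h P ω (some q) (c * r)) n k m (D ω)) :
    ∫⁻ ω, (farSlots (oracle h P ω (some q) (c * r)) n k m (D ω) : ℝ≥0∞)
      ∂(Measure.pi (fun _ : Fin N => ν)) ≤ m * (n * ENNReal.ofReal p₂ ^ k) := by
  have heq : ∀ ω, (farSlots (oracle h P ω (some q) (c * r)) n k m (D ω) : ℝ≥0∞) =
      ∑ i ∈ Finset.range m, ∑ a : Fin n, if dist q (P a) ≤ c * r then 0 else
        (tableEvent N m i {w | h w (P a) = h w q}).indicator 1 ω := by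
    intro ω
    have h1 := sum_slots (hD ω) (fun _ x => if (oracle h P ω (some q) (c * r)).near x then
      (0 : ℝ≥0∞) else 1)
    have h2 : (farSlots (oracle h P ω (some q) (c * r)) n k m (D ω) : ℝ≥0∞) =
        ∑ s ∈ Finset.range (cum (oracle h P ω (some q) (c * r)) n k m m),
          if (oracle h P ω (some q) (c * r)).near
            (slotPoint (oracle h P ω (some q) (c * r)) n k m (D ω) s) then (0 : ℝ≥0∞) else 1 := by
      rw [farSlots, Finset.card_filter]
      push_cast
      refine Finset.sum_congr rfl fun s _ => ?_
      split_ifs <;> simp_all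
    rw [h2, h1]
    refine Finset.sum_congr rfl fun i hi => ?_
    rw [Finset.mem_range] at hi
    have hsub : bucket (oracle h P ω (some q) (c * r)) n k m i ⊆ Finset.Icc 1 n :=
      Finset.filter_subset _ _
    rw [sum_pointSet hsub]
    refine Finset.sum_congr rfl fun a _ => ?_
    have hb : (a : ℕ) + 1 ∈ bucket (oracle h P ω (some q) (c * r)) n k m i ↔
        ω ∈ tableEvent N m i {w | h w (P a) = h w q} := by
      rw [mem_bucket, keyCmp_oracle hN h P ω q _ hi a]
      simp
    simp only [near_oracle, hb]
    by_cases hω : ω ∈ tableEvent N m i {w | h w (P a) = h w q} <;> simp [hω]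
  simp only [heq]
  have hmeas : ∀ i (a : Fin n), MeasurableSet (tableEvent N m i {w | h w (P a) = h w q}) :=
    fun i a => measurableSet_tableEvent (hh.measurableSet_collision _ _) i
  rw [lintegral_finsetSum]
  swap
  · intro i _
    refine Finset.measurable_sum _ fun a _ => ?_
    split_ifs
    · exact measurable_const
    · exact measurable_one.indicator (hmeas i a)
  refine (Finset.sum_le_card_nsmul _ _ (n * ENNReal.ofReal p₂ ^ k) fun i hi => ?_).trans ?_
  · rw [Finset.mem_range] at hi
    rw [lintegral_finsetSum]
    swap
    · intro a _
      split_ifs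
      · exact measurable_const
      · exact measurable_one.indicator (hmeas i a)
    refine (Finset.sum_le_card_nsmul _ _ (ENNReal.ofReal p₂ ^ k) fun a _ => ?_).trans ?_
    · split_ifs with hd
      · simp
      · rw [lintegral_indicator_one (hmeas i a), measure_tableEvent hN _ hi]
        gcongr
        have := hh.far (P a) q (by rw [dist_comm]; exact not_le.1 hd)
        rw [← ENNReal.ofReal_toReal (measure_ne_top ν {w | h w (P a) = h w q})]
        exact ENNReal.ofReal_le_ofReal this
    · simp
  · simp

/-- A union bound over the data points: some near point is in none of the `m` buckets with
probability at most `n (1 - p₁ ^ k) ^ m`. -/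
lemma measure_near_subset_found (hh : IsLSHFamily ν h r c p₁ p₂) (hr : 0 ≤ r) (hc : 1 ≤ c)
    (hN : N = m * k) (P : Fin n ↪ X) (q : X) :
    1 - n * (1 - p₁ ^ k) ^ m ≤ (Measure.pi (fun _ : Fin N => ν)).real
      {ω | nbr P q r ⊆
        (pointSet P (found (oracle h P ω (some q) (c * r)) n k m) : Set X)} := by
  classical
  set A := {ω : Fin N → H | nbr P q r ⊆
        (pointSet P (found (oracle h P ω (some q) (c * r)) n k m) : Set X)} with hA
  set bad : Fin n → Set (Fin N → H) := fun a => if dist q (P a) ≤ r then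
    {ω | ∀ i < m, ω ∉ tableEvent N m i {w | h w (P a) = h w q}} else ∅ with hbad
  have hmeas : ∀ a, MeasurableSet (bad a) := by
    intro a
    simp only [hbad]
    split_ifs
    · have : {ω : Fin N → H | ∀ i < m, ω ∉ tableEvent N m i {w | h w (P a) = h w q}} =
          ⋂ i, ⋂ _ : i < m, (tableEvent N m i {w | h w (P a) = h w q})ᶜ := by
        ext ω; simp
      rw [this]
      exact MeasurableSet.iInter fun i => MeasurableSet.iInter fun _ =>
        (measurableSet_tableEvent (hh.measurableSet_collision _ _) i).compl
    · exact MeasurableSet.empty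
  have hsub : (⋃ a, bad a)ᶜ ⊆ A := by
    intro ω hω x hx
    obtain ⟨⟨a, rfl⟩, hd⟩ := hx
    rw [Finset.mem_coe, mem_pointSet, succ_mem_found hN]
    refine ⟨hd.trans (le_mul_of_one_le_left hr hc), ?_⟩
    simp only [Set.mem_compl_iff, Set.mem_iUnion, not_exists] at hω
    have := hω a
    simp only [hbad, hd, if_true] at this
    simpa using this
  have hp₁ := hh.p₁_le_one hr q
  have hp₁0 : 0 < p₁ := hh.p₂_pos.trans hh.p₂_lt_p₁
  have hpow : p₁ ^ k ≤ 1 := pow_le_one₀ hp₁0.le hp₁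
  have hprob : ∀ a, (Measure.pi (fun _ : Fin N => ν)).real (bad a) ≤ (1 - p₁ ^ k) ^ m := by
    intro a
    simp only [hbad]
    split_ifs with hd
    · rw [measureReal_def, measure_no_tableEvent hN (hh.measurableSet_collision _ _),
        ENNReal.toReal_pow, ENNReal.toReal_sub_of_le (pow_le_one' prob_le_one k) (by simp),
        ENNReal.toReal_pow, ENNReal.toReal_one]
      have h1 := hh.near (P a) q (by rw [dist_comm]; exact hd)
      have h2 : ν.real {w | h w (P a) = h w q} ≤ 1 := measureReal_le_one
      refine pow_le_pow_left₀ ?_ ?_ m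
      · rw [sub_nonneg]
        exact pow_le_one₀ measureReal_nonneg h2
      · exact sub_le_sub_left (pow_le_pow_left₀ hp₁0.le h1 k) 1
    · rw [measureReal_empty]
      exact pow_nonneg (by linarith) m
  have hunion : (Measure.pi (fun _ : Fin N => ν)).real (⋃ a, bad a) ≤ n * (1 - p₁ ^ k) ^ m := by
    refine (measureReal_iUnion_fintype_le bad).trans ?_
    refine (Finset.sum_le_card_nsmul _ _ _ fun a _ => hprob a).trans ?_
    simp
  calc 1 - n * (1 - p₁ ^ k) ^ m
      ≤ 1 - (Measure.pi (fun _ : Fin N => ν)).real (⋃ a, bad a) := by linarith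
    _ = (Measure.pi (fun _ : Fin N => ν)).real (⋃ a, bad a)ᶜ := by
        rw [probReal_compl_eq_one_sub (MeasurableSet.iUnion hmeas)]
    _ ≤ _ := measureReal_mono hsub

end lsh

/-! ### Parameters -/

/-- The number of repetitions of the LSH data structure for failure probability `n ^ (-b)`. -/
noncomputable def reps (b n : ℕ) : ℕ := ⌈((b : ℝ) + 1) * Real.log n⌉₊ + 1

section params

variable {b n : ℕ} {p₁ p₂ : ℝ}

lemma reps_le (b n : ℕ) : (reps b n : ℝ) ≤ (b + 3) * (1 + Real.log n) := by
  have h0 := Real.log_natCast_nonneg n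
  have h1 : 0 ≤ ((b : ℝ) + 1) * Real.log n := by positivity
  have := (Nat.ceil_lt_add_one h1).le
  unfold reps
  push_cast
  nlinarith [(Nat.cast_nonneg b : (0 : ℝ) ≤ b)]

lemma lshL_pos (h₁ : 0 < p₁) : 0 < lshL n p₁ p₂ := by
  unfold lshL
  exact Nat.ceil_pos.2 (by positivity)

/-- The choice of `k`: a bucket contains at most one far point in expectation. -/
lemma n_mul_pow_le_one (hn : 0 < n) (h₂ : 0 < p₂) (h₂' : p₂ < 1) :
    (n : ℝ) * p₂ ^ lshK n p₂ ≤ 1 := by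
  have hlog : 0 < Real.log (1 / p₂) := Real.log_pos (by rw [lt_div_iff₀ h₂]; linarith)
  have hk : Real.log n ≤ lshK n p₂ * Real.log (1 / p₂) := by
    rw [← div_le_iff₀ hlog]
    exact Nat.le_ceil _
  have hn' : (0 : ℝ) < n := by exact_mod_cast hn
  rw [← Real.log_le_log_iff (by positivity) one_pos, Real.log_mul hn'.ne' (by positivity),
    Real.log_pow, Real.log_one]
  rw [one_div, Real.log_inv] at hk
  linarith

/-- The choice of `L` and of the number of repetitions: the union bound over the data points. -/
lemma failure_le (hn : 0 < n) (h₁ : 0 < p₁) (h₁' : p₁ ≤ 1) :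
    (n : ℝ) * (1 - p₁ ^ lshK n p₂) ^ (reps b n * lshL n p₁ p₂) ≤ 1 / (n : ℝ) ^ b := by
  have hn' : (0 : ℝ) < n := by exact_mod_cast hn
  set x := p₁ ^ lshK n p₂ with hx
  have hx0 : 0 < x := by positivity
  have hx1 : x ≤ 1 := pow_le_one₀ h₁.le h₁'
  have hL : 1 ≤ x * lshL n p₁ p₂ := by
    have h : (1 / p₁) ^ lshK n p₂ ≤ lshL n p₁ p₂ := Nat.le_ceil _
    rw [one_div, inv_pow, ← hx] at h
    calc (1 : ℝ) = x * x⁻¹ := (mul_inv_cancel₀ hx0.ne').symm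
      _ ≤ _ := by gcongr
  have ht : ((b : ℝ) + 1) * Real.log n ≤ reps b n := by
    unfold reps
    push_cast
    linarith [Nat.le_ceil (((b : ℝ) + 1) * Real.log n)]
  have hpow : (1 - x) ^ (reps b n * lshL n p₁ p₂) ≤ Real.exp (-((b + 1) * Real.log n)) := by
    calc (1 - x) ^ (reps b n * lshL n p₁ p₂)
        ≤ Real.exp (-x) ^ (reps b n * lshL n p₁ p₂) :=
          pow_le_pow_left₀ (by linarith) (Real.one_sub_le_exp_neg x) _
      _ = Real.exp (-(reps b n * (x * lshL n p₁ p₂))) := by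
          rw [← Real.exp_nat_mul]; push_cast; ring_nf
      _ ≤ _ := by
          rw [Real.exp_le_exp]
          have : (reps b n : ℝ) * 1 ≤ reps b n * (x * lshL n p₁ p₂) := by gcongr
          linarith
  have hexp : Real.exp (-((b + 1) * Real.log n)) = 1 / (n : ℝ) ^ (b + 1) := by
    rw [Real.exp_neg, one_div, ← Nat.cast_one, ← Nat.cast_add, Real.exp_nat_mul, Real.exp_log hn']
  rw [hexp] at hpow
  calc (n : ℝ) * (1 - x) ^ (reps b n * lshL n p₁ p₂) ≤ n * (1 / (n : ℝ) ^ (b + 1)) := by gcongr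
    _ = _ := by rw [pow_succ]; field_simp

lemma spaceBound_le {k m : ℕ} (hn : 0 < n) (hm : 0 < m) :
    spaceBound n k m ≤ 12 * (m * (n + k)) := by
  have := size_le_self (n + m)
  unfold spaceBound
  nlinarith [Nat.mul_le_mul hm hn, Nat.zero_le (m * k), Nat.mul_le_mul_right k hm,
    Nat.mul_le_mul_right n hm, Nat.mul_le_mul_left m hn]

/-- The logarithm `log (n L)`, in terms of which the polylogarithmic factors are expressed. -/
noncomputable def logNL (n : ℕ) (p₁ p₂ : ℝ) : ℝ := Real.log (n * lshL n p₁ p₂)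

lemma log_le_logNL (hn : 0 < n) (h₁ : 0 < p₁) : Real.log n ≤ logNL n p₁ p₂ := by
  have hn' : (0 : ℝ) < n := by exact_mod_cast hn
  have hL : (1 : ℝ) ≤ lshL n p₁ p₂ := by exact_mod_cast lshL_pos (n := n) (p₂ := p₂) h₁
  exact Real.log_le_log hn' (le_mul_of_one_le_right hn'.le hL)

lemma logNL_nonneg (hn : 0 < n) (h₁ : 0 < p₁) : 0 ≤ logNL n p₁ p₂ :=
  (Real.log_natCast_nonneg n).trans (log_le_logNL hn h₁)

lemma tables_le (hn : 0 < n) (h₁ : 0 < p₁) :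
    ((reps b n * lshL n p₁ p₂ : ℕ) : ℝ) ≤ (b + 3) * (1 + logNL n p₁ p₂) * lshL n p₁ p₂ := by
  have h := log_le_logNL (p₂ := p₂) hn h₁
  push_cast
  gcongr
  refine (reps_le b n).trans ?_
  gcongr

/-- A binary search takes `O(1 + log (n L))` steps. -/
lemma size_succ_le (hn : 0 < n) (h₁ : 0 < p₁) :
    ((n + reps b n * lshL n p₁ p₂).size + 1 : ℝ) ≤ (2 * b + 10) * (1 + logNL n p₁ p₂) := by
  set L := lshL n p₁ p₂ with hL
  set J := (n + reps b n * L).size with hJ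
  have hℓ := logNL_nonneg (p₂ := p₂) hn h₁
  have hn' : (1 : ℝ) ≤ n := by exact_mod_cast hn
  have hL' : (1 : ℝ) ≤ L := by exact_mod_cast lshL_pos (n := n) (p₂ := p₂) h₁
  have hJpos : 0 < J := Nat.size_pos.2 (by omega)
  have hpow : 2 ^ (J - 1) ≤ n + reps b n * L := Nat.lt_size.1 (by omega)
  have hb : (0 : ℝ) ≤ b := Nat.cast_nonneg b
  -- `n + t L ≤ (b + 4) (n L) ^ 2`, since `t ≤ (b + 3) n`
  have hreal : (2 : ℝ) ^ (J - 1) ≤ (b + 4) * (n * L) ^ 2 := by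
    have h1 : (2 : ℝ) ^ (J - 1) ≤ n + reps b n * L := by exact_mod_cast hpow
    have h2 : (reps b n : ℝ) ≤ (b + 3) * n := by
      refine (reps_le b n).trans ?_
      gcongr
      linarith [Real.log_le_sub_one_of_pos (show (0 : ℝ) < n by linarith)]
    have h3 : (n : ℝ) * L ≤ (n * L) ^ 2 := by
      have : (1 : ℝ) ≤ n * L := one_le_mul_of_one_le_of_one_le hn' hL'
      nlinarith
    calc (2 : ℝ) ^ (J - 1) ≤ n + reps b n * L := h1
      _ ≤ n * L + (b + 3) * n * L := by
        gcongr
        exact le_mul_of_one_le_right (by linarith) hL'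
      _ = (b + 4) * (n * L) := by ring
      _ ≤ _ := by gcongr
  have hlog := Real.log_le_log (by positivity) hreal
  rw [Real.log_pow, Real.log_mul (by positivity) (by positivity), Real.log_pow] at hlog
  have hb4 : Real.log ((b : ℝ) + 4) ≤ b + 3 := by
    linarith [Real.log_le_sub_one_of_pos (show (0 : ℝ) < (b : ℝ) + 4 by positivity)]
  have hlog2 : (1 / 2 : ℝ) ≤ Real.log 2 := by linarith [Real.log_two_gt_d9]
  have hJc : ((J - 1 : ℕ) : ℝ) = J - 1 := by
    rw [Nat.cast_sub hJpos, Nat.cast_one]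
  have hJ1 : (0 : ℝ) ≤ ((J - 1 : ℕ) : ℝ) := Nat.cast_nonneg _
  have hkey : ((J - 1 : ℕ) : ℝ) * (1 / 2) ≤ b + 3 + 2 * logNL n p₁ p₂ := by
    have : ((J - 1 : ℕ) : ℝ) * (1 / 2) ≤ ((J - 1 : ℕ) : ℝ) * Real.log 2 := by gcongr
    have hdef : logNL n p₁ p₂ = Real.log (n * L) := rfl
    push_cast at hlog
    linarith
  rw [hJc] at hkey
  nlinarith [mul_nonneg hb hℓ]

end params

lemma pre_usesSpace {O : Oracle} {data : ℕ → ℕ} (n k L t : ℕ) {b : ℝ}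
    (hb : (spaceBound n k (t * L) : ℝ) ≤ b) :
    UsesSpace O data (start preProg [n, k, L, t]) b := by
  obtain ⟨τ, s', -, h⟩ := preProg_spec (O := O) (data := data) n k L t le_rfl
  exact usesSpace_of_wp (good_start preProg [n, k, L, t] _) (fun _ => 0)
    (ne_top_of_le_ne_top (by simp) (h 1 fun _ => 0)) hb

lemma exists_dataStructure (O : Oracle) (data : ℕ → ℕ) (n k L t : ℕ) :
    ∃ D : ℕ → ℕ, HaltsWithMemory O data (start preProg [n, k, L, t]) D ∧
      IsDS O n k (t * L) D ∧ ∀ a, D a ≤ spaceBound n k (t * L) := by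
  obtain ⟨τ, h⟩ := preProg_spec (O := O) (data := data) n k L t le_rfl
  obtain ⟨s', hs', hh⟩ := h.haltsWithMemory preProg_randFree
    (good_start preProg [n, k, L, t] _)
  exact ⟨s'.mem, hh, hs'⟩

end FairNN

open FairNN in
theorem mainTheorem2 :
    ∃ pre query : FairNN.Prog,
    -- failure exponent `b`; the number `t` of repetitions and the constants depend only on `b`
    ∀ b : ℕ, ∃ (t : ℕ → ℕ) (C : ℝ) (a : ℕ),
    (∀ n : ℕ, 0 < n → (t n : ℝ) ≤ C * (1 + Real.log n)) ∧
    ∀ (X : Type u) [MetricSpace X] (H : Type v) [MeasurableSpace H]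
      (ν : MeasureTheory.Measure H) [MeasureTheory.IsProbabilityMeasure ν]
      (h : H → X → ℕ) (r c p₁ p₂ : ℝ), 0 ≤ r → 1 < c →
      FairNN.IsLSHFamily ν h r c p₁ p₂ →
    ∀ (n : ℕ), 0 < n → ∀ (P : Fin n ↪ X) (k L N : ℕ),
      k = FairNN.lshK n p₂ → L = FairNN.lshL n p₁ p₂ → N = t n * L * k →
    ∀ (space : ℝ), space = C * FairNN.lshSpace n p₁ p₂ * FairNN.polylog n p₁ p₂ a →
    -- `D ω` is the data structure built from the independently drawn hash functions `ω`
    ∃ D : (Fin N → H) → ℕ → ℕ,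
      (N : ℝ) ≤ space ∧
      (∀ ω : Fin N → H,
        FairNN.HaltsWithMemory (FairNN.oracle h P ω none (c * r)) (fun _ => 0)
          (FairNN.start pre [n, k, L, t n]) (D ω) ∧
        FairNN.UsesSpace (FairNN.oracle h P ω none (c * r)) (fun _ => 0)
          (FairNN.start pre [n, k, L, t n]) space ∧
        ∀ i : ℕ, (D ω i : ℝ) ≤ space) ∧
      ∀ q : X, ∃ S : (Fin N → H) → Finset X,
        (∀ x : X, MeasurableSet {ω | x ∈ S ω}) ∧
        (∀ ω, (S ω : Set X) ⊆ FairNN.nbr P q (c * r)) ∧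
        1 - 1 / (n : ℝ) ^ b ≤
          (MeasureTheory.Measure.pi (fun _ : Fin N => ν)).real
            {ω | FairNN.nbr P q r ⊆ (S ω : Set X)} ∧
        ∀ ε : ℝ, 0 < ε → ε < 1 →
          (∀ ω,
            FairNN.ApproxUniformOn P (S ω) ε
              (FairNN.outputProb (FairNN.oracle h P ω (some q) (c * r)) (D ω)
                (FairNN.start query [⌈1 / ε⌉₊])) ∧
            FairNN.UsesSpace (FairNN.oracle h P ω (some q) (c * r)) (D ω)
              (FairNN.start query [⌈1 / ε⌉₊]) space) ∧
          MeasureTheory.lintegral (MeasureTheory.Measure.pi (fun _ : Fin N => ν)) (fun ω =>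
              FairNN.expectedTime (FairNN.oracle h P ω (some q) (c * r)) (D ω)
                (FairNN.start query [⌈1 / ε⌉₊])) ≤
            ENNReal.ofReal
              (C * FairNN.lshQuery n p₁ p₂ * Real.log (2 / ε) * FairNN.polylog n p₁ p₂ a) := by
  refine ⟨preProg, queryProg, fun b => ⟨reps b, 1800 * ((2 * b + 10) * (b + 3)), 2, ?_, ?_⟩⟩
  · intro n _
    refine (reps_le b n).trans ?_
    have := Real.log_natCast_nonneg n
    gcongr
    have hb : (0 : ℝ) ≤ b := Nat.cast_nonneg b
    nlinarith
  intro X _ H _ ν _ h r c p₁ p₂ hr hc hh n hn P k L N hk hL hNdef space hspace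
  have hb : (0 : ℝ) ≤ b := Nat.cast_nonneg b
  have hp₁ : 0 < p₁ := hh.p₂_pos.trans hh.p₂_lt_p₁
  set m := reps b n * L with hm
  have hmpos : 0 < m := by
    rw [hm, hL]
    exact Nat.mul_pos (by unfold reps; omega) (lshL_pos hp₁)
  have hN : N = m * k := hNdef
  set ℓ := logNL n p₁ p₂ with hℓ
  have hℓ0 : 0 ≤ ℓ := logNL_nonneg hn hp₁
  have hmle : (m : ℝ) ≤ (b + 3) * (1 + ℓ) * L := by
    rw [hm, hL]; exact tables_le hn hp₁
  have hpoly : polylog n p₁ p₂ 2 = (1 + ℓ) ^ 2 := rfl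
  have hbound : 12 * (m * ((n : ℝ) + k)) ≤ space := by
    rw [hspace, hpoly, lshSpace, ← hk, ← hL]
    calc 12 * (m * ((n : ℝ) + k)) ≤ 12 * ((b + 3) * (1 + ℓ) * L * (n + k)) := by gcongr
      _ = 12 * 1 * ((b + 3) * (L * (n + k)) * (1 + ℓ)) := by ring
      _ ≤ 1800 * (2 * b + 10) * ((b + 3) * (L * (n + k)) * ((1 + ℓ) ^ 2)) := by
        gcongr
        · norm_num
        · linarith
        · nlinarith
      _ = _ := by ring
  have hspaceB : (spaceBound n k m : ℝ) ≤ space := by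
    refine le_trans ?_ hbound
    exact_mod_cast spaceBound_le hn hmpos
  choose D hDhalt hDS hDle using fun ω : Fin N → H =>
    exists_dataStructure (oracle h P ω none (c * r)) (fun _ => 0) n k L (reps b n)
  refine ⟨D, ?_, fun ω => ⟨hDhalt ω, pre_usesSpace n k L (reps b n) hspaceB, fun i => ?_⟩, ?_⟩
  · refine le_trans ?_ hbound
    rw [hN]
    push_cast
    have : (0 : ℝ) ≤ m * n := by positivity
    have : (0 : ℝ) ≤ m * k := by positivity
    linarith
  · exact le_trans (by exact_mod_cast hDle ω i) hspaceB
  intro q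
  have hDq : ∀ ω, IsDS (oracle h P ω (some q) (c * r)) n k m (D ω) := fun ω =>
    (hDS ω).congr (oracle_hash_point h P ω none (some q) (c * r))
  refine ⟨fun ω => pointSet P (found (oracle h P ω (some q) (c * r)) n k m), ?_, ?_, ?_, ?_⟩
  · intro x
    by_cases hx : ∃ a, P a = x
    · obtain ⟨a, rfl⟩ := hx
      have hset : {ω : Fin N → H |
          P a ∈ pointSet P (found (oracle h P ω (some q) (c * r)) n k m)} =
          {ω | dist q (P a) ≤ c * r} ∩
            ⋃ i, ⋃ _ : i < m, tableEvent N m i {w | h w (P a) = h w q} := by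
        ext ω
        simp [mem_pointSet, succ_mem_found hN]
      rw [hset]
      exact (MeasurableSet.const _).inter (MeasurableSet.iUnion fun i => MeasurableSet.iUnion
        fun _ => measurableSet_tableEvent (hh.measurableSet_collision _ _) i)
    · have hset : {ω : Fin N → H |
          x ∈ pointSet P (found (oracle h P ω (some q) (c * r)) n k m)} = ∅ := by
        ext ω
        simp only [Set.mem_ofPred_eq, Set.mem_empty_iff_false, iff_false]
        intro hmem
        obtain ⟨a, -, ha⟩ := Finset.mem_map.1 hmem
        exact hx ⟨a, ha⟩
      rw [hset]
      exact MeasurableSet.empty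
  · intro ω x hx
    rw [Finset.mem_coe] at hx
    obtain ⟨a, -, rfl⟩ := Finset.mem_map.1 hx
    rw [mem_pointSet, succ_mem_found hN] at hx
    exact ⟨⟨a, rfl⟩, hx.1⟩
  · refine le_trans ?_ (measure_near_subset_found hh hr hc.le hN P q)
    have := failure_le (b := b) (p₂ := p₂) hn hp₁ (hh.p₁_le_one hr q)
    rw [← hk, ← hL] at this
    linarith
  intro ε hε hε1
  refine ⟨fun ω => ⟨approxUniformOn_query hmpos (hDq ω) P _ hε, ?_⟩, ?_⟩
  · exact usesSpace_of_wp (good_start queryProg [⌈1 / ε⌉₊] _) (fun _ => 0)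
      (ne_top_of_le_ne_top (ENNReal.natCast_ne_top _) (wp_query_time hmpos (hDq ω) _)) hspaceB
  set A : ℕ := ((n + m).size + 1) * (k + 1) with hA
  have htime : ∀ ω, expectedTime (oracle h P ω (some q) (c * r)) (D ω)
      (start queryProg [⌈1 / ε⌉₊]) ≤ ((300 * A : ℕ) : ℝ≥0∞) *
        ((farSlots (oracle h P ω (some q) (c * r)) n k m (D ω) : ℝ≥0∞) + ((m + 1 : ℕ) : ℝ≥0∞)) := by
    intro ω
    refine (expectedTime_le_wp (good_start queryProg [⌈1 / ε⌉₊] _)).trans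
      ((wp_query_time hmpos (hDq ω) _).trans ?_)
    have := queryTime_le n k m (farSlots (oracle h P ω (some q) (c * r)) n k m (D ω))
    rw [← hA] at this
    rw [← Nat.cast_add, ← Nat.cast_mul]
    exact Nat.cast_le.2 (this.trans_eq (by ring))
  have hfar : ∫⁻ ω, (farSlots (oracle h P ω (some q) (c * r)) n k m (D ω) : ℝ≥0∞)
      ∂(Measure.pi (fun _ : Fin N => ν)) ≤ m := by
    refine (lintegral_farSlots_le hh hN P D q hDq).trans ?_
    refine mul_le_of_le_one_right zero_le ?_
    rw [← ENNReal.ofReal_pow hh.p₂_pos.le, ← ENNReal.ofReal_natCast,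
      ← ENNReal.ofReal_mul (Nat.cast_nonneg n), hk]
    exact ENNReal.ofReal_le_one.2 (n_mul_pow_le_one hn hh.p₂_pos hh.p₂_lt_one)
  refine (lintegral_mono htime).trans ?_
  rw [lintegral_const_mul' _ _ (ENNReal.natCast_ne_top _), lintegral_add_right _ measurable_const,
    lintegral_const, measure_univ, mul_one]
  calc ((300 * A : ℕ) : ℝ≥0∞) * (_ + ((m + 1 : ℕ) : ℝ≥0∞))
      ≤ ((300 * A : ℕ) : ℝ≥0∞) * (m + ((m + 1 : ℕ) : ℝ≥0∞)) := by gcongr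
    _ = ENNReal.ofReal (300 * A * (2 * m + 1)) := by
        have hcast : (300 * A * (2 * m + 1) : ℝ) = ((300 * A * (2 * m + 1) : ℕ) : ℝ) := by
          push_cast; rfl
        rw [hcast, ENNReal.ofReal_natCast]
        push_cast
        ring
    _ ≤ _ := ?_
  apply ENNReal.ofReal_le_ofReal
  rw [hpoly, lshQuery, ← hk, ← hL]
  have hm1 : (1 : ℝ) ≤ m := by exact_mod_cast hmpos
  have hAle : (A : ℝ) ≤ (2 * b + 10) * (1 + ℓ) * (k + 1) := by
    rw [hA]
    push_cast
    gcongr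
    have := size_succ_le (b := b) (p₂ := p₂) hn hp₁
    rw [← hL] at this
    exact this
  have hlog : (1 / 2 : ℝ) ≤ Real.log (2 / ε) := by
    have h2 : Real.log 2 ≤ Real.log (2 / ε) :=
      Real.log_le_log two_pos (by rw [le_div_iff₀ hε]; linarith)
    linarith [Real.log_two_gt_d9]
  calc (300 : ℝ) * A * (2 * m + 1) ≤ 300 * A * (2 * m + m) := by gcongr
    _ = 900 * A * m := by ring
    _ ≤ 900 * ((2 * b + 10) * (1 + ℓ) * (k + 1)) * ((b + 3) * (1 + ℓ) * L) := by gcongr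
    _ = 1800 * ((2 * b + 10) * (b + 3)) * (L * (k + 1)) * (1 / 2) * (1 + ℓ) ^ 2 := by ring
    _ ≤ _ := by gcongr
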